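/- **Setting.** A *causal triangulation with $N\ge 1$ slices* is a finite connected rooted planar map $T$ (loops and multiple edges allowed), considered up to orientation- and root-preserving isomorphism, such that: there is no loop at the root vertex; for each $1\le i\le N$ the vertices at graph distance $i$ from the root vertex, together with the edges connecting them, form a cycle $S_i$ (a cycle on one vertex being a loop, a cycle on two vertices a double edge), and no vertex is at distance larger than $N$; all faces are triangles except the external face, which is bounded by $S_N$; and one edge attached to the root vertex is marked. Let $\mathcal T_{N,l}$ be the set of those with $l\ge 1$ vertices on $S_N$, let $F(T)$ be the set of triangles of $T$ (the external face is not counted), $V(T)$ and $E(T)$ its sets of vertices and edges, and let $T^*$ be the dual graph of $T$: its vertices are all faces of $T$, including the external face, and its edges are dual to the edges of $T$. For a graph $G$ and $\sigma\in\{\pm1\}^{V(G)}$ put $H(G,\sigma)=-\sum_{(u,v)\in E(G)}\sigma_u\sigma_v$. For real $\beta\ge 0$ and $\mu$ define, with values in $[0,\infty]$, $$Z_{N,l}(\beta,\mu)=\sum_{T\in\mathcal T_{N,l}}\ \sum_{\sigma\in\{\pm1\}^{V(T)}}e^{-\beta H(T,\sigma)-\mu|F(T)|},\qquad Z^{\Delta}_{N,l}(\beta,\mu)=\sum_{T\in\mathcal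 T_{N,l}}\ \sum_{\sigma\in\{\pm1\}^{V(T^*)}}e^{-\beta H(T^*,\sigma)-\mu|F(T)|}.$$ Let $\mu^c_{N,l}(\beta)=\inf\{\mu\in\mathbb R: Z_{N,l}(\beta,\mu)<\infty\}$ and $\mu^{*c}_{N,l}(\beta)=\inf\{\mu\in\mathbb R: Z^{\Delta}_{N,l}(\beta,\mu)<\infty\}$, in $[-\infty,\infty]$, and let $\mu_c(\beta)=\sup_{N,l}\mu^c_{N,l}(\beta)$ and $\mu^*_c(\beta)=\sup_{N,l}\mu^{*c}_{N,l}(\beta)$ be the critical line and the dual critical line. **Corollary (dual critical line).** 1. Let $\beta>0$ and let $\beta^*$ satisfy $\tanh\beta^*=e^{-2\beta}$. For all $N,l\ge1$ and $\mu\in\mathbb R$, with $\mu^*=\mu+\frac14\log2-\frac34\log\sinh2\beta$, $$Z^{\Delta}_{N,l}(\beta^*,\mu^*)=(2\sinh2\beta)^{-l/4}\,Z_{N,l}(\beta,\mu)$$ (both sides may be $+\infty$). Moreover $\mu^*_c(\beta^*)=\mu_c(\beta)+\frac14\log2-\frac34\log\sinh2\beta$. 2. For every $\beta^*\ge0$ and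 every $l\ge1$, $\mu^*_c(\beta^*)$ is finite and $\mu^{*c}_{N,l}(\beta^*)\to\mu^*_c(\beta^*)$ as $N\to\infty$. The function $\mu^*_c$ is monotone non-decreasing on $[0,\infty)$ and has at most countably many points of discontinuity (jumps). 3. For every $\beta^*\ge0$, $$\max\Big\{2\log2+\tfrac32\log\cosh\beta^*,\ \log2+\tfrac32\beta^*\Big\}\ \le\ \mu^*_c(\beta^*)\ \le\ 2\log2+\tfrac12\beta^*+\log\cosh\beta^*.$$ 4. $\mu^*_c(\beta^*)=2\log2+O(\beta^*)$ as $\beta^*\downarrow0$, and $\mu^*_c(\beta^*)=\log2+\frac32\beta^*+O(e^{-2\beta^*})$ as $\beta^*\to\infty$. -/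

import Mathlib

open Filter Topology Asymptotics
open scoped ENNReal

namespace CDT

/-- A finite rooted map (graph embedded in an oriented surface), given by its rotation system on a
set `D` of darts (oriented edges): `rot` turns a dart to the next one around its source vertex,
`flip` reverses a dart, and `root` is the marked dart. Loops and multiple edges are allowed. -/
structure RootedMap (D : Type) where
  rot : Equiv.Perm D
  flip : Equiv.Perm D
  root : D
  flip_flip : ∀ d, flip (flip d) = d
  flip_ne : ∀ d, flip d ≠ d

namespace RootedMap

variable {D : Type} (M : RootedMap D)

/-- Vertices are the cycles of the rotation. -/
def Vertex : Type := Quotient (Equiv.Perm.SameCycle.setoid M.rot)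

/-- Edges are the pairs `{d, flip d}`. -/
def Edge : Type := Quotient (Equiv.Perm.SameCycle.setoid M.flip)

/-- The permutation that follows the boundary of a face: reverse a dart, then turn. -/
def facePerm : Equiv.Perm D := M.rot * M.flip

/-- Faces (the external one included) are the cycles of `facePerm`. -/
def Face : Type := Quotient (Equiv.Perm.SameCycle.setoid M.facePerm)

/-- The source vertex of a dart; the target of `d` is `M.source (M.flip d)`. -/
def source (d : D) : M.Vertex := Quotient.mk _ d

/-- The face on one fixed side of a dart; the face across the edge is `M.face (M.flip d)`. -/
def face (d : D) : M.Face := Quotient.mk _ d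

/-- The root vertex: the source of the root dart. -/
def rootVertex : M.Vertex := M.source M.root

/-- The simple graph underlying the map; it carries connectedness and the graph distance. -/
def graph : SimpleGraph M.Vertex where
  Adj u v := u ≠ v ∧ ∃ d, M.source d = u ∧ M.source (M.flip d) = v
  symm := ⟨by
    rintro u v ⟨h, d, rfl, rfl⟩
    exact ⟨h.symm, M.flip d, rfl, by rw [M.flip_flip]⟩⟩
  loopless := ⟨fun _ h => h.1 rfl⟩

/-- The map lies on the sphere: Euler's formula. -/
def IsPlanar : Prop :=
  (Nat.card M.Vertex : ℤ) - Nat.card M.Edge + Nat.card M.Face = 2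

/-- The set of vertices at graph distance `i` from the root. -/
def slice (i : ℕ) : Set M.Vertex := {v | M.graph.dist M.rootVertex v = i}

/-- The vertices in `S`, with all edges of the map joining them, form a cycle: they induce a
connected multigraph that is regular of degree two (a loop counts twice). A cycle with one vertex
is a loop, and a cycle with two vertices is a double edge. -/
def FormsCycle (S : Set M.Vertex) : Prop :=
  (M.graph.induce S).Connected ∧
    ∀ v ∈ S, {d : D | M.source d = v ∧ M.source (M.flip d) ∈ S}.ncard = 2

/-- Causal triangulations with slices `S₁, …, S_N` around the root, `l` vertices on `S_N`. All
faces are triangles except the external face, which is bounded by the last slice. -/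
structure IsCausal (N l : ℕ) : Prop where
  connected : M.graph.Connected
  planar : M.IsPlanar
  no_root_loop : ∀ d, M.source d = M.rootVertex → M.source (M.flip d) ≠ M.rootVertex
  slices : ∀ i, 1 ≤ i → i ≤ N → M.FormsCycle (M.slice i)
  last : ∀ i, N < i → M.slice i = ∅
  boundary : (M.slice N).ncard = l
  triangles : ∃ f₀ : M.Face, (∀ d, M.face d = f₀ → M.source d ∈ M.slice N) ∧
    ∀ f : M.Face, f ≠ f₀ → {d : D | M.face d = f}.ncard = 3

/-- The number `|F(T)|` of triangles: all faces but the external one. -/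
noncomputable def triangleCount : ℕ := Nat.card M.Face - 1

/-- The energy `H(T, s) = - ∑ s_u s_v` of spins on the vertices, summed over the edges `(u, v)`;
the half is there because each edge consists of two darts. -/
noncomputable def energy [Fintype D] (s : M.Vertex → ℤˣ) : ℝ :=
  -((1 / 2) * ∑ d : D, ((s (M.source d) : ℤ) : ℝ) * ((s (M.source (M.flip d)) : ℤ) : ℝ))

/-- The energy `H(T*, s)` of spins on the vertices of the dual graph, that is on all faces, the
external face included; each edge joins the faces on its two sides. -/
noncomputable def dualEnergy [Fintype D] (s : M.Face → ℤˣ) : ℝ :=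
  -((1 / 2) * ∑ d : D, ((s (M.face d) : ℤ) : ℝ) * ((s (M.face (M.flip d)) : ℤ) : ℝ))

/-- `∑_s exp (-β H(T, s) - μ |F(T)|)` over spin configurations on the vertices. -/
noncomputable def weight [Fintype D] (β μ : ℝ) : ℝ≥0∞ :=
  ∑' s : M.Vertex → ℤˣ, ENNReal.ofReal (Real.exp (-β * M.energy s - μ * M.triangleCount))

/-- `∑_s exp (-β H(T*, s) - μ |F(T)|)` over spin configurations on the faces. -/
noncomputable def dualWeight [Fintype D] (β μ : ℝ) : ℝ≥0∞ :=
  ∑' s : M.Face → ℤˣ, ENNReal.ofReal (Real.exp (-β * M.dualEnergy s - μ * M.triangleCount))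

/-- Isomorphism of rooted maps (orientation preserving, respecting the root). -/
def Iso {D' : Type} (M : RootedMap D) (M' : RootedMap D') : Prop :=
  ∃ e : D ≃ D', (∀ d, e (M.rot d) = M'.rot (e d)) ∧ (∀ d, e (M.flip d) = M'.flip (e d)) ∧
    e M.root = M'.root

end RootedMap

/-- Causal triangulations in the class `(N, l)` with darts labelled by some `Fin n`. -/
def LabelledTriangulation (N l : ℕ) : Type :=
  {M : (n : ℕ) × RootedMap (Fin n) // M.2.IsCausal N l}

/-- Two labelled triangulations are identified when they are isomorphic as rooted maps. -/
instance isoSetoid (N l : ℕ) : Setoid (LabelledTriangulation N l) where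
  r M M' := M.1.2.Iso M'.1.2
  iseqv :=
    { refl := fun M => ⟨Equiv.refl _, fun _ => rfl, fun _ => rfl, rfl⟩
      symm := by
        rintro M M' ⟨e, h₁, h₂, h₃⟩
        refine ⟨e.symm, fun d => ?_, fun d => ?_, ?_⟩
        · rw [Equiv.symm_apply_eq, h₁, Equiv.apply_symm_apply]
        · rw [Equiv.symm_apply_eq, h₂, Equiv.apply_symm_apply]
        · rw [Equiv.symm_apply_eq, h₃]
      trans := by
        rintro M M' M'' ⟨e, h₁, h₂, h₃⟩ ⟨e', h₁', h₂', h₃'⟩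
        refine ⟨e.trans e', fun d => ?_, fun d => ?_, ?_⟩
        · simp [h₁, h₁']
        · simp [h₂, h₂']
        · simp [h₃, h₃'] }

/-- The set `𝒯_{N,l}` of causal triangulations, up to isomorphism. -/
def Triangulation (N l : ℕ) : Type := Quotient (isoSetoid N l)

/-- The rooted map of a triangulation: a representative of the isomorphism class. The weights
below do not depend on the representative. -/
noncomputable def Triangulation.toMap {N l : ℕ} (T : Triangulation N l) :
    RootedMap (Fin (Quotient.out T).1.1) :=
  (Quotient.out T).1.2

/-- `Z_{N,l}(β, μ)`: Ising spins on the vertices, annealed over causal triangulations. -/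
noncomputable def partitionFunction (N l : ℕ) (β μ : ℝ) : ℝ≥0∞ :=
  ∑' T : Triangulation N l, T.toMap.weight β μ

/-- `Z^Δ_{N,l}(β, μ)`: Ising spins on the faces, annealed over causal triangulations. -/
noncomputable def dualPartitionFunction (N l : ℕ) (β μ : ℝ) : ℝ≥0∞ :=
  ∑' T : Triangulation N l, T.toMap.dualWeight β μ

/-- The threshold in `μ` above which a partition function, decreasing in `μ`, is finite; it is
`-∞` when the partition function is finite for all `μ` (as happens for `N = 1`). -/
noncomputable def threshold (Z : ℝ → ℝ≥0∞) : EReal :=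
  sInf ((fun μ : ℝ => (μ : EReal)) '' {μ : ℝ | Z μ < ∞})

/-- `μ^c_{N,l}(β)`. -/
noncomputable def criticalPoint (N l : ℕ) (β : ℝ) : EReal :=
  threshold (partitionFunction N l β)

/-- The critical point of the dual model with fixed `N` and `l`. -/
noncomputable def dualCriticalPoint (N l : ℕ) (β : ℝ) : EReal :=
  threshold (dualPartitionFunction N l β)

/-- The critical line `μ_c(β)` of the model with spins on the vertices. -/
noncomputable def criticalLine (β : ℝ) : ℝ := (⨆ N, ⨆ l, criticalPoint N l β).toReal

/-- The dual critical line `μ*_c(β)`, of the model with spins on the faces. -/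
noncomputable def dualCriticalLine (β : ℝ) : ℝ := (⨆ N, ⨆ l, dualCriticalPoint N l β).toReal

end CDT

/-!
The whole statement rests on an encoding of causal triangulations by words, and on the duality of
the Ising model on a planar map.

*Duality.* Expanding `exp (β s s') = cosh β (1 + s s' tanh β)` over the edges writes the sum over
spins on the faces of a map as a sum of `tanh β ^ |A|` over the sets `A` of edges that are even
in the dual graph (`RootedMap.sum_exp_dualEnergy`). Grouping the spins on the vertices by their
domain walls writes the other sum as one of `exp (-2β) ^ |A|` over the domain walls, which are even
sets (`RootedMap.sum_exp_energy`). By Euler's formula both families have the same cardinality, hence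
coincide, so that the weights are proportional as soon as `tanh β* = exp (-2β)`
(`RootedMap.IsCausal.dualWeight_dual`). The factor depends on the numbers of edges and faces only,
which are determined by the number of triangles and by `l`. Summing over triangulations gives the
duality of the partition functions, and a shift of all thresholds. The high-temperature expansion
has nonnegative coefficients, which gives the monotonicity in `β`.

*Codes.* The strip between two consecutive slices is a cyclic chain of triangles, each with its
base on the upper or on the lower slice. Cutting every strip along an edge determined by the root
turns a causal triangulation into a family of words in two letters (`Code`). Every code is realised
by a map (`Code.map`, `Code.isCausal`), every causal triangulation has a code
(`RootedMap.IsCausal.exists_code`), and different codes give different triangulations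
(`Code.eq_of_iso`), so that the partition functions are sums over codes
(`dualPartitionFunction_eq`).

*Bounds.* For the upper bound the interactions across the slices are bounded by `1`. The strips
become independent cyclic Ising chains, and the words are summed as a geometric series
(`dualPartitionFunction_lt_top`). For the lower bound the weight of a triangulation is at least its
ground state term, and at least the term of the empty set in the high-temperature expansion, while
the triangulations with slices of equal length `m` already have the entropy `log 2` per triangle as
`m` and `N` grow, by the size of the central binomial coefficient
(`le_of_dualPartitionFunction_lt_top`).

*Limit in `N`.* A further strip can be put on top of any triangulation, with any length of the new
boundary, at the cost of a constant factor (`Code.dualWeight_snoc`). Hence every critical point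
`(N, l')` lies below the critical point `(N + 1, l)`, and for fixed `l` the critical points increase
to the supremum over all `N` and `l`. The remaining claims follow from the monotonicity and the
bounds.
-/

namespace CDT

/-! ### Ising sums on finite multigraphs -/

section Multigraph

variable {E F : Type} (f g : E → F)

/-- A set `A` of edges of the multigraph on `F` with endpoint maps `f` and `g` is even when every
vertex has even degree in `A`, expressed through characters: every product of spins over the
endpoints of `A` is `1`. -/
def IsEvenSet (A : Finset E) : Prop :=
  ∀ s : F → ℤˣ, ∏ e ∈ A, s (f e) * s (g e) = 1

open Classical in
/-- The finite set of all even sets of edges. -/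
noncomputable def evenSets [Fintype E] : Finset (Finset E) := Finset.univ.filter (IsEvenSet f g)

open Classical in
/-- Orthogonality of characters of the group of spin configurations. -/
theorem sum_prod_spins [Fintype F] (A : Finset E) :
    ∑ s : F → ℤˣ, (((∏ e ∈ A, s (f e) * s (g e) : ℤˣ) : ℤ) : ℝ) =
      if IsEvenSet f g A then 2 ^ Fintype.card F else 0 := by
  split_ifs with h
  · have : ∀ s : F → ℤˣ, (((∏ e ∈ A, s (f e) * s (g e) : ℤˣ) : ℤ) : ℝ) = 1 := fun s => by
      rw [h s]; simp
    simp only [this]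
    simp
  · simp only [IsEvenSet, not_forall] at h
    obtain ⟨s₀, h₀⟩ := h
    have h₁ : ∏ e ∈ A, s₀ (f e) * s₀ (g e) = -1 := (Int.units_eq_one_or _).resolve_left h₀
    have key : ∑ s : F → ℤˣ, (((∏ e ∈ A, s (f e) * s (g e) : ℤˣ) : ℤ) : ℝ) =
        -∑ s : F → ℤˣ, (((∏ e ∈ A, s (f e) * s (g e) : ℤˣ) : ℤ) : ℝ) := by
      rw [← Finset.sum_neg_distrib]
      refine Fintype.sum_equiv (Equiv.mulLeft s₀) _ _ fun s => ?_
      have : ∏ e ∈ A, (Equiv.mulLeft s₀ s) (f e) * (Equiv.mulLeft s₀ s) (g e) =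
          -∏ e ∈ A, s (f e) * s (g e) := by
        rw [← neg_one_mul, ← h₁, ← Finset.prod_mul_distrib]
        refine Finset.prod_congr rfl fun e _ => ?_
        simp only [Equiv.coe_mulLeft, Pi.mul_apply]
        exact mul_mul_mul_comm _ _ _ _
      rw [this]; simp
    linarith

/-- Only even sets survive when the product over the edges is expanded and
summed over the spins. -/
theorem sum_prod_one_add [Fintype E] [Fintype F] [DecidableEq F] (t : ℝ) :
    ∑ s : F → ℤˣ, ∏ e, (1 + t * (((s (f e) * s (g e) : ℤˣ) : ℤ) : ℝ)) =
      2 ^ Fintype.card F * ∑ A ∈ evenSets f g, t ^ A.card := by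
  have h : ∀ s : F → ℤˣ, ∏ e, (1 + t * (((s (f e) * s (g e) : ℤˣ) : ℤ) : ℝ)) =
      ∑ A : Finset E, t ^ A.card * (((∏ e ∈ A, s (f e) * s (g e) : ℤˣ) : ℤ) : ℝ) := by
    intro s
    rw [Finset.prod_one_add, Finset.powerset_univ]
    refine Finset.sum_congr rfl fun A _ => ?_
    rw [Finset.prod_mul_distrib, Finset.prod_const]
    push_cast
    rfl
  simp only [h]
  rw [Finset.sum_comm]
  have h' := fun A => sum_prod_spins f g A
  simp only [← Finset.mul_sum, evenSets, Finset.sum_filter]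
  rw [Finset.mul_sum]
  refine Finset.sum_congr rfl fun A _ => ?_
  convert congrArg (t ^ A.card * ·) (h' A) using 1
  · congr!
  · split_ifs <;> ring

theorem exp_mul_spin (β : ℝ) (u : ℤˣ) :
    Real.exp (β * ((u : ℤ) : ℝ)) = Real.cosh β * (1 + Real.tanh β * ((u : ℤ) : ℝ)) := by
  have hc := (Real.cosh_pos β).ne'
  rcases Int.units_eq_one_or u with rfl | rfl
  · rw [Real.tanh_eq_sinh_div_cosh]
    field_simp
    simp [Real.cosh_eq, Real.sinh_eq]
    ring
  · rw [Real.tanh_eq_sinh_div_cosh]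
    field_simp
    simp [Real.cosh_eq, Real.sinh_eq]
    ring

/-- The high-temperature expansion: the partition function of the Ising model is a sum over even
sets of edges. -/
theorem high_temperature [Fintype E] [Fintype F] [DecidableEq F] (β : ℝ) :
    ∑ s : F → ℤˣ, Real.exp (β * ∑ e, (((s (f e) * s (g e) : ℤˣ) : ℤ) : ℝ)) =
      Real.cosh β ^ Fintype.card E *
        (2 ^ Fintype.card F * ∑ A ∈ evenSets f g, Real.tanh β ^ A.card) := by
  rw [← sum_prod_one_add, Finset.mul_sum]
  refine Finset.sum_congr rfl fun s => ?_
  rw [Finset.mul_sum, Real.exp_sum]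
  simp only [exp_mul_spin]
  rw [Finset.prod_mul_distrib]
  simp

theorem empty_mem_evenSets [Fintype E] : ∅ ∈ evenSets f g := by
  simp [evenSets, IsEvenSet]

/-- In a connected multigraph there are `2 ^ (|E| - |F| + 1)` even sets. -/
theorem card_evenSets [Fintype E] [Fintype F] [Nonempty F]
    (conn : ∀ s : F → ℤˣ, (∀ e, s (f e) = s (g e)) → ∀ x y, s x = s y) :
    2 ^ Fintype.card F * (evenSets f g).card = 2 ^ Fintype.card E * 2 := by
  classical
  have h1 := sum_prod_one_add f g 1
  have h2 : ∀ s : F → ℤˣ, ∏ e, (1 + 1 * (((s (f e) * s (g e) : ℤˣ) : ℤ) : ℝ)) =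
      if ∀ x y, s x = s y then 2 ^ Fintype.card E else 0 := by
    intro s
    split_ifs with h
    · rw [← Finset.card_univ, ← Finset.prod_const]
      refine Finset.prod_congr rfl fun e _ => ?_
      rw [h (f e) (g e)]
      norm_num
    · have : ¬ ∀ e, s (f e) = s (g e) := fun h' => h (conn s h')
      push Not at this
      obtain ⟨e, he⟩ := this
      refine Finset.prod_eq_zero (Finset.mem_univ e) ?_
      have : s (f e) * s (g e) = -1 := by
        rcases Int.units_eq_one_or (s (f e)) with a | a <;>
          rcases Int.units_eq_one_or (s (g e)) with b | b <;> simp_all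
      rw [this]; simp
  simp only [h2] at h1
  rw [← Finset.sum_filter] at h1
  have h3 : (Finset.univ.filter (fun s : F → ℤˣ => ∀ x y, s x = s y)).card = 2 := by
    have : Finset.univ.filter (fun s : F → ℤˣ => ∀ x y, s x = s y) =
        {(fun _ => 1), (fun _ => -1)} := by
      ext s
      simp only [Finset.mem_filter, Finset.mem_univ, true_and, Finset.mem_insert,
        Finset.mem_singleton]
      constructor
      · intro h
        obtain ⟨x⟩ := ‹Nonempty F›
        rcases Int.units_eq_one_or (s x) with a | a
        · left; funext y; rw [h y x, a]
        · right; funext y; rw [h y x, a]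
      · rintro (rfl | rfl) <;> simp
    rw [this, Finset.card_pair]
    intro h
    obtain ⟨x⟩ := ‹Nonempty F›
    have := congrFun h x
    revert this; decide
  rw [Finset.sum_const, h3] at h1
  simp at h1
  have h4 : ((2 ^ Fintype.card F * (evenSets f g).card : ℕ) : ℝ) =
      ((2 ^ Fintype.card E * 2 : ℕ) : ℝ) := by
    push_cast
    linarith
  exact_mod_cast h4

end Multigraph

/-! ### Darts, edges and faces of a rooted map -/

namespace RootedMap

variable {D : Type} (M : RootedMap D)

theorem sameCycle_flip_iff {d d' : D} : M.flip.SameCycle d d' ↔ d' = d ∨ d' = M.flip d := by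
  constructor
  · rintro ⟨n, rfl⟩
    rcases Int.even_or_odd n with ⟨k, rfl⟩ | ⟨k, rfl⟩
    · left
      have h : M.flip ^ (2 : ℤ) = 1 := by
        ext x; rw [zpow_two]; simp [M.flip_flip]
      rw [← two_mul, zpow_mul, h]; simp
    · right
      have h : M.flip ^ (2 : ℤ) = 1 := by
        ext x; rw [zpow_two]; simp [M.flip_flip]
      rw [zpow_add, zpow_mul, h]; simp
  · rintro (rfl | rfl)
    · exact Equiv.Perm.SameCycle.refl _ _
    · exact ⟨1, by simp⟩

/-- The edge of a dart. -/
def edge (d : D) : M.Edge := Quotient.mk _ d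

/-- A dart on each edge. -/
noncomputable def edgeDart (e : M.Edge) : D := Quotient.out e

theorem edge_edgeDart (e : M.Edge) : M.edge (M.edgeDart e) = e := Quotient.out_eq _

theorem edge_eq_iff {d d' : D} : M.edge d = M.edge d' ↔ d' = d ∨ d' = M.flip d := by
  rw [← sameCycle_flip_iff]
  exact Quotient.eq (r := Equiv.Perm.SameCycle.setoid M.flip)

theorem edge_flip (d : D) : M.edge (M.flip d) = M.edge d :=
  M.edge_eq_iff.2 (Or.inr (M.flip_flip d).symm)

/-- Every edge consists of two darts. -/
noncomputable def dartEquiv : M.Edge × Bool ≃ D :=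
  Equiv.ofBijective (fun p => if p.2 then M.flip (M.edgeDart p.1) else M.edgeDart p.1) <| by
    constructor
    · rintro ⟨e, b⟩ ⟨e', b'⟩ h
      have he : e = e' := by
        have := congrArg M.edge h
        cases b <;> cases b' <;> simpa [edge_flip, edge_edgeDart] using this
      subst he
      cases b <;> cases b' <;> simp at h ⊢
      · exact M.flip_ne _ h.symm
      · exact M.flip_ne _ h
    · intro d
      rcases M.edge_eq_iff.1 (M.edge_edgeDart (M.edge d)) with h | h
      · exact ⟨(M.edge d, false), by simp [← h]⟩
      · exact ⟨(M.edge d, true), by simp [← h]⟩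

instance [Finite D] : Finite M.Edge := inferInstanceAs (Finite (Quotient _))
instance [Finite D] : Finite M.Vertex := inferInstanceAs (Finite (Quotient _))
instance [Finite D] : Finite M.Face := inferInstanceAs (Finite (Quotient _))
noncomputable instance [Finite D] : Fintype M.Edge := Fintype.ofFinite _
noncomputable instance [Finite D] : Fintype M.Vertex := Fintype.ofFinite _
noncomputable instance [Finite D] : Fintype M.Face := Fintype.ofFinite _
noncomputable instance : DecidableEq M.Edge := Classical.decEq _
noncomputable instance : DecidableEq M.Vertex := Classical.decEq _
noncomputable instance : DecidableEq M.Face := Classical.decEq _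
instance : Nonempty M.Face := ⟨M.face M.root⟩
instance : Nonempty M.Vertex := ⟨M.source M.root⟩

theorem prod_darts [Fintype D] {A : Type*} [CommMonoid A] (G : D → A) :
    ∏ d, G d = ∏ e : M.Edge, G (M.edgeDart e) * G (M.flip (M.edgeDart e)) := by
  rw [← Fintype.prod_equiv M.dartEquiv (fun p => G (M.dartEquiv p)) G (fun _ => rfl),
    Fintype.prod_prod_type]
  refine Finset.prod_congr rfl fun e _ => ?_
  rw [Fintype.prod_bool, mul_comm]
  rfl

theorem sum_darts [Fintype D] {A : Type*} [AddCommMonoid A] (G : D → A) :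
    ∑ d, G d = ∑ e : M.Edge, (G (M.edgeDart e) + G (M.flip (M.edgeDart e))) :=
  M.prod_darts (A := Multiplicative A) G

theorem card_darts [Fintype D] : Fintype.card D = 2 * Fintype.card M.Edge := by
  rw [← Fintype.card_congr M.dartEquiv, Fintype.card_prod, Fintype.card_bool, mul_comm]

theorem source_rot (d : D) : M.source (M.rot d) = M.source d :=
  Quotient.sound (s := Equiv.Perm.SameCycle.setoid M.rot) ⟨-1, by simp⟩

theorem face_facePerm (d : D) : M.face (M.facePerm d) = M.face d :=
  Quotient.sound (s := Equiv.Perm.SameCycle.setoid M.facePerm) ⟨-1, by simp⟩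

theorem facePerm_apply (d : D) : M.facePerm d = M.rot (M.flip d) := rfl

theorem source_facePerm (d : D) : M.source (M.facePerm d) = M.source (M.flip d) :=
  M.source_rot _

theorem source_eq_iff {d d' : D} : M.source d = M.source d' ↔ M.rot.SameCycle d d' :=
  Quotient.eq (r := Equiv.Perm.SameCycle.setoid M.rot)

theorem face_eq_iff {d d' : D} : M.face d = M.face d' ↔ M.facePerm.SameCycle d d' :=
  Quotient.eq (r := Equiv.Perm.SameCycle.setoid M.facePerm)

theorem source_surjective : Function.Surjective M.source := Quotient.mk_surjective

theorem face_surjective : Function.Surjective M.face := Quotient.mk_surjective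

theorem eq_of_sameCycle {X : Type*} (π : Equiv.Perm D) (F : D → X) (h : ∀ d, F (π d) = F d)
    {d d' : D} (hd : π.SameCycle d d') : F d = F d' := by
  have h' : ∀ d, F (π⁻¹ d) = F d := fun d => by rw [← h (π⁻¹ d)]; simp
  obtain ⟨n, rfl⟩ := hd
  induction n using Int.induction_on generalizing d with
  | zero => simp
  | succ n ih => rw [zpow_add, zpow_one, Equiv.Perm.mul_apply, ← ih, h]
  | pred n ih => rw [zpow_sub, zpow_one, Equiv.Perm.mul_apply, ← ih, h']

/-- A function on darts that is invariant under the two generating permutations is constant. -/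
def DartConnected : Prop :=
  ∀ F : D → Prop, (∀ d, F (M.rot d) = F d) → (∀ d, F (M.flip d) = F d) → ∀ d d', F d = F d'

theorem DartConnected.eq {M : RootedMap D} (h : M.DartConnected) {X : Type*} (F : D → X)
    (h₁ : ∀ d, F (M.rot d) = F d) (h₂ : ∀ d, F (M.flip d) = F d) (d d' : D) : F d = F d' := by
  have := h (fun x => F x = F d') (fun x => by simp only [h₁]) (fun x => by simp only [h₂]) d d'
  simpa using this

theorem dartConnected_of_connected (h : M.graph.Connected) : M.DartConnected := by
  intro F h₁ h₂
  have hs : ∀ {d d'}, M.source d = M.source d' → F d = F d' := fun hd =>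
    eq_of_sameCycle M.rot F h₁ (M.source_eq_iff.1 hd)
  have hw : ∀ {u v : M.Vertex}, M.graph.Walk u v →
      ∀ d d', M.source d = u → M.source d' = v → F d = F d' := by
    intro u v w
    induction w with
    | nil => intro d d' h h'; exact hs (h.trans h'.symm)
    | cons hadj _ ih =>
      intro d d' h h'
      obtain ⟨-, x, hx, hx'⟩ := hadj
      rw [hs (h.trans hx.symm), ← h₂ x]
      exact ih _ _ hx' h'
  intro d d'
  obtain ⟨w⟩ := h.preconnected (M.source d) (M.source d')
  exact hw w d d' rfl rfl

theorem connected_of_dartConnected (h : M.DartConnected) : M.graph.Connected := by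
  have key : ∀ d, M.graph.Reachable M.rootVertex (M.source d) := by
    intro d
    have := h.eq (fun x => M.graph.Reachable M.rootVertex (M.source x))
      (fun x => by simp only [source_rot]) (fun x => ?_) d M.root
    · rw [this]; exact SimpleGraph.Reachable.refl _
    · have hadj : M.graph.Reachable (M.source x) (M.source (M.flip x)) := by
        by_cases hx : M.source x = M.source (M.flip x)
        · rw [hx]
        · exact SimpleGraph.Adj.reachable ⟨hx, x, rfl, rfl⟩
      exact propext ⟨fun hr => hr.trans hadj.symm, fun hr => hr.trans hadj⟩
  refine ⟨fun u v => ?_⟩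
  obtain ⟨d, rfl⟩ := M.source_surjective u
  obtain ⟨d', rfl⟩ := M.source_surjective v
  exact (key d).symm.trans (key d')

theorem spins_const_of_vertex (h : M.DartConnected) (s : M.Vertex → ℤˣ)
    (hs : ∀ e, s (M.source (M.edgeDart e)) = s (M.source (M.flip (M.edgeDart e)))) (x y) :
    s x = s y := by
  obtain ⟨d, rfl⟩ := M.source_surjective x
  obtain ⟨d', rfl⟩ := M.source_surjective y
  refine h.eq (fun d => s (M.source d)) (fun d => by simp only [source_rot]) (fun d => ?_) d d'
  rcases M.edge_eq_iff.1 (M.edge_edgeDart (M.edge d)) with h | h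
  · rw [h, hs]
  · rw [h, M.flip_flip, hs]

/-- The dual graph is connected, in terms of spins. -/
theorem spins_const_of_face (h : M.DartConnected) (s : M.Face → ℤˣ)
    (hs : ∀ e, s (M.face (M.edgeDart e)) = s (M.face (M.flip (M.edgeDart e)))) (x y) :
    s x = s y := by
  obtain ⟨d, rfl⟩ := M.face_surjective x
  obtain ⟨d', rfl⟩ := M.face_surjective y
  have hf : ∀ d, s (M.face (M.flip d)) = s (M.face d) := by
    intro d
    rcases M.edge_eq_iff.1 (M.edge_edgeDart (M.edge d)) with h | h
    · rw [h, hs]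
    · rw [h, M.flip_flip, hs]
  refine h.eq (fun d => s (M.face d)) (fun d => ?_) hf d d'
  have := M.face_facePerm (M.flip d)
  rw [facePerm_apply, M.flip_flip] at this
  simp only [this, hf]

/-! ### Kramers–Wannier duality -/

section Duality

variable [Fintype D]

/-- The even sets of edges of the dual graph. -/
noncomputable abbrev dualEvenSets : Finset (Finset M.Edge) :=
  evenSets (fun e => M.face (M.edgeDart e)) (fun e => M.face (M.flip (M.edgeDart e)))

/-- The domain walls of a spin configuration on the vertices. -/
noncomputable def cut (s : M.Vertex → ℤˣ) : Finset M.Edge :=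
  Finset.univ.filter fun e => s (M.source (M.edgeDart e)) * s (M.source (M.flip (M.edgeDart e))) ≠ 1

/-- The pairing of signs: `y` if `x = -1`, and `1` otherwise. It is bimultiplicative. -/
def pairing (x y : ℤˣ) : ℤˣ := if x = 1 then 1 else y

theorem pairing_mul_left (x x' y : ℤˣ) : pairing (x * x') y = pairing x y * pairing x' y := by
  revert x x' y; decide

theorem pairing_mul_right (x y y' : ℤˣ) : pairing x (y * y') = pairing x y * pairing x y' := by
  revert x y y'; decide

/-- Along the boundary of a face a spin configuration on the vertices changes sign an even number
of times, so domain walls are even sets in the dual graph. -/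
theorem cut_mem_dualEvenSets (s : M.Vertex → ℤˣ) : M.cut s ∈ M.dualEvenSets := by
  classical
  simp only [evenSets, Finset.mem_filter, Finset.mem_univ, true_and]
  intro r
  have h1 : ∏ e ∈ M.cut s, r (M.face (M.edgeDart e)) * r (M.face (M.flip (M.edgeDart e))) =
      ∏ d, pairing (s (M.source d) * s (M.source (M.flip d))) (r (M.face d)) := by
    rw [M.prod_darts, cut, Finset.prod_filter]
    refine Finset.prod_congr rfl fun e _ => ?_
    rw [M.flip_flip, mul_comm (s (M.source (M.flip _))), ← pairing_mul_right, pairing]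
    split_ifs <;> simp_all
  rw [h1]
  simp only [← M.source_facePerm, pairing_mul_left]
  rw [Finset.prod_mul_distrib]
  have h2 : ∏ d, pairing (s (M.source (M.facePerm d))) (r (M.face d)) =
      ∏ d, pairing (s (M.source d)) (r (M.face d)) :=
    Fintype.prod_equiv M.facePerm _ _ fun d => by rw [M.face_facePerm]
  rw [h2]
  exact Int.units_mul_self _

/-- Domain walls determine the spins up to a global sign. -/
theorem card_cut_fiber (h : M.DartConnected) (s : M.Vertex → ℤˣ) :
    (Finset.univ.filter fun s' => M.cut s' = M.cut s).card = 2 := by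
  have h1 : ∀ s s' : M.Vertex → ℤˣ, M.cut s = M.cut s' ↔ s' = s ∨ s' = -s := by
    intro s s'
    constructor
    · intro hc
      have hc' : ∀ e, (s * s') (M.source (M.edgeDart e)) =
          (s * s') (M.source (M.flip (M.edgeDart e))) := by
        intro e
        have := congrArg (fun A => e ∈ A) hc
        simp only [cut, Finset.mem_filter, Finset.mem_univ, true_and, eq_iff_iff] at this
        simp only [Pi.mul_apply]
        generalize s (M.source (M.edgeDart e)) = a at *
        generalize s' (M.source (M.edgeDart e)) = b at *
        generalize s (M.source (M.flip (M.edgeDart e))) = a' at *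
        generalize s' (M.source (M.flip (M.edgeDart e))) = b' at *
        revert a b a' b'
        decide
      have hk := M.spins_const_of_vertex h _ hc'
      rcases Int.units_eq_one_or ((s * s') M.rootVertex) with a | a
      · left
        funext x
        have := hk x M.rootVertex
        rw [a, Pi.mul_apply] at this
        exact (Int.units_eq_one_or (s x)).elim (fun b => by simp_all) (fun b => by
          rw [b] at this ⊢; simpa [neg_eq_iff_eq_neg] using this)
      · right
        funext x
        have := hk x M.rootVertex
        rw [a, Pi.mul_apply] at this
        exact (Int.units_eq_one_or (s x)).elim (fun b => by simp_all) (fun b => by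
          rw [Pi.neg_apply, b]; rw [b] at this; simpa [neg_eq_iff_eq_neg] using this)
    · rintro (rfl | rfl)
      · rfl
      · ext e; simp [cut]
  have : (Finset.univ.filter fun s' => M.cut s' = M.cut s) = {s, -s} := by
    ext s'
    simp only [Finset.mem_filter, Finset.mem_univ, true_and, Finset.mem_insert,
      Finset.mem_singleton]
    rw [eq_comm, h1]
  rw [this, Finset.card_pair]
  intro hs
  have := congrFun hs M.rootVertex
  rw [Pi.neg_apply] at this
  generalize s M.rootVertex = a at this
  revert this a; decide

theorem card_cuts_mul_two (h : M.DartConnected) :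
    (Finset.univ.image M.cut).card * 2 = 2 ^ Fintype.card M.Vertex := by
  have h2 : Fintype.card (M.Vertex → ℤˣ) = 2 ^ Fintype.card M.Vertex := by simp
  rw [← h2, ← Finset.card_univ,
    Finset.card_eq_sum_card_fiberwise (f := M.cut) (t := Finset.univ.image M.cut)
      (fun x hx => by simp)]
  rw [← smul_eq_mul, ← Finset.sum_const]
  refine Finset.sum_congr rfl fun A hA => ?_
  obtain ⟨s, -, rfl⟩ := Finset.mem_image.1 hA
  rw [M.card_cut_fiber h]

theorem image_cut_subset : Finset.univ.image M.cut ⊆ M.dualEvenSets := by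
  intro A hA
  obtain ⟨s, -, rfl⟩ := Finset.mem_image.1 hA
  exact M.cut_mem_dualEvenSets s

/-- The number of even sets, from the connectedness of the dual graph. -/
theorem card_dualEvenSets (h : M.DartConnected) :
    2 ^ Fintype.card M.Face * M.dualEvenSets.card = 2 ^ Fintype.card M.Edge * 2 :=
  card_evenSets _ _ (M.spins_const_of_face h)

/-- The genus of a connected map is nonnegative. -/
theorem card_vertex_add_card_face_le (h : M.DartConnected) :
    Fintype.card M.Vertex + Fintype.card M.Face ≤ Fintype.card M.Edge + 2 := by
  classical
  have h1 := M.card_cuts_mul_two h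
  have h2 := M.card_dualEvenSets h
  have h3 := Finset.card_le_card M.image_cut_subset
  have : 2 ^ (Fintype.card M.Vertex + Fintype.card M.Face) ≤ 2 ^ (Fintype.card M.Edge + 2) := by
    rw [pow_add, pow_add, ← h1]
    nlinarith [Nat.two_pow_pos (Fintype.card M.Face)]
  exact (Nat.pow_le_pow_iff_right (by norm_num)).1 this

/-- In a planar map every even set of the dual graph is a domain wall: the inclusion is an
equality by Euler's formula. -/
theorem image_cut_eq (h : M.DartConnected) (hp : M.IsPlanar) :
    Finset.univ.image M.cut = M.dualEvenSets := by
  refine Finset.eq_of_subset_of_card_le M.image_cut_subset ?_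
  have h1 := M.card_cuts_mul_two h
  have h2 := M.card_dualEvenSets h
  rw [IsPlanar] at hp
  simp only [Nat.card_eq_fintype_card] at hp
  have h3 : Fintype.card M.Vertex + Fintype.card M.Face = Fintype.card M.Edge + 2 := by omega
  have h4 : 2 ^ Fintype.card M.Vertex * 2 ^ Fintype.card M.Face =
      2 ^ Fintype.card M.Edge * 4 := by
    rw [← pow_add, h3, pow_add]; norm_num
  have h5 : 0 < 2 ^ Fintype.card M.Face := by positivity
  rw [← h1] at h4
  have : 2 ^ Fintype.card M.Face * M.dualEvenSets.card =
      2 ^ Fintype.card M.Face * (Finset.univ.image M.cut).card := by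
    linarith
  exact (Nat.eq_of_mul_eq_mul_left h5 this).le

theorem neg_energy (s : M.Vertex → ℤˣ) : -M.energy s = ∑ e : M.Edge,
    (((s (M.source (M.edgeDart e)) * s (M.source (M.flip (M.edgeDart e))) : ℤˣ) : ℤ) : ℝ) := by
  rw [energy, neg_neg, M.sum_darts, Finset.mul_sum]
  refine Finset.sum_congr rfl fun e _ => ?_
  rw [M.flip_flip]
  push_cast
  ring

theorem neg_dualEnergy (s : M.Face → ℤˣ) : -M.dualEnergy s = ∑ e : M.Edge,
    (((s (M.face (M.edgeDart e)) * s (M.face (M.flip (M.edgeDart e))) : ℤˣ) : ℤ) : ℝ) := by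
  rw [dualEnergy, neg_neg, M.sum_darts, Finset.mul_sum]
  refine Finset.sum_congr rfl fun e _ => ?_
  rw [M.flip_flip]
  push_cast
  ring

theorem sum_exp_dualEnergy (β : ℝ) :
    ∑ s, Real.exp (-β * M.dualEnergy s) = Real.cosh β ^ Fintype.card M.Edge *
      (2 ^ Fintype.card M.Face * ∑ A ∈ M.dualEvenSets, Real.tanh β ^ A.card) := by
  rw [← high_temperature]
  refine Finset.sum_congr rfl fun s _ => ?_
  rw [← M.neg_dualEnergy]
  ring_nf

/-- The low-temperature expansion: the energy is counted by the domain walls. -/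
theorem exp_energy (β : ℝ) (s : M.Vertex → ℤˣ) :
    Real.exp (-β * M.energy s) =
      Real.exp (β * Fintype.card M.Edge) * Real.exp (-2 * β) ^ (M.cut s).card := by
  classical
  have h : ∀ e : M.Edge,
      (((s (M.source (M.edgeDart e)) * s (M.source (M.flip (M.edgeDart e))) : ℤˣ) : ℤ) : ℝ) =
      1 - 2 * if e ∈ M.cut s then 1 else 0 := by
    intro e
    simp only [cut, Finset.mem_filter, Finset.mem_univ, true_and]
    split_ifs with h
    · rw [(Int.units_eq_one_or _).resolve_left h]; norm_num
    · rw [not_not.1 h]; norm_num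
  have h2 : -β * M.energy s = β * -M.energy s := by ring
  rw [h2, M.neg_energy, Finset.sum_congr rfl fun e _ => h e, Finset.sum_sub_distrib,
    ← Finset.mul_sum, ← Real.exp_nat_mul, ← Real.exp_add]
  congr 1
  simp
  ring

theorem sum_exp_energy (β : ℝ) (h : M.DartConnected) (hp : M.IsPlanar) :
    ∑ s, Real.exp (-β * M.energy s) = 2 * (Real.exp (β * Fintype.card M.Edge) *
      ∑ A ∈ M.dualEvenSets, Real.exp (-2 * β) ^ A.card) := by
  classical
  simp only [M.exp_energy]
  rw [← Finset.mul_sum, ← M.image_cut_eq h hp]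
  have : ∑ s, Real.exp (-2 * β) ^ (M.cut s).card =
      2 * ∑ A ∈ Finset.univ.image M.cut, Real.exp (-2 * β) ^ A.card := by
    rw [Finset.sum_comp (fun A : Finset M.Edge => Real.exp (-2 * β) ^ A.card) M.cut,
      Finset.mul_sum]
    refine Finset.sum_congr rfl fun A hA => ?_
    obtain ⟨s, -, rfl⟩ := Finset.mem_image.1 hA
    rw [M.card_cut_fiber h, nsmul_eq_mul, Nat.cast_ofNat]
  rw [this]; ring

end Duality

end RootedMap

/-! ### Invariance under isomorphism -/

theorem dist_iso {V V' : Type*} {G : SimpleGraph V} {G' : SimpleGraph V'} (φ : G ≃g G')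
    (hG : G.Connected) (u v : V) : G'.dist (φ u) (φ v) = G.dist u v := by
  have hG' : G'.Connected := φ.connected_iff.1 hG
  apply le_antisymm
  · obtain ⟨w, hw⟩ := hG.exists_walk_length_eq_dist u v
    rw [← hw, ← w.length_map φ.toHom]
    exact SimpleGraph.dist_le (w.map φ.toHom)
  · obtain ⟨w, hw⟩ := hG'.exists_walk_length_eq_dist (φ u) (φ v)
    rw [← hw, ← w.length_map φ.symm.toHom]
    have h := SimpleGraph.dist_le (w.map φ.symm.toHom)
    simpa using h

theorem sameCycle_equiv_iff {D D' : Type*} (e : D ≃ D') (π : Equiv.Perm D) (π' : Equiv.Perm D')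
    (h : ∀ d, e (π d) = π' (e d)) (a b : D) : π.SameCycle a b ↔ π'.SameCycle (e a) (e b) := by
  have hπ : π' = e.permCongr π := by
    ext x; simp [Equiv.permCongr_apply, h]
  have hz : ∀ n : ℤ, e ((π ^ n) a) = (π' ^ n) (e a) := by
    intro n
    have : e.permCongr π ^ n = e.permCongr (π ^ n) := (map_zpow e.permCongrHom π n).symm
    rw [hπ, this]; simp
  exact exists_congr fun n => by rw [← hz, e.apply_eq_iff_eq]

namespace RootedMap

variable {D D' : Type} {M : RootedMap D} {M' : RootedMap D'}

theorem Iso.symm : M.Iso M' → M'.Iso M := by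
  rintro ⟨e, h₁, h₂, h₃⟩
  refine ⟨e.symm, fun d => ?_, fun d => ?_, ?_⟩
  · rw [Equiv.symm_apply_eq, h₁, Equiv.apply_symm_apply]
  · rw [Equiv.symm_apply_eq, h₂, Equiv.apply_symm_apply]
  · rw [Equiv.symm_apply_eq, h₃]

theorem Iso.trans {D'' : Type} {M'' : RootedMap D''} : M.Iso M' → M'.Iso M'' → M.Iso M'' := by
  rintro ⟨e, h₁, h₂, h₃⟩ ⟨e', h₁', h₂', h₃'⟩
  exact ⟨e.trans e', fun d => by simp [h₁, h₁'], fun d => by simp [h₂, h₂'], by simp [h₃, h₃']⟩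

theorem iso_facePerm (e : D ≃ D') (hr : ∀ d, e (M.rot d) = M'.rot (e d))
    (hf : ∀ d, e (M.flip d) = M'.flip (e d)) (d : D) :
    e (M.facePerm d) = M'.facePerm (e d) := by
  rw [facePerm_apply, facePerm_apply, hr, hf]

section

variable (e : D ≃ D') (hr : ∀ d, e (M.rot d) = M'.rot (e d))
  (hf : ∀ d, e (M.flip d) = M'.flip (e d))

/-- The bijection of vertices induced by an isomorphism. -/
def vertexEquiv : M.Vertex ≃ M'.Vertex :=
  Quotient.congr e fun a b => sameCycle_equiv_iff e M.rot M'.rot hr a b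

/-- The bijection of edges induced by an isomorphism. -/
def edgeEquiv : M.Edge ≃ M'.Edge :=
  Quotient.congr e fun a b => sameCycle_equiv_iff e M.flip M'.flip hf a b

/-- The bijection of faces induced by an isomorphism. -/
def faceEquiv : M.Face ≃ M'.Face :=
  Quotient.congr e fun a b =>
    sameCycle_equiv_iff e M.facePerm M'.facePerm (iso_facePerm e hr hf) a b

theorem vertexEquiv_source (d : D) : vertexEquiv e hr (M.source d) = M'.source (e d) := rfl

theorem faceEquiv_face (d : D) : faceEquiv e hr hf (M.face d) = M'.face (e d) := rfl

/-- The isomorphism of underlying graphs induced by an isomorphism of maps. -/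
def graphIso : M.graph ≃g M'.graph where
  toEquiv := vertexEquiv e hr
  map_rel_iff' := by
    intro u v
    constructor
    · rintro ⟨hne, d, h₁, h₂⟩
      refine ⟨fun h => hne (by rw [h]), e.symm d, (vertexEquiv e hr).injective ?_,
        (vertexEquiv e hr).injective ?_⟩
      · rw [vertexEquiv_source, e.apply_symm_apply]; exact h₁
      · rw [vertexEquiv_source, hf, e.apply_symm_apply]; exact h₂
    · rintro ⟨hne, d, rfl, rfl⟩
      exact ⟨fun h => hne ((vertexEquiv e hr).injective h), e d, rfl, by
        rw [← hf]; rfl⟩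

end

/-- The height of a dart: the distance of its source from the root vertex. -/
noncomputable def height (M : RootedMap D) (d : D) : ℕ := M.graph.dist M.rootVertex (M.source d)

theorem height_iso (hG : M.graph.Connected) (e : D ≃ D') (hr : ∀ d, e (M.rot d) = M'.rot (e d))
    (hf : ∀ d, e (M.flip d) = M'.flip (e d)) (hroot : e M.root = M'.root) (d : D) :
    M'.height (e d) = M.height d := by
  have := dist_iso (graphIso e hr hf) hG M.rootVertex (M.source d)
  rw [height, height, ← this]
  congr 1
  rw [rootVertex, ← hroot]
  rfl

theorem IsCausal.of_iso {N l : ℕ} (h : M.IsCausal N l) (hM : M.Iso M') : M'.IsCausal N l := by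
  obtain ⟨e, hr, hf, hroot⟩ := hM
  have hroot' : M'.rootVertex = vertexEquiv e hr M.rootVertex := by
    rw [rootVertex, ← hroot]; rfl
  have hslice : ∀ i v, vertexEquiv e hr v ∈ M'.slice i ↔ v ∈ M.slice i := by
    intro i v
    simp only [slice, Set.mem_ofPred_eq]
    rw [hroot']
    exact (dist_iso (graphIso e hr hf) h.connected M.rootVertex v).congr_left
  have hslice' : ∀ i, M'.slice i = vertexEquiv e hr '' M.slice i := by
    intro i
    ext v
    obtain ⟨u, rfl⟩ := (vertexEquiv e hr).surjective v
    rw [hslice, (vertexEquiv e hr).injective.mem_set_image]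
  refine ⟨(graphIso e hr hf).connected_iff.1 h.connected, ?_, ?_, ?_, ?_, ?_, ?_⟩
  · have := h.planar
    rw [IsPlanar] at this ⊢
    rwa [← Nat.card_congr (vertexEquiv e hr), ← Nat.card_congr (edgeEquiv e hf),
      ← Nat.card_congr (faceEquiv e hr hf)]
  · intro d
    obtain ⟨d, rfl⟩ := e.surjective d
    rw [← hf, ← vertexEquiv_source e hr, ← vertexEquiv_source e hr, hroot']
    intro h1 h2
    exact h.no_root_loop d ((vertexEquiv e hr).injective h1) ((vertexEquiv e hr).injective h2)
  · intro i h1 h2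
    obtain ⟨hc, hd⟩ := h.slices i h1 h2
    constructor
    · refine (SimpleGraph.Iso.connected_iff ?_).1 hc
      exact
        { toEquiv := (vertexEquiv e hr).subtypeEquiv fun v => (hslice i v).symm
          map_rel_iff' := (graphIso e hr hf).map_rel_iff' }
    · intro v hv
      obtain ⟨v, rfl⟩ := (vertexEquiv e hr).surjective v
      rw [hslice] at hv
      rw [← hd v hv, ← Set.ncard_image_of_injective _ e.injective]
      congr 1
      ext d
      obtain ⟨d, rfl⟩ := e.surjective d
      rw [e.injective.mem_set_image]
      simp only [Set.mem_ofPred_eq]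
      rw [← hf, ← vertexEquiv_source e hr, ← vertexEquiv_source e hr, hslice,
        (vertexEquiv e hr).apply_eq_iff_eq]
  · intro i hi
    rw [hslice', h.last i hi, Set.image_empty]
  · rw [hslice', Set.ncard_image_of_injective _ (vertexEquiv e hr).injective, h.boundary]
  · obtain ⟨f₀, h1, h2⟩ := h.triangles
    refine ⟨faceEquiv e hr hf f₀, fun d hd => ?_, fun f hne => ?_⟩
    · obtain ⟨d, rfl⟩ := e.surjective d
      rw [← faceEquiv_face e hr hf, (faceEquiv e hr hf).apply_eq_iff_eq] at hd
      rw [← vertexEquiv_source e hr, hslice]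
      exact h1 d hd
    · obtain ⟨f, rfl⟩ := (faceEquiv e hr hf).surjective f
      rw [← h2 f (fun h => hne (by rw [h])), ← Set.ncard_image_of_injective _ e.injective]
      congr 1
      ext d
      obtain ⟨d, rfl⟩ := e.surjective d
      rw [e.injective.mem_set_image]
      simp only [Set.mem_ofPred_eq]
      rw [← faceEquiv_face e hr hf, (faceEquiv e hr hf).apply_eq_iff_eq]

theorem dualWeight_iso [Fintype D] [Fintype D'] (hM : M.Iso M') (β μ : ℝ) :
    M.dualWeight β μ = M'.dualWeight β μ := by
  obtain ⟨e, hr, hf, -⟩ := hM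
  rw [dualWeight, dualWeight, ← ((faceEquiv e hr hf).arrowCongr (Equiv.refl ℤˣ)).tsum_eq]
  refine tsum_congr fun s => ?_
  have h1 : M.triangleCount = M'.triangleCount := by
    rw [triangleCount, triangleCount, Nat.card_congr (faceEquiv e hr hf)]
  have h2 : M.dualEnergy s =
      M'.dualEnergy ((faceEquiv e hr hf).arrowCongr (Equiv.refl ℤˣ) s) := by
    rw [dualEnergy, dualEnergy, ← e.sum_comp]
    simp only [← hf, ← faceEquiv_face e hr hf, Equiv.arrowCongr_apply, Function.comp,
      Equiv.symm_apply_apply, Equiv.refl_apply]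
  rw [h1, h2]

end RootedMap

/-! ### Strip words and codes -/

/-- The cyclic sequence of triangles between two consecutive slices, cut open at a marked upward
edge, as a finite word: `true` stands for a triangle whose horizontal edge lies on the upper slice,
`false` for a triangle whose horizontal edge lies on the lower slice. -/
abbrev StripWord : Type := (n : ℕ) × (Fin n → Bool)

namespace StripWord

/-- The letter at position `k`; the value beyond the length is immaterial. -/
def bit (w : StripWord) (k : ℕ) : Bool := if h : k < w.1 then w.2 ⟨k, h⟩ else false

/-- The number of letters `b` before position `k`. -/
def cnt (w : StripWord) (b : Bool) (k : ℕ) : ℕ := Nat.count (fun j => w.bit j = b) k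

/-- The position of the `j`-th letter `b`. -/
noncomputable def pos (w : StripWord) (b : Bool) (j : ℕ) : ℕ := Nat.nth (fun j => w.bit j = b) j

theorem ext_bit {w w' : StripWord} (h : w.1 = w'.1) (hb : ∀ k < w.1, w.bit k = w'.bit k) :
    w = w' := by
  obtain ⟨n, f⟩ := w
  obtain ⟨n', f'⟩ := w'
  obtain rfl : n = n' := h
  congr 1
  funext k
  have := hb k k.2
  simpa [bit] using this

theorem bit_mk {n : ℕ} (f : Fin n → Bool) {k : ℕ} (hk : k < n) :
    bit ⟨n, f⟩ k = f ⟨k, hk⟩ := dif_pos hk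

variable (w : StripWord) (b : Bool)

theorem cnt_zero : w.cnt b 0 = 0 := Nat.count_zero _

theorem cnt_succ_eq {k : ℕ} (h : w.bit k = b) : w.cnt b (k + 1) = w.cnt b k + 1 := by
  rw [cnt, Nat.count_succ, if_pos h, cnt]

theorem cnt_succ_ne {k : ℕ} (h : w.bit k ≠ b) : w.cnt b (k + 1) = w.cnt b k := by
  rw [cnt, Nat.count_succ, if_neg h, cnt, add_zero]

theorem cnt_mono {k k' : ℕ} (h : k ≤ k') : w.cnt b k ≤ w.cnt b k' := Nat.count_monotone _ h

theorem cnt_lt {k : ℕ} (hk : k < w.1) (h : w.bit k = b) : w.cnt b k < w.cnt b w.1 := by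
  have := w.cnt_mono b (Nat.succ_le_of_lt hk)
  rw [Nat.succ_eq_add_one, cnt_succ_eq _ _ h] at this
  omega

theorem cnt_add (k : ℕ) : w.cnt true k + w.cnt false k = k := by
  induction k with
  | zero => simp [cnt_zero]
  | succ k ih =>
    cases h : w.bit k
    · rw [cnt_succ_eq _ _ h, cnt_succ_ne _ _ (by simp [h])]; omega
    · rw [cnt_succ_eq _ _ h, cnt_succ_ne _ _ (by simp [h])]; omega

theorem pos_cnt {k : ℕ} (h : w.bit k = b) : w.pos b (w.cnt b k) = k := Nat.nth_count h

/-- Every value of the counter below the total is attained at some letter `b`. -/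
theorem exists_of_lt_cnt {n j : ℕ} (h : j < w.cnt b n) : ∃ k < n, w.bit k = b ∧ w.cnt b k = j := by
  induction n with
  | zero => simp [cnt_zero] at h
  | succ n ih =>
    by_cases hn : w.bit n = b
    · rw [cnt_succ_eq _ _ hn] at h
      rcases Nat.lt_succ_iff_lt_or_eq.1 h with h | rfl
      · obtain ⟨k, hk, h⟩ := ih h
        exact ⟨k, by omega, h⟩
      · exact ⟨n, by omega, hn, rfl⟩
    · rw [cnt_succ_ne _ _ hn] at h
      obtain ⟨k, hk, h⟩ := ih h
      exact ⟨k, by omega, h⟩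

theorem pos_spec {j : ℕ} (h : j < w.cnt b w.1) :
    w.pos b j < w.1 ∧ w.bit (w.pos b j) = b ∧ w.cnt b (w.pos b j) = j := by
  obtain ⟨k, hk, hb, rfl⟩ := w.exists_of_lt_cnt b h
  rw [w.pos_cnt b hb]
  exact ⟨hk, hb, rfl⟩

end StripWord

/-- The combinatorial data of a causal triangulation with slices of sizes given by the numbers of
letters: one word for each of the `N` strips. The slice between two strips is counted by either
word, and the cut of a strip at height `i ≥ 1` is normalised by its last letter. -/
structure IsCode (N l : ℕ) (w : ℕ → StripWord) : Prop where
  pos : 0 < N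
  empty : ∀ i, N ≤ i → w i = ⟨0, fun _ => false⟩
  first : ∀ k < (w 0).1, (w 0).bit k = true
  glue : ∀ i, i + 1 < N → (w (i + 1)).cnt false (w (i + 1)).1 = (w i).cnt true (w i).1
  last_bit : ∀ i, 0 < i → i < N → (w i).bit ((w i).1 - 1) = false
  top_pos : ∀ i < N, 0 < (w i).cnt true (w i).1
  boundary : (w (N - 1)).cnt true (w (N - 1)).1 = l

/-- The type of codes of causal triangulations. -/
def Code (N l : ℕ) : Type := {w : ℕ → StripWord // IsCode N l w}

namespace Code

variable {N l : ℕ} (c : Code N l)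

/-- The number of triangles in strip `i`. -/
def len (i : ℕ) : ℕ := (c.1 i).1

/-- The letter at position `k` of strip `i`. -/
def bit (i k : ℕ) : Bool := (c.1 i).bit k

/-- The number of letters `b` before position `k` of strip `i`. -/
def cnt (i : ℕ) (b : Bool) (k : ℕ) : ℕ := (c.1 i).cnt b k

/-- The position of the `j`-th letter `b` in strip `i`. -/
noncomputable def pos (i : ℕ) (b : Bool) (j : ℕ) : ℕ := (c.1 i).pos b j

/-- The number of vertices of slice `i`. -/
def size : ℕ → ℕ
  | 0 => 1
  | i + 1 => c.cnt i true (c.len i)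

theorem N_pos (c : Code N l) : 0 < N := c.2.pos

theorem size_succ (i : ℕ) : c.size (i + 1) = c.cnt i true (c.len i) := rfl

theorem size_last : c.size N = l := by
  obtain ⟨n, rfl⟩ := Nat.exists_eq_succ_of_ne_zero c.N_pos.ne'
  exact c.2.boundary

theorem size_pos {i : ℕ} (hi : i ≤ N) : 0 < c.size i := by
  cases i with
  | zero => exact Nat.one_pos
  | succ i => exact c.2.top_pos i (by omega)

theorem l_pos (c : Code N l) : 0 < l := c.size_last ▸ c.size_pos le_rfl

theorem cnt_false_len {i : ℕ} (h0 : 0 < i) (hi : i < N) : c.cnt i false (c.len i) = c.size i := by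
  obtain ⟨n, rfl⟩ := Nat.exists_eq_succ_of_ne_zero h0.ne'
  exact c.2.glue n hi

theorem len_pos {i : ℕ} (hi : i < N) : 0 < c.len i := by
  by_contra h
  have h2 := c.size_pos (i := i + 1) hi
  have h3 : c.len i = 0 := by omega
  rw [size_succ, h3] at h2
  simp [cnt, StripWord.cnt_zero] at h2

theorem cnt_false_zero {k : ℕ} (hk : k ≤ c.len 0) : c.cnt 0 false k = 0 := by
  induction k with
  | zero => exact StripWord.cnt_zero _ _
  | succ k ih =>
    rw [cnt, StripWord.cnt_succ_ne, ← cnt, ih (by omega)]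
    rw [c.2.first k hk]; simp

theorem lt_size_succ {i k : ℕ} (hk : k < c.len i) (h : c.bit i k = true) :
    c.cnt i true k < c.size (i + 1) := StripWord.cnt_lt _ _ hk h

theorem bit_false_pos {i k : ℕ} (hk : k < c.len i) (h : c.bit i k = false) : 0 < i := by
  rcases Nat.eq_zero_or_pos i with rfl | h0
  · have := c.2.first k hk
    rw [bit] at h
    rw [h] at this
    exact absurd this (by simp)
  · exact h0

theorem lt_size {i k : ℕ} (hi : i < N) (hk : k < c.len i) (h : c.bit i k = false) :
    c.cnt i false k < c.size i := by
  rw [← c.cnt_false_len (c.bit_false_pos hk h) hi]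
  exact StripWord.cnt_lt _ _ hk h

theorem pos_true {i j : ℕ} (h : j < c.size (i + 1)) :
    c.pos i true j < c.len i ∧ c.bit i (c.pos i true j) = true ∧
      c.cnt i true (c.pos i true j) = j := StripWord.pos_spec _ _ h

theorem pos_false {i j : ℕ} (h0 : 0 < i) (hi : i < N) (h : j < c.size i) :
    c.pos i false j < c.len i ∧ c.bit i (c.pos i false j) = false ∧
      c.cnt i false (c.pos i false j) = j :=
  StripWord.pos_spec _ _ (by rw [← c.cnt_false_len h0 hi] at h; exact h)

/-! ### The rooted map of a code -/

/-- The triangles of the map of a code: `(i, k)` is the triangle number `k` in strip `i`. -/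
def Tri : Type := {p : ℕ × ℕ // p.1 < N ∧ p.2 < c.len p.1}

namespace Tri

variable {c}

/-- The strip of a triangle. -/
def lvl (p : c.Tri) : ℕ := p.1.1

/-- The position of a triangle in its strip. -/
def idx (p : c.Tri) : ℕ := p.1.2

/-- The letter of a triangle. -/
def bit (p : c.Tri) : Bool := c.bit p.lvl p.idx

/-- Rank of a triangle among those of kind `b` in the strip. -/
def rank (p : c.Tri) (b : Bool) : ℕ := c.cnt p.lvl b p.idx

theorem lvl_lt (p : c.Tri) : p.lvl < N := p.2.1

theorem idx_lt (p : c.Tri) : p.idx < c.len p.lvl := p.2.2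

/-- The triangle with given coordinates. -/
def mk (i k : ℕ) (hi : i < N) (hk : k < c.len i) : c.Tri := ⟨(i, k), hi, hk⟩

theorem ext' {p q : c.Tri} (h : p.lvl = q.lvl) (h' : p.idx = q.idx) : p = q :=
  Subtype.ext (Prod.ext h h')

instance : DecidableEq c.Tri := inferInstanceAs (DecidableEq (Subtype _))

/-- Triangles as pairs of a strip and a position in it. -/
def equivSigma : c.Tri ≃ (i : Fin N) × Fin (c.len i) where
  toFun p := ⟨⟨p.lvl, p.lvl_lt⟩, ⟨p.idx, p.idx_lt⟩⟩
  invFun p := ⟨(p.1, p.2), p.1.2, p.2.2⟩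
  left_inv _ := rfl
  right_inv _ := rfl

instance : Fintype c.Tri := Fintype.ofEquiv _ equivSigma.symm

/-- The next triangle in the strip, cyclically. -/
def next (p : c.Tri) : c.Tri :=
  mk p.lvl (if p.idx + 1 = c.len p.lvl then 0 else p.idx + 1) p.lvl_lt (by
    have := p.idx_lt
    split_ifs <;> omega)

/-- The previous triangle in the strip, cyclically. -/
def prev (p : c.Tri) : c.Tri :=
  mk p.lvl (if p.idx = 0 then c.len p.lvl - 1 else p.idx - 1) p.lvl_lt (by
    have := p.idx_lt
    split_ifs <;> omega)

theorem prev_next (p : c.Tri) : p.next.prev = p := by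
  refine ext' rfl ?_
  have := p.idx_lt
  show (if (if p.idx + 1 = c.len p.lvl then 0 else p.idx + 1) = 0 then c.len p.lvl - 1
    else (if p.idx + 1 = c.len p.lvl then 0 else p.idx + 1) - 1) = p.idx
  by_cases h : p.idx + 1 = c.len p.lvl
  · rw [if_pos h]; simp; omega
  · simp [h]

theorem next_prev (p : c.Tri) : p.prev.next = p := by
  refine ext' rfl ?_
  have := p.idx_lt
  show (if (if p.idx = 0 then c.len p.lvl - 1 else p.idx - 1) + 1 = c.len p.lvl then 0
    else (if p.idx = 0 then c.len p.lvl - 1 else p.idx - 1) + 1) = p.idx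
  by_cases h : p.idx = 0
  · simp only [h, if_true]; rw [if_pos (by omega)]
  · simp only [h, if_false]; rw [if_neg (by omega)]; omega

theorem lvl_next (p : c.Tri) : p.next.lvl = p.lvl := rfl

theorem rank_next_true (p : c.Tri) :
    p.next.rank true % c.size (p.lvl + 1) = c.cnt p.lvl true (p.idx + 1) % c.size (p.lvl + 1) := by
  by_cases h : p.idx + 1 = c.len p.lvl
  · have : p.next.idx = 0 := if_pos h
    rw [rank, this, h, lvl_next, cnt, StripWord.cnt_zero, ← size_succ, Nat.zero_mod, Nat.mod_self]
  · have : p.next.idx = p.idx + 1 := if_neg h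
    rw [rank, this, lvl_next]

theorem rank_next_false (p : c.Tri) :
    p.next.rank false % c.size p.lvl = c.cnt p.lvl false (p.idx + 1) % c.size p.lvl := by
  by_cases h : p.idx + 1 = c.len p.lvl
  · have : p.next.idx = 0 := if_pos h
    rw [rank, this, h, lvl_next, cnt, StripWord.cnt_zero]
    rcases Nat.eq_zero_or_pos p.lvl with h0 | h0
    · rw [h0, size, Nat.mod_one, Nat.mod_one]
    · rw [c.cnt_false_len h0 p.lvl_lt, Nat.zero_mod, Nat.mod_self]
  · have : p.next.idx = p.idx + 1 := if_neg h
    rw [rank, this, lvl_next]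

end Tri

/-- Darts of the map of a code: the edge from slice `i` to slice `i + 1` in front of a triangle, in
both directions; the horizontal edge of each triangle, directed so that the triangle is on its
face side; and the boundary of the external face. -/
inductive Dart : Type
  | up (p : c.Tri)
  | dn (p : c.Tri)
  | base (p : c.Tri)
  | ext (j : Fin l)

namespace Dart

variable {c}

/-- Darts as a disjoint union. -/
def equivSum : c.Dart ≃ (c.Tri ⊕ c.Tri) ⊕ (c.Tri ⊕ Fin l) where
  toFun
    | up p => .inl (.inl p)
    | dn p => .inl (.inr p)
    | base p => .inr (.inl p)
    | ext j => .inr (.inr j)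
  invFun
    | .inl (.inl p) => up p
    | .inl (.inr p) => dn p
    | .inr (.inl p) => base p
    | .inr (.inr j) => ext j
  left_inv d := by cases d <;> rfl
  right_inv d := by rcases d with (d | d) | (d | d) <;> rfl

instance : Fintype c.Dart := Fintype.ofEquiv _ equivSum.symm

theorem sum_eq {A : Type*} [AddCommMonoid A] (G : c.Dart → A) :
    ∑ d, G d = ((∑ p, G (up p)) + ∑ p, G (dn p)) + ((∑ p, G (base p)) + ∑ j, G (ext j)) := by
  rw [← equivSum.symm.sum_comp, Fintype.sum_sum_type, Fintype.sum_sum_type, Fintype.sum_sum_type]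
  rfl

theorem card_eq : Fintype.card c.Dart = 3 * Fintype.card c.Tri + l := by
  rw [Fintype.card_congr equivSum]
  simp
  ring

/-- The successor of a dart along the boundary of its face. -/
def faceFun : c.Dart → c.Dart
  | up q => if q.prev.bit then base q.prev else dn q.prev
  | base p => if p.bit then dn p else up p.next
  | dn p => if p.bit then up p.next else base p
  | ext j => ext (finRotate l j)

/-- The predecessor of a dart along the boundary of its face. -/
def faceInv : c.Dart → c.Dart
  | up q => if q.prev.bit then dn q.prev else base q.prev
  | base p => if p.bit then up p.next else dn p
  | dn p => if p.bit then base p else up p.next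
  | ext j => ext ((finRotate l).symm j)

/-- The permutation of darts along the boundaries of faces. -/
def facePerm : Equiv.Perm c.Dart where
  toFun := faceFun
  invFun := faceInv
  left_inv d := by
    cases d with
    | up q =>
      simp only [faceFun]; split_ifs with h <;> simp [faceInv, h, Tri.next_prev]
    | dn p => simp only [faceFun]; split_ifs with h <;> simp [faceInv, h, Tri.prev_next]
    | base p => simp only [faceFun]; split_ifs with h <;> simp [faceInv, h, Tri.prev_next]
    | ext j => exact congrArg ext ((finRotate l).symm_apply_apply j)
  right_inv d := by
    cases d with
    | up q =>
      simp only [faceInv]; split_ifs with h <;> simp [faceFun, h, Tri.next_prev]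
    | dn p => simp only [faceInv]; split_ifs with h <;> simp [faceFun, h, Tri.prev_next]
    | base p => simp only [faceInv]; split_ifs with h <;> simp [faceFun, h, Tri.prev_next]
    | ext j => exact congrArg ext ((finRotate l).apply_symm_apply j)

end Dart

open Dart

/-- The triangle below horizontal edge number `j` of slice `i + 1`. -/
noncomputable def topTri (i j : ℕ) (hi : i < N) (hj : j < c.size (i + 1)) : c.Tri :=
  Tri.mk i (c.pos i true j) hi (c.pos_true hj).1

/-- The triangle above horizontal edge number `j` of slice `i`. -/
noncomputable def botTri (i j : ℕ) (h0 : 0 < i) (hi : i < N) (hj : j < c.size i) : c.Tri :=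
  Tri.mk i (c.pos i false j) hi (c.pos_false h0 hi hj).1

variable {c}

theorem Tri.rank_true_lt {p : c.Tri} (h : p.bit = true) : p.rank true < c.size (p.lvl + 1) :=
  c.lt_size_succ p.idx_lt h

theorem Tri.lvl_pos {p : c.Tri} (h : p.bit = false) : 0 < p.lvl := c.bit_false_pos p.idx_lt h

theorem Tri.rank_false_lt {p : c.Tri} (h : p.bit = false) : p.rank false < c.size p.lvl :=
  c.lt_size p.lvl_lt p.idx_lt h

theorem Tri.succ_pred_lvl {p : c.Tri} (h : p.bit = false) : p.lvl - 1 + 1 = p.lvl := by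
  have := p.lvl_pos h
  omega

theorem Tri.rank_lt_boundary {p : c.Tri} (h : p.bit = true) (hN : ¬ p.lvl + 1 < N) :
    p.rank true < l := by
  have h1 := p.lvl_lt
  have h2 : p.lvl + 1 = N := by omega
  have := p.rank_true_lt h
  rwa [h2, c.size_last] at this

theorem bit_topTri {i j : ℕ} (hi : i < N) (hj : j < c.size (i + 1)) :
    (c.topTri i j hi hj).bit = true := (c.pos_true hj).2.1

theorem rank_topTri {i j : ℕ} (hi : i < N) (hj : j < c.size (i + 1)) :
    (c.topTri i j hi hj).rank true = j := (c.pos_true hj).2.2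

theorem bit_botTri {i j : ℕ} (h0 : 0 < i) (hi : i < N) (hj : j < c.size i) :
    (c.botTri i j h0 hi hj).bit = false := (c.pos_false h0 hi hj).2.1

theorem rank_botTri {i j : ℕ} (h0 : 0 < i) (hi : i < N) (hj : j < c.size i) :
    (c.botTri i j h0 hi hj).rank false = j := (c.pos_false h0 hi hj).2.2

theorem eq_topTri {p : c.Tri} {i j : ℕ} (h : p.bit = true) (hi : p.lvl = i)
    (hj : p.rank true = j) :
    p = c.topTri i j (hi ▸ p.lvl_lt) (hi ▸ hj ▸ p.rank_true_lt h) := by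
  subst hi hj
  exact Tri.ext' rfl ((c.1 p.lvl).pos_cnt true h).symm

theorem eq_botTri {p : c.Tri} {i j : ℕ} (h : p.bit = false) (hi : p.lvl = i)
    (hj : p.rank false = j) :
    p = c.botTri i j (hi ▸ p.lvl_pos h) (hi ▸ p.lvl_lt) (hi ▸ hj ▸ p.rank_false_lt h) := by
  subst hi hj
  exact Tri.ext' rfl ((c.1 p.lvl).pos_cnt false h).symm

variable (c)

theorem last_lt (c : Code N l) : N - 1 < N := Nat.sub_lt c.N_pos Nat.one_pos

theorem lt_size_last (j : Fin l) : (j : ℕ) < c.size (N - 1 + 1) := by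
  rw [Nat.sub_add_cancel c.N_pos, c.size_last]
  exact j.2

/-- The reversal of darts. Horizontal edge number `j` of a slice is the base of the `j`-th triangle
of the strip below pointing down, and of the `j`-th triangle of the strip above pointing up. -/
noncomputable def flipFun : c.Dart → c.Dart
  | up p => dn p
  | dn p => up p
  | base p =>
    if h : p.bit = true then
      if hN : p.lvl + 1 < N then
        base (c.botTri (p.lvl + 1) (p.rank true) (Nat.succ_pos _) hN (p.rank_true_lt h))
      else ext ⟨p.rank true, p.rank_lt_boundary h hN⟩
    else base (c.topTri (p.lvl - 1) (p.rank false) ((Nat.sub_le _ _).trans_lt p.lvl_lt)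
      ((p.succ_pred_lvl (by simpa using h)).symm ▸ p.rank_false_lt (by simpa using h)))
  | ext j => base (c.topTri (N - 1) j c.last_lt (c.lt_size_last j))

variable {c}

theorem flipFun_top {p : c.Tri} (h : p.bit = true) (hN : p.lvl + 1 < N) :
    c.flipFun (base p) =
      base (c.botTri (p.lvl + 1) (p.rank true) (Nat.succ_pos _) hN (p.rank_true_lt h)) := by
  rw [flipFun, dif_pos h, dif_pos hN]

theorem flipFun_top_last {p : c.Tri} (h : p.bit = true) (hN : ¬ p.lvl + 1 < N) :
    c.flipFun (base p) = ext ⟨p.rank true, p.rank_lt_boundary h hN⟩ := by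
  rw [flipFun, dif_pos h, dif_neg hN]

theorem flipFun_bot {p : c.Tri} (h : p.bit = false) :
    c.flipFun (base p) = base (c.topTri (p.lvl - 1) (p.rank false)
      ((Nat.sub_le _ _).trans_lt p.lvl_lt) ((p.succ_pred_lvl h).symm ▸ p.rank_false_lt h)) := by
  rw [flipFun, dif_neg (by simp [h])]

theorem flipFun_flipFun (d : c.Dart) : c.flipFun (c.flipFun d) = d := by
  cases d with
  | up p => rfl
  | dn p => rfl
  | base p =>
    cases h : p.bit
    · rw [flipFun_bot h, flipFun_top (bit_topTri _ _)]
      congr 1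
      exact (eq_botTri h (p.succ_pred_lvl h).symm (rank_topTri _ _).symm).symm
    · by_cases hN : p.lvl + 1 < N
      · rw [flipFun_top h hN, flipFun_bot (bit_botTri _ _ _)]
        congr 1
        exact (eq_topTri h rfl (rank_botTri _ _ _).symm).symm
      · rw [flipFun_top_last h hN, flipFun]
        congr 1
        refine (eq_topTri h ?_ rfl).symm
        have := p.lvl_lt
        omega
  | ext j =>
    rw [flipFun, flipFun_top_last (bit_topTri _ _)]
    · congr 1
      exact Fin.ext (rank_topTri _ _)
    · show ¬ (N - 1 + 1 < N)
      omega

variable (c)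

/-- The edge-reversing permutation of the map of a code. -/
noncomputable def flipPerm : Equiv.Perm c.Dart :=
  Function.Involutive.toPerm c.flipFun flipFun_flipFun

theorem flipFun_ne (d : c.Dart) : c.flipFun d ≠ d := by
  intro h
  cases d with
  | up p => cases h
  | dn p => cases h
  | base p =>
    cases hb : p.bit
    · rw [flipFun_bot hb] at h
      have := congrArg Tri.bit (Dart.base.inj h)
      rw [bit_topTri, hb] at this
      cases this
    · by_cases hN : p.lvl + 1 < N
      · rw [flipFun_top hb hN] at h
        have := congrArg Tri.bit (Dart.base.inj h)
        rw [bit_botTri, hb] at this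
        cases this
      · rw [flipFun_top_last hb hN] at h; cases h
  | ext j => cases h

/-- The first triangle of strip `i`. -/
def firstTri (i : ℕ) (hi : i < N) : c.Tri := Tri.mk i 0 hi (c.len_pos hi)

/-- The rooted map with a given code. -/
noncomputable def map : RootedMap c.Dart where
  rot := facePerm * c.flipPerm
  flip := c.flipPerm
  root := up (c.firstTri 0 c.N_pos)
  flip_flip := flipFun_flipFun
  flip_ne := c.flipFun_ne

theorem map_flip (d : c.Dart) : c.map.flip d = c.flipFun d := rfl

theorem map_facePerm (d : c.Dart) : c.map.facePerm d = faceFun d := by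
  show faceFun (c.flipFun (c.flipFun d)) = faceFun d
  rw [flipFun_flipFun]

theorem map_rot (d : c.Dart) : c.map.rot d = faceFun (c.flipFun d) := rfl

/-- The source vertex of a dart, as its height and its position in the slice. -/
def label : c.Dart → ℕ × ℕ
  | up p => (p.lvl, p.rank false % c.size p.lvl)
  | dn p => (p.lvl + 1, p.rank true % c.size (p.lvl + 1))
  | base p =>
    if p.bit then (p.lvl + 1, (p.rank true + 1) % c.size (p.lvl + 1))
    else (p.lvl, p.rank false % c.size p.lvl)
  | ext j => (N, j)

variable {c}

theorem Tri.cnt_succ_true {p : c.Tri} (b : Bool) (h : p.bit = b) :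
    c.cnt p.lvl b (p.idx + 1) = p.rank b + 1 := StripWord.cnt_succ_eq _ _ h

theorem Tri.cnt_succ_false {p : c.Tri} (b : Bool) (h : p.bit ≠ b) :
    c.cnt p.lvl b (p.idx + 1) = p.rank b := StripWord.cnt_succ_ne _ _ h

theorem label_base_top {p : c.Tri} (h : p.bit = true) :
    c.label (base p) = (p.lvl + 1, (p.rank true + 1) % c.size (p.lvl + 1)) := if_pos h

theorem label_base_bot {p : c.Tri} (h : p.bit = false) :
    c.label (base p) = (p.lvl, p.rank false % c.size p.lvl) := if_neg (by simp [h])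

theorem label_topTri {i j : ℕ} (hi : i < N) (hj : j < c.size (i + 1)) :
    c.label (base (c.topTri i j hi hj)) = (i + 1, (j + 1) % c.size (i + 1)) := by
  rw [label_base_top (bit_topTri hi hj), rank_topTri]
  rfl

theorem label_botTri {i j : ℕ} (h0 : 0 < i) (hi : i < N) (hj : j < c.size i) :
    c.label (base (c.botTri i j h0 hi hj)) = (i, j) := by
  rw [label_base_bot (bit_botTri h0 hi hj), rank_botTri]
  show (i, j % c.size i) = _
  rw [Nat.mod_eq_of_lt hj]

theorem finRotate_val {n : ℕ} (j : Fin n) : (finRotate n j : ℕ) = (j + 1) % n := by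
  cases n with
  | zero => exact j.elim0
  | succ n => rw [finRotate_apply, Fin.val_add, Fin.val_one']; simp

theorem label_faceFun (d : c.Dart) : c.label (faceFun d) = c.label (c.flipFun d) := by
  cases d with
  | up q =>
    obtain ⟨p, rfl⟩ : ∃ p : c.Tri, q = p.next := ⟨q.prev, q.next_prev.symm⟩
    simp only [faceFun, Tri.prev_next, flipFun]
    cases h : p.bit
    · simp only [Bool.false_eq_true, if_false, label, Tri.lvl_next, p.rank_next_true]
      rw [Tri.cnt_succ_false _ (by simp [h])]
    · simp only [if_true, label_base_top h]
      simp only [label, Tri.lvl_next, p.rank_next_true]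
      rw [Tri.cnt_succ_true _ h]
  | dn p =>
    simp only [faceFun, flipFun]
    cases h : p.bit
    · simp only [Bool.false_eq_true, if_false, label_base_bot h]
      rfl
    · simp only [if_true, label, Tri.lvl_next, p.rank_next_false]
      rw [Tri.cnt_succ_false _ (by simp [h])]
  | base p =>
    simp only [faceFun]
    cases h : p.bit
    · rw [flipFun_bot h, label_topTri]
      simp only [Bool.false_eq_true, if_false, label, Tri.lvl_next, p.rank_next_false]
      rw [Tri.cnt_succ_true _ h, p.succ_pred_lvl h]
    · simp only [if_true]
      rw [show c.label (dn p) = (p.lvl + 1, p.rank true % c.size (p.lvl + 1)) from rfl]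
      by_cases hN : p.lvl + 1 < N
      · rw [flipFun_top h hN, label_botTri, Nat.mod_eq_of_lt (p.rank_true_lt h)]
      · rw [flipFun_top_last h hN]
        simp only [label]
        rw [Nat.mod_eq_of_lt (p.rank_true_lt h)]
        have := p.lvl_lt
        congr 1
        omega
  | ext j =>
    rw [flipFun, label_topTri]
    simp only [faceFun, label, finRotate_val]
    have := c.N_pos
    rw [Nat.sub_add_cancel this, c.size_last]

/-- Turning a dart around its source preserves the label, so that labels are defined on vertices. -/
theorem label_rot (d : c.Dart) : c.label (c.map.rot d) = c.label d := by
  rw [map_rot, label_faceFun, flipFun_flipFun]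

end Code

/-- A function that grows by at most one along edges, vanishes only at the root, and can always be
decreased along an edge is the distance from the root. -/
theorem dist_eq_of_height {V : Type*} {G : SimpleGraph V} (hG : G.Connected) {r : V} (h : V → ℕ)
    (hr : h r = 0) (hadj : ∀ u v, G.Adj u v → h v ≤ h u + 1)
    (hdown : ∀ v, h v ≠ 0 → ∃ u, G.Adj u v ∧ h u + 1 = h v) (h0 : ∀ v, h v = 0 → v = r) (v : V) :
    G.dist r v = h v := by
  apply le_antisymm
  · have key : ∀ n v, h v = n → G.dist r v ≤ n := by
      intro n
      induction n with
      | zero => intro v hv; rw [h0 v hv]; simp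
      | succ n ih =>
        intro v hv
        obtain ⟨u, hu, huv⟩ := hdown v (by omega)
        have h1 := hG.dist_triangle (u := r) (v := u) (w := v)
        have h2 := ih u (by omega)
        have h3 : G.dist u v = 1 := SimpleGraph.dist_eq_one_iff_adj.2 hu
        omega
    exact key _ v rfl
  · have key : ∀ {u v : V} (w : G.Walk u v), h v ≤ h u + w.length := by
      intro u v w
      induction w with
      | nil => simp
      | cons hadj' w ih =>
        have := hadj _ _ hadj'
        rw [SimpleGraph.Walk.length_cons]
        omega
    obtain ⟨w, hw⟩ := hG.exists_walk_length_eq_dist r v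
    have := key w
    omega

namespace Code

open Dart

variable {N l : ℕ} (c : Code N l)

theorem map_rot_flip (d : c.Dart) : c.map.rot (c.flipFun d) = faceFun d := by
  rw [map_rot, flipFun_flipFun]

/-! ### Connectedness and Euler's formula for the map of a code -/

theorem dartConnected : c.map.DartConnected := by
  intro F h₁ h₂
  have hf : ∀ d, F (faceFun d) = F d := fun d => by
    rw [← c.map_rot_flip, h₁]; exact h₂ d
  have hb : ∀ p, F (base p) = F (dn p) := by
    intro p
    cases h : p.bit
    · have := hf (dn p)
      rwa [faceFun, h, if_neg (by simp)] at this
    · have := hf (base p)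
      rw [faceFun, h, if_pos rfl] at this
      exact this.symm
  have hu : ∀ p, F (up p) = F (dn p) := fun p => h₂ (dn p)
  have hn : ∀ p : c.Tri, F (dn p.next) = F (dn p) := by
    intro p
    rw [← hu]
    cases h : p.bit
    · have := hf (base p)
      rw [faceFun, h, if_neg (by simp)] at this
      rw [this, hb]
    · have := hf (dn p)
      rwa [faceFun, h, if_pos rfl] at this
  have hstrip : ∀ i (hi : i < N) k (hk : k < c.len i),
      F (dn (Tri.mk i k hi hk)) = F (dn (c.firstTri i hi)) := by
    intro i hi k
    induction k with
    | zero => intro hk; rfl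
    | succ k ih =>
      intro hk
      rw [← ih (by omega), ← hn (Tri.mk i k hi (by omega))]
      congr 2
      refine Tri.ext' rfl ?_
      show k + 1 = if k + 1 = c.len i then 0 else k + 1
      rw [if_neg (by omega)]
  have hlvl : ∀ i (hi : i < N), F (dn (c.firstTri i hi)) = F (dn (c.firstTri 0 c.N_pos)) := by
    intro i
    induction i with
    | zero => intro hi; rfl
    | succ i ih =>
      intro hi
      rw [← ih (by omega)]
      have h0 : 0 < c.size (i + 1) := c.size_pos (by omega)
      have e1 := h₂ (base (c.botTri (i + 1) 0 (Nat.succ_pos _) hi h0))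
      rw [map_flip, flipFun_bot (bit_botTri _ _ _), hb, hb] at e1
      exact (hstrip _ _ _ _).symm.trans (e1.symm.trans (hstrip _ _ _ _))
  have hall : ∀ p, F (dn p) = F (dn (c.firstTri 0 c.N_pos)) := fun p =>
    (hstrip p.lvl p.lvl_lt p.idx p.idx_lt).trans (hlvl _ _)
  have hD : ∀ d, F d = F (dn (c.firstTri 0 c.N_pos)) := by
    intro d
    cases d with
    | up p => rw [hu, hall]
    | dn p => exact hall p
    | base p => rw [hb, hall]
    | ext j =>
      rw [← h₂ (ext j), map_flip, flipFun, hb, hall]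
  intro d d'
  rw [hD d, hD d']

theorem connected : c.map.graph.Connected := RootedMap.connected_of_dartConnected _ c.dartConnected

/-- The triangle to which a dart belongs; `none` for the external face. -/
def faceLabel : c.Dart → Option c.Tri
  | up q => some q.prev
  | dn p => some p
  | base p => some p
  | ext _ => none

theorem faceLabel_faceFun (d : c.Dart) : c.faceLabel (faceFun d) = c.faceLabel d := by
  cases d with
  | up q => simp only [faceFun]; split_ifs <;> rfl
  | dn p => simp only [faceFun]; split_ifs <;> simp [faceLabel, Tri.prev_next]
  | base p => simp only [faceFun]; split_ifs <;> simp [faceLabel, Tri.prev_next]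
  | ext j => rfl

theorem face_faceFun (d : c.Dart) : c.map.face (faceFun d) = c.map.face d := by
  rw [← map_facePerm, c.map.face_facePerm]

theorem face_base (p : c.Tri) : c.map.face (base p) = c.map.face (dn p) := by
  cases h : p.bit
  · have := c.face_faceFun (dn p)
    rwa [faceFun, h, if_neg (by simp)] at this
  · have := c.face_faceFun (base p)
    rw [faceFun, h, if_pos rfl] at this
    exact this.symm

theorem face_up_next (p : c.Tri) : c.map.face (up p.next) = c.map.face (dn p) := by
  cases h : p.bit
  · have := c.face_faceFun (base p)
    rw [faceFun, h, if_neg (by simp)] at this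
    rw [this, face_base]
  · have := c.face_faceFun (dn p)
    rwa [faceFun, h, if_pos rfl] at this

/-- The first dart of the external face. -/
def firstExt : c.Dart := ext ⟨0, c.l_pos⟩

theorem face_ext (j : Fin l) : c.map.face (ext j) = c.map.face c.firstExt := by
  obtain ⟨j, hj⟩ := j
  induction j with
  | zero => rfl
  | succ j ih =>
    rw [← ih (by omega), ← c.face_faceFun (ext ⟨j, by omega⟩), faceFun]
    congr 2
    apply Fin.ext
    rw [finRotate_val]
    exact (Nat.mod_eq_of_lt hj).symm

/-- The cycles of `faceFun` are the boundaries of the triangles and of the external face. -/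
theorem face_eq_iff (d d' : c.Dart) :
    c.map.face d = c.map.face d' ↔ c.faceLabel d = c.faceLabel d' := by
  constructor
  · intro h
    exact RootedMap.eq_of_sameCycle c.map.facePerm c.faceLabel
      (fun d => by rw [map_facePerm, faceLabel_faceFun]) (c.map.face_eq_iff.1 h)
  · have key : ∀ d, c.map.face d = (c.faceLabel d).elim (c.map.face c.firstExt)
        (fun p => c.map.face (dn p)) := by
      intro d
      cases d with
      | up q =>
        have := c.face_up_next q.prev
        rwa [Tri.next_prev] at this
      | dn p => rfl
      | base p => exact c.face_base p
      | ext j => exact c.face_ext j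
    intro h
    rw [key d, key d', h]

/-- The faces of the map of a code are its triangles and the external face. -/
noncomputable def faceEquiv : Option c.Tri ≃ c.map.Face :=
  Equiv.ofBijective
    (fun o => o.elim (c.map.face c.firstExt) (fun p => c.map.face (dn p))) <| by
    constructor
    · intro o o' h
      cases o <;> cases o'
      · rfl
      · have := (c.face_eq_iff _ _).1 h; cases this
      · have := (c.face_eq_iff _ _).1 h; cases this
      · exact (c.face_eq_iff _ _).1 h
    · intro f
      obtain ⟨d, rfl⟩ := c.map.face_surjective f
      refine ⟨c.faceLabel d, ?_⟩
      cases h : c.faceLabel d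
      · exact (c.face_eq_iff _ _).2 h.symm
      · exact (c.face_eq_iff _ _).2 h.symm

theorem faceEquiv_faceLabel (d : c.Dart) : c.faceEquiv (c.faceLabel d) = c.map.face d := by
  cases h : c.faceLabel d
  · exact (c.face_eq_iff _ _).2 h.symm
  · exact (c.face_eq_iff _ _).2 h.symm

theorem card_face : Fintype.card c.map.Face = Fintype.card c.Tri + 1 := by
  rw [← Fintype.card_congr c.faceEquiv, Fintype.card_option]

theorem triangleCount_map : c.map.triangleCount = Fintype.card c.Tri := by
  rw [RootedMap.triangleCount, Nat.card_eq_fintype_card, card_face, Nat.add_sub_cancel]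

theorem card_tri : Fintype.card c.Tri = ∑ i ∈ Finset.range N, c.len i := by
  rw [Fintype.card_congr Tri.equivSigma, Fintype.card_sigma, ← Fin.sum_univ_eq_sum_range]
  simp

/-- Every triangle has a horizontal edge. Each such edge lies on two triangles, except on the last
slice. -/
theorem card_tri_add : Fintype.card c.Tri + l = 2 * ∑ i ∈ Finset.range N, c.size (i + 1) := by
  have h : ∀ n < N, (∑ i ∈ Finset.range (n + 1), c.len i) + c.size (n + 1) =
      2 * ∑ i ∈ Finset.range (n + 1), c.size (i + 1) := by
    intro n
    induction n with
    | zero =>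
      intro hn
      have h1 := (c.1 0).cnt_add (c.len 0)
      have h2 := c.cnt_false_zero le_rfl
      simp only [cnt] at h2
      simp only [Finset.range_one, Finset.sum_singleton, zero_add, size_succ, cnt]
      omega
    | succ n ih =>
      intro hn
      have h1 := (c.1 (n + 1)).cnt_add (c.len (n + 1))
      have h2 : c.cnt (n + 1) false (c.len (n + 1)) = c.size (n + 1) :=
        c.cnt_false_len (Nat.succ_pos n) hn
      simp only [cnt] at h2
      rw [Finset.sum_range_succ, Finset.sum_range_succ _ (n + 1), mul_add, ← ih (by omega)]
      have h3 := c.size_succ (n + 1)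
      simp only [cnt] at h3
      omega
  have := h (N - 1) c.last_lt
  rwa [Nat.sub_add_cancel c.N_pos, c.size_last, ← card_tri] at this

theorem two_mul_card_edge : 2 * Fintype.card c.map.Edge = 3 * Fintype.card c.Tri + l := by
  rw [← c.map.card_darts, card_eq]

/-- The vertices other than the root, in slice `i + 1` with position `j`. -/
noncomputable def sliceVertex (i j : ℕ) (hi : i < N) (hj : j < c.size (i + 1)) : c.map.Vertex :=
  c.map.source (dn (c.topTri i j hi hj))

/-- The label of a vertex: its height and its position in the slice. -/
noncomputable def vertexLabel : c.map.Vertex → ℕ × ℕ :=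
  Quotient.lift c.label fun _ _ h => RootedMap.eq_of_sameCycle c.map.rot c.label c.label_rot h

theorem vertexLabel_source (d : c.Dart) : c.vertexLabel (c.map.source d) = c.label d := rfl

theorem label_root : c.label c.map.root = (0, 0) := by
  show (0, _ % 1) = _
  rw [Nat.mod_one]

theorem vertexLabel_sliceVertex (i j : ℕ) (hi : i < N) (hj : j < c.size (i + 1)) :
    c.vertexLabel (c.sliceVertex i j hi hj) = (i + 1, j) := by
  show (i + 1, (c.topTri i j hi hj).rank true % c.size (i + 1)) = _
  rw [rank_topTri, Nat.mod_eq_of_lt hj]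

/-- The root vertex and the vertices on the slices. -/
noncomputable def vertexOf : Option ((i : Fin N) × Fin (c.size (i + 1))) → c.map.Vertex
  | none => c.map.rootVertex
  | some p => c.sliceVertex p.1 p.2 p.1.2 p.2.2

theorem vertexOf_injective : Function.Injective c.vertexOf := by
  intro o o' h
  have h' := congrArg c.vertexLabel h
  cases o with
  | none =>
    cases o' with
    | none => rfl
    | some p' =>
      simp only [vertexOf, vertexLabel_sliceVertex, RootedMap.rootVertex, vertexLabel_source,
        label_root] at h'
      cases h'
  | some p =>
    cases o' with
    | none =>
      simp only [vertexOf, vertexLabel_sliceVertex, RootedMap.rootVertex, vertexLabel_source,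
        label_root] at h'
      cases h'
    | some p' =>
      obtain ⟨⟨i, hi⟩, ⟨j, hj⟩⟩ := p
      obtain ⟨⟨i', hi'⟩, ⟨j', hj'⟩⟩ := p'
      simp only [vertexOf, vertexLabel_sliceVertex, Prod.mk.injEq, Nat.add_right_cancel_iff] at h'
      obtain ⟨rfl, rfl⟩ := h'
      rfl

theorem card_vertexIndex : Fintype.card (Option ((i : Fin N) × Fin (c.size (i + 1)))) =
    (∑ i ∈ Finset.range N, c.size (i + 1)) + 1 := by
  rw [Fintype.card_option, Fintype.card_sigma,
    ← Fin.sum_univ_eq_sum_range (fun i => c.size (i + 1))]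
  simp

/-- There are no further vertices, since the genus is nonnegative. -/
theorem vertexOf_bijective : Function.Bijective c.vertexOf := by
  refine c.vertexOf_injective.bijective_of_nat_card_le ?_
  rw [Nat.card_eq_fintype_card, Nat.card_eq_fintype_card, card_vertexIndex]
  have h1 := c.map.card_vertex_add_card_face_le c.dartConnected
  have h2 := c.two_mul_card_edge
  have h3 := c.card_tri_add
  rw [card_face] at h1
  omega

theorem isPlanar : c.map.IsPlanar := by
  have h0 := Nat.card_congr (Equiv.ofBijective _ c.vertexOf_bijective)
  rw [Nat.card_eq_fintype_card, card_vertexIndex, Nat.card_eq_fintype_card] at h0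
  have h1 := c.card_face
  have h2 := c.two_mul_card_edge
  have h3 := c.card_tri_add
  rw [RootedMap.IsPlanar]
  simp only [Nat.card_eq_fintype_card]
  omega

theorem vertexLabel_injective : Function.Injective c.vertexLabel := by
  intro u v h
  obtain ⟨o, rfl⟩ := c.vertexOf_bijective.2 u
  obtain ⟨o', rfl⟩ := c.vertexOf_bijective.2 v
  cases o with
  | none =>
    cases o' with
    | none => rfl
    | some p' =>
      simp only [vertexOf, vertexLabel_sliceVertex, RootedMap.rootVertex, vertexLabel_source,
        label_root] at h
      cases h
  | some p =>
    cases o' with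
    | none =>
      simp only [vertexOf, vertexLabel_sliceVertex, RootedMap.rootVertex, vertexLabel_source,
        label_root] at h
      cases h
    | some p' =>
      obtain ⟨⟨i, hi⟩, ⟨j, hj⟩⟩ := p
      obtain ⟨⟨i', hi'⟩, ⟨j', hj'⟩⟩ := p'
      simp only [vertexOf, vertexLabel_sliceVertex, Prod.mk.injEq, Nat.add_right_cancel_iff] at h
      obtain ⟨rfl, rfl⟩ := h
      rfl

/-! ### The map of a code is a causal triangulation -/

variable {c} in
theorem label_flip_base (p : c.Tri) : (c.label (c.flipFun (base p))).1 = (c.label (base p)).1 := by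
  cases h : p.bit
  · rw [flipFun_bot h, label_base_bot h, label_topTri, p.succ_pred_lvl h]
  · by_cases hN : p.lvl + 1 < N
    · rw [flipFun_top h hN, label_base_top h, label_botTri]
    · rw [flipFun_top_last h hN, label_base_top h]
      have := p.lvl_lt
      show N = p.lvl + 1
      omega

theorem label_flip_ext (j : Fin l) : (c.label (c.flipFun (ext j))).1 = N := by
  rw [flipFun, label_topTri]
  exact Nat.sub_add_cancel c.N_pos

theorem label_flip_le (d : c.Dart) : (c.label (c.flipFun d)).1 ≤ (c.label d).1 + 1 := by
  cases d with
  | up p => exact le_rfl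
  | dn p => show p.lvl ≤ p.lvl + 1 + 1; omega
  | base p => rw [label_flip_base]; omega
  | ext j => rw [label_flip_ext]; show N ≤ N + 1; omega

/-- The height of a dart is the first component of its label. -/
theorem dist_source (d : c.Dart) : c.map.graph.dist c.map.rootVertex (c.map.source d) =
    (c.label d).1 := by
  refine dist_eq_of_height c.connected (fun v => (c.vertexLabel v).1) ?_ ?_ ?_ ?_ _
  · exact congrArg Prod.fst c.label_root
  · rintro u v ⟨-, d, rfl, rfl⟩
    exact c.label_flip_le d
  · intro v hv
    obtain ⟨o, rfl⟩ := c.vertexOf_bijective.2 v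
    cases o with
    | none => exact absurd (congrArg Prod.fst c.label_root) hv
    | some p =>
      refine ⟨c.map.source (up (c.topTri p.1 p.2 p.1.2 p.2.2)), ⟨?_, _, rfl, rfl⟩, rfl⟩
      intro h
      have := congrArg (fun v => (c.vertexLabel v).1) h
      exact absurd this (Nat.ne_of_lt (Nat.lt_succ_self _))
  · intro v hv
    obtain ⟨o, rfl⟩ := c.vertexOf_bijective.2 v
    cases o with
    | none => rfl
    | some p =>
      simp only [vertexOf, vertexLabel_sliceVertex] at hv
      cases hv

theorem source_mem_slice (d : c.Dart) (i : ℕ) :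
    c.map.source d ∈ c.map.slice i ↔ (c.label d).1 = i := by
  rw [← dist_source]; rfl

theorem source_eq_iff (d d' : c.Dart) :
    c.map.source d = c.map.source d' ↔ c.label d = c.label d' :=
  c.vertexLabel_injective.eq_iff.symm

theorem mem_slice_succ {i : ℕ} {v : c.map.Vertex} (hv : v ∈ c.map.slice (i + 1)) :
    ∃ (j : ℕ) (hi : i < N) (hj : j < c.size (i + 1)), v = c.sliceVertex i j hi hj := by
  obtain ⟨o, rfl⟩ := c.vertexOf_bijective.2 v
  cases o with
  | none =>
    rw [vertexOf, RootedMap.rootVertex, source_mem_slice, label_root] at hv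
    cases hv
  | some p =>
    have : (c.label (dn (c.topTri p.1 p.2 p.1.2 p.2.2))).1 = i + 1 := (c.source_mem_slice _ _).1 hv
    have : (p.1 : ℕ) = i := Nat.succ.inj this
    subst this
    exact ⟨p.2, p.1.2, p.2.2, rfl⟩

theorem sliceVertex_mem (i j : ℕ) (hi : i < N) (hj : j < c.size (i + 1)) :
    c.sliceVertex i j hi hj ∈ c.map.slice (i + 1) :=
  (c.source_mem_slice _ _).2 rfl

theorem source_eq_sliceVertex {d : c.Dart} {i j : ℕ} (hi : i < N) (hj : j < c.size (i + 1))
    (h : c.label d = (i + 1, j)) : c.map.source d = c.sliceVertex i j hi hj := by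
  apply c.vertexLabel_injective
  rw [vertexLabel_sliceVertex, vertexLabel_source, h]

theorem slice_connected {i : ℕ} (hi : i < N) :
    (c.map.graph.induce (c.map.slice (i + 1))).Connected := by
  have h0 : 0 < c.size (i + 1) := c.size_pos hi
  have key : ∀ j (hj : j < c.size (i + 1)),
      (c.map.graph.induce (c.map.slice (i + 1))).Reachable
        ⟨c.sliceVertex i 0 hi h0, c.sliceVertex_mem i 0 hi h0⟩
        ⟨c.sliceVertex i j hi hj, c.sliceVertex_mem i j hi hj⟩ := by
    intro j
    induction j with
    | zero => intro hj; exact SimpleGraph.Reachable.refl _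
    | succ j ih =>
      intro hj
      refine (ih (by omega)).trans (SimpleGraph.Adj.reachable (SimpleGraph.Adj.symm ?_))
      refine ⟨?_, base (c.topTri i j hi (by omega)), ?_, ?_⟩
      · intro h
        have := congrArg c.vertexLabel h
        simp [vertexLabel_sliceVertex] at this
      · refine c.source_eq_sliceVertex _ _ ?_
        rw [label_topTri, Nat.mod_eq_of_lt hj]
      · refine c.source_eq_sliceVertex _ _ ?_
        rw [map_flip, ← label_faceFun, faceFun, bit_topTri, if_pos rfl]
        exact c.vertexLabel_sliceVertex i j hi (by omega)
  have : Nonempty (c.map.slice (i + 1)) := ⟨⟨_, c.sliceVertex_mem i 0 hi h0⟩⟩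
  refine ⟨?_⟩
  rintro ⟨u, hu⟩ ⟨v, hv⟩
  obtain ⟨j, hi, hj, rfl⟩ := c.mem_slice_succ hu
  obtain ⟨j', hi, hj', rfl⟩ := c.mem_slice_succ hv
  exact (key j hj).symm.trans (key j' hj')

theorem label_flip_topTri {i j : ℕ} (hi : i < N) (hj : j < c.size (i + 1)) :
    c.label (c.flipFun (base (c.topTri i j hi hj))) = (i + 1, j) := by
  rw [← label_faceFun, faceFun, bit_topTri, if_pos rfl]
  exact c.vertexLabel_sliceVertex i j hi hj

/-- A dart in a slice is one of the two directions of a horizontal edge. -/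
theorem horizontal_cases {d : c.Dart} {i : ℕ} (h1 : (c.label d).1 = i + 1)
    (h2 : (c.label (c.flipFun d)).1 = i + 1) : ∃ (hi : i < N) (j : ℕ) (hj : j < c.size (i + 1)),
      d = base (c.topTri i j hi hj) ∨ d = c.flipFun (base (c.topTri i j hi hj)) := by
  cases d with
  | up p =>
    have a : p.lvl = i + 1 := h1
    have b : p.lvl + 1 = i + 1 := h2
    omega
  | dn p =>
    have a : p.lvl = i + 1 := h2
    have b : p.lvl + 1 = i + 1 := h1
    omega
  | base p =>
    cases h : p.bit
    · rw [label_base_bot h] at h1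
      have a : p.lvl = i + 1 := h1
      have hi : i < N := by have := p.lvl_lt; omega
      have hj : p.rank false < c.size (i + 1) := a ▸ p.rank_false_lt h
      refine ⟨hi, p.rank false, hj, Or.inr ?_⟩
      rw [← flipFun_flipFun (base p), flipFun_bot h]
      congr 2
      refine Tri.ext' (by show p.lvl - 1 = i; omega) ?_
      show c.pos (p.lvl - 1) true _ = c.pos i true _
      congr 1
      omega
    · rw [label_base_top h] at h1
      have a : p.lvl = i := Nat.succ.inj h1
      have hi : i < N := a ▸ p.lvl_lt
      exact ⟨hi, p.rank true, a ▸ p.rank_true_lt h, Or.inl (congrArg base (eq_topTri h a rfl))⟩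
  | ext j =>
    have a : N = i + 1 := h1
    have hi : i < N := by omega
    refine ⟨hi, j, by rw [← a, c.size_last]; exact j.2, Or.inr ?_⟩
    rw [← flipFun_flipFun (ext j)]
    congr 1
    rw [flipFun]
    congr 1
    refine Tri.ext' (by show N - 1 = i; omega) ?_
    show c.pos (N - 1) true _ = c.pos i true _
    congr 1
    omega

/-- The two directions of horizontal edges are distinct: in one of them the face is the triangle
below, in the other one it is the triangle above or the external face. -/
theorem topTri_ne_flip {i j j' : ℕ} (hi : i < N) (hj : j < c.size (i + 1))
    (hj' : j' < c.size (i + 1)) :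
    base (c.topTri i j hi hj) ≠ c.flipFun (base (c.topTri i j' hi hj')) := by
  intro h
  by_cases hN : (c.topTri i j' hi hj').lvl + 1 < N
  · rw [flipFun_top (bit_topTri _ _) hN] at h
    have := congrArg Tri.bit (Dart.base.inj h)
    rw [bit_topTri, bit_botTri] at this
    cases this
  · rw [flipFun_top_last (bit_topTri _ _) hN] at h
    cases h

theorem formsCycle {i : ℕ} (hi : i < N) : c.map.FormsCycle (c.map.slice (i + 1)) := by
  refine ⟨c.slice_connected hi, fun v hv => ?_⟩
  obtain ⟨j, _, hj, rfl⟩ := c.mem_slice_succ hv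
  have hpos := c.size_pos (i := i + 1) hi
  -- the edge entering position `j` is number `j - 1`, cyclically
  set j' := (j + (c.size (i + 1) - 1)) % c.size (i + 1) with hj'
  have hlt : j' < c.size (i + 1) := Nat.mod_lt _ hpos
  have hmod : (j' + 1) % c.size (i + 1) = j := by
    rw [hj', Nat.mod_add_mod, show j + (c.size (i + 1) - 1) + 1 = j + c.size (i + 1) by omega,
      Nat.add_mod_right, Nat.mod_eq_of_lt hj]
  have hset : {d | c.map.source d = c.sliceVertex i j hi hj ∧
      c.map.source (c.map.flip d) ∈ c.map.slice (i + 1)} =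
      {base (c.topTri i j' hi hlt), c.flipFun (base (c.topTri i j hi hj))} := by
    ext d
    simp only [Set.mem_ofPred_eq, Set.mem_insert_iff, Set.mem_singleton_iff, map_flip,
      source_mem_slice]
    constructor
    · rintro ⟨h1, h2⟩
      have h1' := congrArg c.vertexLabel h1
      rw [vertexLabel_source, vertexLabel_sliceVertex] at h1'
      obtain ⟨_, k, hk, rfl | rfl⟩ := c.horizontal_cases (by rw [h1']) h2
      · left
        rw [label_topTri] at h1'
        have : (k + 1) % c.size (i + 1) = (j' + 1) % c.size (i + 1) := by
          rw [hmod]; exact congrArg Prod.snd h1'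
        have : k = j' := by
          have := Nat.ModEq.add_right_cancel' 1 this
          rwa [Nat.ModEq, Nat.mod_eq_of_lt hk, Nat.mod_eq_of_lt hlt] at this
        subst this
        rfl
      · right
        rw [label_flip_topTri] at h1'
        have : k = j := congrArg Prod.snd h1'
        subst this
        rfl
    · rintro (rfl | rfl)
      · refine ⟨c.source_eq_sliceVertex _ _ (by rw [label_topTri, hmod]), ?_⟩
        rw [label_flip_topTri]
      · refine ⟨c.source_eq_sliceVertex _ _ (by rw [label_flip_topTri]), ?_⟩
        rw [flipFun_flipFun, label_topTri]
  rw [hset, Set.ncard_pair (c.topTri_ne_flip _ _ _)]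

theorem isCausal : c.map.IsCausal N l where
  connected := c.connected
  planar := c.isPlanar
  no_root_loop d h1 h2 := by
    rw [RootedMap.rootVertex, source_eq_iff, label_root] at h1
    rw [RootedMap.rootVertex, source_eq_iff, label_root, map_flip] at h2
    cases d with
    | up p =>
      have : p.lvl + 1 = 0 := congrArg Prod.fst h2
      cases this
    | dn p =>
      have : p.lvl + 1 = 0 := congrArg Prod.fst h1
      cases this
    | base p =>
      cases h : p.bit
      · rw [label_base_bot h] at h1
        have := congrArg Prod.fst h1
        exact absurd this (p.lvl_pos h).ne'
      · rw [label_base_top h] at h1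
        cases congrArg Prod.fst h1
    | ext j => exact absurd (congrArg Prod.fst h1) c.N_pos.ne'
  slices i h1 h2 := by
    obtain ⟨n, rfl⟩ := Nat.exists_eq_succ_of_ne_zero (Nat.one_le_iff_ne_zero.1 h1)
    exact c.formsCycle h2
  last i hi := by
    obtain ⟨n, rfl⟩ := Nat.exists_eq_succ_of_ne_zero (Nat.ne_zero_of_lt hi)
    ext v
    simp only [Set.mem_empty_iff_false, iff_false]
    intro hv
    obtain ⟨_, h, _⟩ := c.mem_slice_succ hv
    omega
  boundary := by
    obtain ⟨n, rfl⟩ := Nat.exists_eq_succ_of_ne_zero c.N_pos.ne'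
    have hn' : n < n.succ := Nat.lt_succ_self n
    have hs : c.map.slice n.succ = Set.range
        (fun j : Fin (c.size (n + 1)) => c.sliceVertex n j hn' j.2) := by
      ext v
      constructor
      · intro hv
        obtain ⟨j, _, hj, rfl⟩ := c.mem_slice_succ hv
        exact ⟨⟨j, hj⟩, rfl⟩
      · rintro ⟨j, rfl⟩
        exact c.sliceVertex_mem _ _ _ _
    rw [hs, Set.ncard_range_of_injective, Nat.card_eq_fintype_card, Fintype.card_fin]
    · exact c.size_last
    · intro j j' h
      have := congrArg c.vertexLabel h
      simp only [vertexLabel_sliceVertex, Prod.mk.injEq] at this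
      exact Fin.ext this.2
  triangles := by
    refine ⟨c.map.face c.firstExt, fun d hd => ?_, fun f hf => ?_⟩
    · have h1 := (c.face_eq_iff _ _).1 hd
      cases d with
      | ext j => exact (c.source_mem_slice _ _).2 rfl
      | up p => cases h1
      | dn p => cases h1
      | base p => cases h1
    · obtain ⟨o, rfl⟩ := c.faceEquiv.surjective f
      cases o with
      | none => exact absurd rfl hf
      | some p =>
        have hset : {d | c.map.face d = c.faceEquiv (some p)} = {up p.next, dn p, base p} := by
          ext d
          simp only [Set.mem_ofPred_eq, Set.mem_insert_iff, Set.mem_singleton_iff]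
          rw [← faceEquiv_faceLabel, c.faceEquiv.apply_eq_iff_eq]
          cases d with
          | up q =>
            simp only [faceLabel, Option.some.injEq, Dart.up.injEq, reduceCtorEq, or_false]
            constructor
            · rintro rfl; exact q.next_prev.symm
            · rintro rfl; exact p.prev_next
          | dn q => simp [faceLabel]
          | base q => simp [faceLabel]
          | ext j => simp [faceLabel]
        exact Set.ncard_eq_three.2 ⟨_, _, _, by simp, by simp, by simp, hset⟩

end Code

/-! ### Local structure of causal triangulations -/

/-- A property that spreads along the edges inside a connected set spreads to the whole set. -/
theorem propagate {V : Type*} {G : SimpleGraph V} {S : Set V} (hS : (G.induce S).Connected)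
    (P : V → Prop) (step : ∀ u v, u ∈ S → v ∈ S → G.Adj u v → P u → P v) {u v : V} (hu : u ∈ S)
    (hv : v ∈ S) (h : P u) : P v := by
  obtain ⟨w⟩ := hS.preconnected ⟨u, hu⟩ ⟨v, hv⟩
  have key : ∀ {x y : S}, (G.induce S).Walk x y → P x → P y := by
    intro x y w
    induction w with
    | nil => exact id
    | cons hadj _ ih => exact fun hx => ih (step _ _ (Subtype.prop _) (Subtype.prop _) hadj hx)
  exact key w h

theorem exists_adj_of_dist_succ {V : Type*} {G : SimpleGraph V} (hG : G.Connected) {r v : V}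
    {n : ℕ} (h : G.dist r v = n + 1) : ∃ u, G.Adj u v ∧ G.dist r u = n := by
  obtain ⟨w, hw⟩ := hG.exists_walk_length_eq_dist v r
  rw [SimpleGraph.dist_comm, h] at hw
  cases w with
  | nil => simp at hw
  | @cons _ u _ hadj w =>
    refine ⟨u, hadj.symm, ?_⟩
    rw [SimpleGraph.Walk.length_cons] at hw
    have h1 := SimpleGraph.dist_le w
    have h2 := hG.dist_triangle (u := r) (v := u) (w := v)
    have h3 : G.dist u v = 1 := SimpleGraph.dist_eq_one_iff_adj.2 hadj.symm
    have h4 : G.dist r u = G.dist u r := SimpleGraph.dist_comm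
    omega

theorem minimalPeriod_eq {α : Type*} {f : α → α} {x : α} {L : ℕ} (hL : 0 < L) (h : f^[L] x = x)
    (hne : ∀ j, 0 < j → j < L → f^[j] x ≠ x) : Function.minimalPeriod f x = L := by
  have h1 : Function.IsPeriodicPt f L x := h
  have h2 := h1.minimalPeriod_le hL
  have h3 := h1.minimalPeriod_pos hL
  by_contra h4
  exact hne _ h3 (lt_of_le_of_ne h2 h4) Function.iterate_minimalPeriod

namespace RootedMap

variable {D : Type} (M : RootedMap D)

/-- The dart goes from a slice to the next one. -/
def Up (d : D) : Prop := M.height (M.flip d) = M.height d + 1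

/-- The dart goes from a slice to the previous one. -/
def Dn (d : D) : Prop := M.height d = M.height (M.flip d) + 1

/-- The dart stays in a slice. -/
def Hor (d : D) : Prop := M.height (M.flip d) = M.height d

open Classical in
/-- The first horizontal dart strictly after `d` in the rotation around its source. -/
noncomputable def nextHor (d : D) : D :=
  if h : ∃ n, M.Hor ((M.rot ^ (n + 1)) d) then (M.rot ^ (Nat.find h + 1)) d else d

open Classical in
/-- From an upward edge to the next upward edge of the same strip. -/
noncomputable def nextUp (d : D) : D :=
  if M.Up (M.rot d) then M.rot d else M.rot (M.flip (M.rot d))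

/-- From a horizontal dart to the following one in the same slice. -/
noncomputable def around (d : D) : D := M.nextHor (M.flip d)

variable {M}

theorem height_rot (d : D) : M.height (M.rot d) = M.height d := by
  rw [height, source_rot, height]

theorem height_eq_of_source {d d' : D} (h : M.source d = M.source d') :
    M.height d = M.height d' := by
  rw [height, h, height]

theorem height_facePerm (d : D) : M.height (M.facePerm d) = M.height (M.flip d) := height_rot _

theorem rot_flip_eq (d : D) : M.rot (M.flip d) = M.facePerm d := rfl

theorem Up.flip {d : D} (h : M.Up d) : M.Dn (M.flip d) := by
  rw [Dn, M.flip_flip]; exact h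

theorem Up.not_hor {d : D} (h : M.Up d) : ¬ M.Hor d := by
  unfold Up at h; unfold Hor; omega

theorem Dn.not_hor {d : D} (h : M.Dn d) : ¬ M.Hor d := by
  unfold Dn at h; unfold Hor; omega

theorem Dn.not_up {d : D} (h : M.Dn d) : ¬ M.Up d := by
  unfold Dn at h; unfold Up; omega

theorem Hor.flip {d : D} (h : M.Hor d) : M.Hor (M.flip d) := by
  rw [Hor, M.flip_flip]; exact h.symm

open Classical in
theorem nextHor_of_hor {d : D} (h : M.Hor (M.rot d)) : M.nextHor d = M.rot d := by
  have h0 : M.Hor ((M.rot ^ (0 + 1)) d) := by simpa using h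
  have hex : ∃ n, M.Hor ((M.rot ^ (n + 1)) d) := ⟨0, h0⟩
  rw [nextHor, dif_pos hex, show Nat.find hex = 0 from (Nat.find_eq_zero hex).2 h0]
  simp

theorem pow_succ_rot (d : D) (n : ℕ) : (M.rot ^ n) (M.rot d) = (M.rot ^ (n + 1)) d := by
  rw [pow_succ, Equiv.Perm.mul_apply]

open Classical in
theorem nextHor_of_not_hor {d : D} (h : ¬ M.Hor (M.rot d))
    (hex : ∃ n, M.Hor ((M.rot ^ (n + 1)) d)) : M.nextHor d = M.nextHor (M.rot d) := by
  have hex' : ∃ n, M.Hor ((M.rot ^ (n + 1)) (M.rot d)) := by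
    obtain ⟨n, hn⟩ := hex
    cases n with
    | zero => exact absurd (by simpa using hn) h
    | succ n => exact ⟨n, by rwa [pow_succ_rot]⟩
  have h0 : ¬ M.Hor ((M.rot ^ (0 + 1)) d) := by simpa using h
  rw [nextHor, dif_pos hex, nextHor, dif_pos hex', pow_succ_rot]
  congr 2
  have hex2 : ∃ n, M.Hor ((M.rot ^ (n + 1 + 1)) d) := by
    obtain ⟨n, hn⟩ := hex'
    exact ⟨n, by rwa [pow_succ_rot] at hn⟩
  have e := Nat.find_comp_succ hex hex2 h0
  rw [e]
  have : Nat.find hex' = Nat.find hex2 := by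
    congr 1
  omega

/-- Rotating a dart with a property that persists until the next horizontal dart, the dart in front
of that horizontal dart has the property. -/
theorem exists_rot_eq_nextHor {Q : D → Prop} (hQ : ∀ x, Q x → Q (M.rot x) ∨ M.Hor (M.rot x))
    {d : D} (hex : ∃ n, M.Hor ((M.rot ^ (n + 1)) d)) (hd : Q d) :
    ∃ z, Q z ∧ M.rot z = M.nextHor d := by
  obtain ⟨n, hn⟩ := hex
  induction n generalizing d with
  | zero => exact ⟨d, hd, (nextHor_of_hor (by simpa using hn)).symm⟩
  | succ n ih =>
    by_cases h : M.Hor (M.rot d)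
    · exact ⟨d, hd, (nextHor_of_hor h).symm⟩
    · rw [nextHor_of_not_hor h ⟨_, hn⟩]
      exact ih ((hQ d hd).resolve_right h) (by rwa [pow_succ_rot])

theorem source_pow_rot (d : D) (n : ℕ) : M.source ((M.rot ^ n) d) = M.source d := by
  induction n with
  | zero => simp
  | succ n ih => rw [pow_succ', Equiv.Perm.mul_apply, source_rot, ih]

theorem source_nextHor (d : D) : M.source (M.nextHor d) = M.source d := by
  rw [nextHor]
  split_ifs
  · exact source_pow_rot _ _
  · rfl

/-- A face with three darts is a cycle of length three. -/
theorem facePerm_cube_of_ne [Finite D] {f₀ : M.Face}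
    (h₀ : ∀ f, f ≠ f₀ → {d | M.face d = f}.ncard = 3) {d : D}
    (hd : M.face d ≠ f₀) : M.facePerm (M.facePerm (M.facePerm d)) = d := by
  have h1 := h₀ _ hd
  set S : Set D := {d' | M.face d' = M.face d} with hS
  have hfin : S.Finite := Set.toFinite _
  have hc : M.facePerm.IsCycleOn (hfin.toFinset : Set D) := by
    rw [Set.Finite.coe_toFinset]
    constructor
    · refine ⟨fun x hx => ?_, M.facePerm.injective.injOn, fun x hx => ?_⟩
      · show M.face _ = _
        rw [face_facePerm]; exact hx
      · refine ⟨M.facePerm.symm x, ?_, M.facePerm.apply_symm_apply x⟩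
        show M.face _ = _
        rw [← face_facePerm, Equiv.apply_symm_apply]; exact hx
    · intro x hx y hy
      exact M.face_eq_iff.1 (Eq.trans hx (Eq.symm hy))
  have h2 := hc.pow_card_apply (a := d) (by simp [hS])
  rw [← Set.ncard_eq_toFinset_card S hfin, h1] at h2
  exact h2

theorem height_nextHor (d : D) : M.height (M.nextHor d) = M.height d :=
  height_eq_of_source (source_nextHor d)

namespace IsCausal

variable {N l : ℕ} (hM : M.IsCausal N l)

include hM

theorem height_flip_le (d : D) : M.height (M.flip d) ≤ M.height d + 1 := by
  by_cases h : M.source d = M.source (M.flip d)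
  · rw [height_eq_of_source h]; omega
  · have h1 : M.graph.Adj (M.source d) (M.source (M.flip d)) := ⟨h, d, rfl, rfl⟩
    have h2 := hM.connected.dist_triangle (u := M.rootVertex) (v := M.source d)
      (w := M.source (M.flip d))
    rw [SimpleGraph.dist_eq_one_iff_adj.2 h1] at h2
    exact h2

theorem height_le_flip (d : D) : M.height d ≤ M.height (M.flip d) + 1 := by
  have := hM.height_flip_le (M.flip d)
  rwa [M.flip_flip] at this

theorem height_le (d : D) : M.height d ≤ N := by
  by_contra h
  have h1 : M.source d ∈ M.slice (M.height d) := rfl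
  rw [hM.last _ (by omega)] at h1
  exact h1

theorem height_eq_zero {d : D} : M.height d = 0 ↔ M.source d = M.rootVertex := by
  rw [height, hM.connected.dist_eq_zero_iff, eq_comm]

theorem kinds (d : D) : M.Up d ∨ M.Dn d ∨ M.Hor d := by
  have h1 := hM.height_flip_le d
  have h2 := hM.height_le_flip d
  unfold Up Dn Hor
  omega

theorem one_le_of_hor {d : D} (h : M.Hor d) : 1 ≤ M.height d := by
  by_contra h1
  have h2 : M.height d = 0 := by omega
  exact hM.no_root_loop d (hM.height_eq_zero.1 h2) (hM.height_eq_zero.1 (h.trans h2))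

theorem ncard_hor {d : D} (hd : 1 ≤ M.height d) :
    {x | M.source x = M.source d ∧ M.Hor x}.ncard = 2 := by
  rw [← (hM.slices (M.height d) hd (hM.height_le d)).2 (M.source d) rfl]
  congr 1
  ext x
  simp only [Set.mem_ofPred_eq]
  refine and_congr_right fun h => ?_
  rw [Hor, height_eq_of_source h]
  rfl

theorem height_lt_of_up {d : D} (h : M.Up d) : M.height d < N := by
  have := hM.height_le (M.flip d)
  unfold Up at h
  omega

variable [Finite D]

/-- The face of a dart that starts or ends below the last slice is a triangle. -/
theorem facePerm_cube {d : D} (hd : M.height d < N ∨ M.height (M.flip d) < N) :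
    M.facePerm (M.facePerm (M.facePerm d)) = d := by
  obtain ⟨f₀, h1, h2⟩ := hM.triangles
  refine RootedMap.facePerm_cube_of_ne h2 fun h => ?_
  have h3 : M.height d = N := h1 d h
  have h4 : M.height (M.facePerm d) = N := h1 _ ((M.face_facePerm d).trans h)
  rw [height_facePerm] at h4
  omega

theorem exists_hor {d : D} (hd : 1 ≤ M.height d) : ∃ n, M.Hor ((M.rot ^ (n + 1)) d) := by
  have h1 := hM.ncard_hor hd
  obtain ⟨x, hx, hx'⟩ := Set.nonempty_of_ncard_ne_zero (by rw [h1]; norm_num)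
  obtain ⟨n, hn, -, hnx⟩ := (M.source_eq_iff.1 hx.symm).exists_pow_eq''
  obtain ⟨m, rfl⟩ := Nat.exists_eq_succ_of_ne_zero hn.ne'
  exact ⟨m, by rw [Nat.succ_eq_add_one] at hnx; rwa [hnx]⟩

theorem hor_nextHor {d : D} (hd : 1 ≤ M.height d) : M.Hor (M.nextHor d) := by
  classical
  have h := hM.exists_hor hd
  rw [nextHor, dif_pos h]
  convert Nat.find_spec h

theorem nextHor_eq {d : D} (hd : 1 ≤ M.height d) (h : ¬ M.Hor (M.rot d)) :
    M.nextHor d = M.nextHor (M.rot d) := nextHor_of_not_hor h (hM.exists_hor hd)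

/-- The rotation reaches the second horizontal dart of a vertex before it returns. -/
theorem nextHor_ne {d : D} (hd : M.Hor d) : M.nextHor d ≠ d := by
  classical
  intro h
  have h1 := hM.one_le_of_hor hd
  have hex := hM.exists_hor h1
  obtain ⟨b, ⟨hb, hb'⟩, hbd⟩ :=
    Set.exists_ne_of_one_lt_ncard (by rw [hM.ncard_hor h1]; norm_num) d
  obtain ⟨m, -, -, hm⟩ := (M.source_eq_iff.1 hb.symm).exists_pow_eq''
  have hper : (M.rot ^ (Nat.find hex + 1)) d = d := by
    have h' := h
    rw [nextHor, dif_pos hex] at h'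
    convert h'
  have hmod : (M.rot ^ (m % (Nat.find hex + 1))) d = b := by
    rw [← hm]
    conv_rhs => rw [← Nat.mod_add_div m (Nat.find hex + 1), pow_add, Equiv.Perm.mul_apply, pow_mul]
    congr 1
    generalize m / (Nat.find hex + 1) = q
    induction q with
    | zero => simp
    | succ q ih => rw [pow_succ, Equiv.Perm.mul_apply, hper]; exact ih
  rcases hq : m % (Nat.find hex + 1) with _ | q
  · rw [hq] at hmod
    exact hbd (by simpa using hmod.symm)
  · have hlt := Nat.mod_lt m (Nat.succ_pos (Nat.find hex))
    rw [Nat.succ_eq_add_one, hq] at hlt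
    rw [hq] at hmod
    exact Nat.find_min hex (m := q) (by omega) (by rw [hmod]; exact hb')

/-- Every vertex on a slice has exactly two horizontal darts. -/
theorem hor_cases {d x : D} (hd : M.Hor d) (hx : M.Hor x) (hs : M.source x = M.source d) :
    x = d ∨ x = M.nextHor d := by
  have h1 := hM.one_le_of_hor hd
  obtain ⟨a, b, hab, hset⟩ := Set.ncard_eq_two.1 (hM.ncard_hor h1)
  have m1 : d ∈ ({a, b} : Set D) := hset ▸ ⟨rfl, hd⟩
  have m2 : x ∈ ({a, b} : Set D) := hset ▸ ⟨hs, hx⟩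
  have m3 : M.nextHor d ∈ ({a, b} : Set D) := hset ▸ ⟨source_nextHor d, hM.hor_nextHor h1⟩
  have m4 := hM.nextHor_ne hd
  rcases m1 with rfl | rfl <;> rcases m2 with rfl | rfl <;> rcases m3 with m3 | m3 <;>
    simp_all

theorem nextHor_nextHor {d : D} (hd : M.Hor d) : M.nextHor (M.nextHor d) = d := by
  have h1 := hM.hor_nextHor (hM.one_le_of_hor hd)
  rcases hM.hor_cases h1 hd (source_nextHor d).symm with h | h
  · exact absurd h.symm (hM.nextHor_ne hd)
  · exact h.symm

/-- The dart after an upward one closes a triangle with it, so it cannot go down. -/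
theorem up_rot {d : D} (h : M.Up d) : M.Up (M.rot d) ∨ M.Hor (M.rot d) := by
  have hlt := hM.height_lt_of_up h
  have h3 := hM.facePerm_cube (d := M.flip d) (Or.inr (by rwa [M.flip_flip]))
  have e1 : M.facePerm (M.flip d) = M.rot d := by rw [facePerm_apply, M.flip_flip]
  rw [e1] at h3
  have a1 := hM.height_flip_le (M.facePerm (M.rot d))
  have a2 := hM.height_le_flip (M.facePerm (M.rot d))
  rw [← height_facePerm (M.facePerm (M.rot d)), h3, height_facePerm] at a1 a2
  have a3 := hM.height_flip_le (M.rot d)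
  rw [height_rot] at a3
  unfold Up Hor at *
  rw [height_rot]
  omega

/-- The dart after a downward one closes a triangle with it, so it cannot go up. -/
theorem dn_rot {d : D} (h : M.Dn d) : M.Dn (M.rot d) ∨ M.Hor (M.rot d) := by
  have hlt := hM.height_le d
  have h3 := hM.facePerm_cube (d := M.flip d) (Or.inl (by unfold Dn at h; omega))
  have e1 : M.facePerm (M.flip d) = M.rot d := by rw [facePerm_apply, M.flip_flip]
  rw [e1] at h3
  have a1 := hM.height_flip_le (M.facePerm (M.rot d))
  have a2 := hM.height_le_flip (M.facePerm (M.rot d))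
  rw [← height_facePerm (M.facePerm (M.rot d)), h3, height_facePerm] at a1 a2
  have a3 := hM.height_le_flip (M.rot d)
  rw [height_rot] at a3
  unfold Dn Hor at *
  rw [height_rot]
  omega

/-- Two consecutive upward darts and the horizontal edge above them. -/
theorem top_triangle {d : D} (h : M.Up d) (h' : M.Up (M.rot d)) :
    M.rot (M.flip (M.rot (M.flip (M.rot d)))) = M.flip d ∧
      M.Hor (M.rot (M.flip (M.rot d))) := by
  have hlt := hM.height_lt_of_up h
  have h3 := hM.facePerm_cube (d := M.flip d) (Or.inr (by rwa [M.flip_flip]))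
  have e1 : M.facePerm (M.flip d) = M.rot d := by rw [facePerm_apply, M.flip_flip]
  rw [e1] at h3
  refine ⟨h3, ?_⟩
  have a := height_facePerm (M := M) (M.facePerm (M.rot d))
  rw [h3] at a
  rw [rot_flip_eq, Hor, ← a, height_facePerm]
  unfold Up at h h'
  rw [h', h, height_rot]

/-- A triangle based on a horizontal edge below. -/
theorem bot_triangle {d : D} (h : M.Up d) (h' : M.Hor (M.rot d)) :
    M.rot (M.flip (M.rot (M.flip (M.rot d)))) = M.flip d ∧
      M.Up (M.rot (M.flip (M.rot d))) ∧
      M.height (M.rot (M.flip (M.rot d))) = M.height d := by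
  have hlt := hM.height_lt_of_up h
  have h3 := hM.facePerm_cube (d := M.flip d) (Or.inr (by rwa [M.flip_flip]))
  have e1 : M.facePerm (M.flip d) = M.rot d := by rw [facePerm_apply, M.flip_flip]
  rw [e1] at h3
  have a := height_facePerm (M := M) (M.facePerm (M.rot d))
  rw [h3] at a
  have b : M.height (M.rot (M.flip (M.rot d))) = M.height d := by
    rw [height_rot]; unfold Hor at h'; rw [h', height_rot]
  refine ⟨h3, ?_, b⟩
  rw [rot_flip_eq] at b ⊢
  unfold Up at h ⊢
  rw [← a, h, b]

theorem nextUp_up {d : D} (h : M.Up d) :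
    M.Up (M.nextUp d) ∧ M.height (M.nextUp d) = M.height d := by
  rw [nextUp]
  split_ifs with h'
  · exact ⟨h', height_rot d⟩
  · exact (hM.bot_triangle h ((hM.up_rot h).resolve_left h')).2

theorem nextUp_injOn {d d' : D} (h : M.Up d) (h' : M.Up d') (he : M.nextUp d = M.nextUp d') :
    d = d' := by
  have key : ∀ {x y : D}, M.Up x → M.Up y → ¬ M.Up (M.rot y) →
      M.rot x = M.rot (M.flip (M.rot y)) → False := by
    intro x y hx hy hy' hxy
    have h1 : M.Hor (M.flip (M.rot y)) := ((hM.up_rot hy).resolve_left hy').flip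
    rw [← M.rot.injective hxy] at h1
    exact hx.not_hor h1
  rw [nextUp, nextUp] at he
  split_ifs at he with h1 h2 h2
  · exact M.rot.injective he
  · exact (key h h' h2 he).elim
  · exact (key h' h h1 he.symm).elim
  · exact M.rot.injective (M.flip.injective (M.rot.injective he))

/-- `nextUp` is a permutation of the finite set of upward darts. -/
theorem mem_periodicPts_nextUp {d : D} (h : M.Up d) : d ∈ Function.periodicPts M.nextUp := by
  let f : {d // M.Up d} → {d // M.Up d} := fun x => ⟨M.nextUp x, (hM.nextUp_up x.2).1⟩
  have hf : Function.Injective f := fun x y hxy =>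
    Subtype.ext (hM.nextUp_injOn x.2 y.2 (congrArg Subtype.val hxy))
  have h1 := hf.mem_periodicPts ⟨d, h⟩
  have hs : Function.Semiconj (Subtype.val : {d // M.Up d} → D) f M.nextUp := fun _ => rfl
  exact hs.mapsTo_periodicPts h1

/-- The rotation arrives at an upward dart from a horizontal dart. -/
theorem exists_hor_before_up {x : D} (hx : M.Up x) (h1 : 1 ≤ M.height x) :
    ∃ z, M.Hor z ∧ M.Up (M.rot z) ∧ M.nextHor z = M.nextHor x ∧ M.source z = M.source x := by
  obtain ⟨h, ⟨hs, hh⟩⟩ := Set.nonempty_of_ncard_ne_zero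
    (show {y | M.source y = M.source x ∧ M.Hor y}.ncard ≠ 0 by rw [hM.ncard_hor h1]; norm_num)
  obtain ⟨n, hn, -, hnx⟩ := (M.source_eq_iff.1 hs).exists_pow_eq''
  obtain ⟨m, rfl⟩ := Nat.exists_eq_succ_of_ne_zero hn.ne'
  clear hn
  rw [Nat.succ_eq_add_one] at hnx
  induction m generalizing x with
  | zero =>
    simp only [zero_add, pow_one] at hnx
    subst hnx
    refine ⟨h, hh, hx, hM.nextHor_eq ?_ hx.not_hor, hs⟩
    rwa [height_rot] at h1
  | succ m ih =>
    obtain ⟨x', hx'⟩ : ∃ x', x' = (M.rot ^ (m + 1)) h := ⟨_, rfl⟩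
    have hr : M.rot x' = x := by rw [← hnx, hx', pow_succ' _ (m + 1), Equiv.Perm.mul_apply]
    have hs' : M.source x' = M.source x := by rw [← hr, source_rot]
    have h1' : 1 ≤ M.height x' := by rwa [height_eq_of_source hs']
    have hnh : M.nextHor x' = M.nextHor x := by
      rw [← hr]; exact hM.nextHor_eq h1' (by rw [hr]; exact hx.not_hor)
    rcases hM.kinds x' with h' | h' | h'
    · obtain ⟨z, hz1, hz2, hz3, hz4⟩ := ih h' h1' (hs.trans hs'.symm) hx'.symm
      exact ⟨z, hz1, hz2, hz3.trans hnh, hz4.trans hs'⟩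
    · rcases hM.dn_rot h' with h'' | h''
      · rw [hr] at h''; exact absurd hx h''.not_up
      · rw [hr] at h''; exact absurd h'' hx.not_hor
    · exact ⟨x', h', hr ▸ hx, hnh, hs'⟩

/-- Every vertex strictly between the root and the last slice has an upward dart: this property
spreads along the slice, and the next slice is not empty. -/
theorem exists_up {d : D} (h1 : 1 ≤ M.height d) (hN : M.height d < N) :
    ∃ x, M.source x = M.source d ∧ M.Up x := by
  set i := M.height d with hi
  have hS := (hM.slices i h1 hN.le).1
  have hS' := (hM.slices (i + 1) (by omega) hN).1
  obtain ⟨⟨v, hv⟩⟩ := hS'.nonempty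
  obtain ⟨u, ⟨-, x, rfl, rfl⟩, hu⟩ := exists_adj_of_dist_succ hM.connected hv
  refine propagate hS (fun v => ∃ x, M.source x = v ∧ M.Up x) ?_ (u := M.source x) hu
    (v := M.source d) hi.symm ⟨x, rfl, Eq.trans hv (congrArg (· + 1) hu).symm⟩
  rintro _ _ hu hv ⟨-, d, rfl, rfl⟩ ⟨x, hxs, hx⟩
  have hd : M.Hor d := Eq.trans hv hu.symm
  have hdi : M.height d = i := hu
  have hxi : M.height x = i := (height_eq_of_source hxs).trans hdi
  obtain ⟨z, hz, hzup, hznh, hzs⟩ := hM.exists_hor_before_up hx (by omega)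
  have hb : M.Hor (M.nextHor x) := hM.hor_nextHor (by omega)
  have hzb : z = M.nextHor (M.nextHor x) := by rw [← hznh, hM.nextHor_nextHor hz]
  rcases hM.hor_cases hb hd (by rw [source_nextHor, hxs]) with h | h
  · obtain ⟨x', hx', hrx'⟩ :=
      exists_rot_eq_nextHor (fun y hy => hM.up_rot hy) (hM.exists_hor (by omega)) hx
    rw [← hrx'] at h
    have h2 := hM.bot_triangle hx' (h ▸ hd)
    rw [← h] at h2
    exact ⟨_, M.source_rot _, h2.2.1⟩
  · rw [← hzb] at h
    subst h
    have h2 := hM.facePerm_cube (d := M.flip d) (Or.inr (by rw [M.flip_flip]; omega))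
    have e1 : M.facePerm (M.flip d) = M.rot d := by rw [facePerm_apply, M.flip_flip]
    rw [e1] at h2
    refine ⟨M.flip (M.facePerm (M.rot d)), ?_, ?_⟩
    · rw [← source_facePerm, h2]
    · rw [Up, M.flip_flip, ← height_facePerm (M.facePerm (M.rot d)), h2, height_facePerm,
        hzup, height_rot]
      unfold Hor at hd
      rw [hd]

/-- Between the last slice and the external face there is nothing: around every vertex of the last
slice the two horizontal darts are consecutive. -/
theorem exists_hor_rot_hor {d : D} (hd : M.height d = N) :
    ∃ z, M.source z = M.source d ∧ M.Hor z ∧ M.Hor (M.rot z) := by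
  have hN1 : 1 ≤ N := by
    by_contra h
    have h1 := hM.height_le M.root
    have h2 := hM.height_le (M.flip M.root)
    exact hM.no_root_loop M.root rfl (hM.height_eq_zero.1 (by omega))
  obtain ⟨f₀, h1, -⟩ := hM.triangles
  obtain ⟨d₀, rfl⟩ := M.face_surjective f₀
  have hS := (hM.slices N hN1 le_rfl).1
  have key : ∀ z, M.face (M.flip z) = M.face d₀ → M.Hor z ∧ M.Hor (M.rot z) := by
    intro z hz
    have e : M.facePerm (M.flip z) = M.rot z := by rw [facePerm_apply, M.flip_flip]
    have a1 : M.height (M.flip z) = N := h1 _ hz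
    have hz' : M.face (M.rot z) = M.face d₀ := by rw [← e, face_facePerm]; exact hz
    have a2 : M.height (M.rot z) = N := h1 _ hz'
    have a3 : M.height (M.facePerm (M.rot z)) = N := h1 _ (by rw [face_facePerm]; exact hz')
    rw [height_facePerm] at a3
    refine ⟨?_, ?_⟩
    · rw [Hor, a1, ← height_rot z, a2]
    · rw [Hor, a3, a2]
  have hd₀ : M.height (M.flip d₀) = N := by
    rw [← height_facePerm]; exact h1 _ (M.face_facePerm d₀)
  suffices h : ∃ z, M.source z = M.source d ∧ M.face (M.flip z) = M.face d₀ by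
    obtain ⟨z, hz, hz'⟩ := h
    exact ⟨z, hz, key z hz'⟩
  refine propagate hS (fun v => ∃ z, M.source z = v ∧ M.face (M.flip z) = M.face d₀) ?_
    (u := M.source (M.flip d₀)) hd₀ (v := M.source d) hd ⟨_, rfl, by rw [M.flip_flip]⟩
  rintro _ _ hu hv ⟨-, d, rfl, rfl⟩ ⟨z, hzs, hz⟩
  have hdh : M.Hor d := Eq.trans hv hu.symm
  obtain ⟨k1, k2⟩ := key z hz
  rcases hM.hor_cases k1 hdh hzs.symm with h | h
  · subst h
    refine ⟨M.flip (M.facePerm.symm (M.flip d)), ?_, ?_⟩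
    · rw [← source_facePerm, Equiv.apply_symm_apply]
    · rw [M.flip_flip, ← face_facePerm, Equiv.apply_symm_apply, hz]
  · rw [nextHor_of_hor k2] at h
    refine ⟨M.flip d, rfl, ?_⟩
    rw [M.flip_flip, h, ← hz, ← M.face_facePerm (M.flip z), facePerm_apply, M.flip_flip]

end IsCausal

end RootedMap

namespace RootedMap

variable {D : Type} (M : RootedMap D)

/-! ### The code of a causal triangulation -/

/-- The marked upward dart of strip `i`: the root for the first strip, and then the first upward
dart found when turning around the end of the previous one. -/
noncomputable def mark : ℕ → D
  | 0 => M.root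
  | i + 1 => M.rot (M.nextHor (M.flip (mark i)))

/-- The `k`-th upward dart of strip `i`. -/
noncomputable def upDart (i k : ℕ) : D := M.nextUp^[k] (M.mark i)

/-- The marked horizontal dart of slice `i + 1`; it points at the mark of that slice. -/
noncomputable def start (i : ℕ) : D := M.nextHor (M.nextHor (M.flip (M.mark i)))

open Classical in
/-- The words of the strips. -/
noncomputable def stripWord (N i : ℕ) : StripWord :=
  if i < N then
    ⟨Function.minimalPeriod M.nextUp (M.mark i), fun k => decide (M.Up (M.rot (M.upDart i k)))⟩
  else ⟨0, fun _ => false⟩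

variable {M}

theorem upDart_succ (i k : ℕ) : M.upDart i (k + 1) = M.nextUp (M.upDart i k) :=
  Function.iterate_succ_apply' _ _ _

theorem stripWord_len {N i : ℕ} (hi : i < N) :
    (M.stripWord N i).1 = Function.minimalPeriod M.nextUp (M.mark i) := by
  rw [stripWord, if_pos hi]

theorem stripWord_bit {N i k : ℕ} (hi : i < N) (hk : k < (M.stripWord N i).1) :
    (M.stripWord N i).bit k = true ↔ M.Up (M.rot (M.upDart i k)) := by
  have h : M.stripWord N i = ⟨Function.minimalPeriod M.nextUp (M.mark i),
      fun k => @decide (M.Up (M.rot (M.upDart i k))) (Classical.propDecidable _)⟩ := by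
    rw [stripWord, if_pos hi]
  rw [h] at hk ⊢
  rw [StripWord.bit_mk _ hk]
  simp

theorem upDart_len {N i : ℕ} (hi : i < N) : M.upDart i (M.stripWord N i).1 = M.mark i := by
  rw [stripWord_len hi]
  exact Function.iterate_minimalPeriod

theorem upDart_injOn {N i k k' : ℕ} (hi : i < N) (hk : k < (M.stripWord N i).1)
    (hk' : k' < (M.stripWord N i).1) (h : M.upDart i k = M.upDart i k') : k = k' := by
  rw [stripWord_len hi] at hk hk'
  exact (Function.iterate_eq_iterate_iff_of_lt_minimalPeriod hk hk').1 h

theorem nextUp_of_up {d : D} (h : M.Up (M.rot d)) : M.nextUp d = M.rot d := if_pos h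

theorem nextUp_of_not_up {d : D} (h : ¬ M.Up (M.rot d)) :
    M.nextUp d = M.rot (M.flip (M.rot d)) := if_neg h

namespace IsCausal

variable {N l : ℕ} (hM : M.IsCausal N l)

include hM

theorem N_pos : 0 < N := by
  by_contra h
  have h1 := hM.height_le M.root
  have h2 := hM.height_le (M.flip M.root)
  exact hM.no_root_loop M.root rfl (hM.height_eq_zero.1 (by omega))

variable [Finite D]

/-- Around a vertex of a slice the downward and the upward darts are separated by the two horizontal
darts, so the first dart after the horizontal one that ends the downward ones goes up. -/
theorem mark_up {i : ℕ} (hi : i < N) : M.Up (M.mark i) ∧ M.height (M.mark i) = i := by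
  induction i with
  | zero =>
    have h1 : M.height (M.mark 0) = 0 := hM.height_eq_zero.2 rfl
    refine ⟨?_, h1⟩
    have h2 : M.height (M.flip (M.mark 0)) ≠ 0 := fun h =>
      hM.no_root_loop _ (hM.height_eq_zero.1 h1) (hM.height_eq_zero.1 h)
    have h3 := hM.height_flip_le (M.mark 0)
    unfold Up
    omega
  | succ i ih =>
    obtain ⟨ih1, ih2⟩ := ih (by omega)
    have hd : M.Dn (M.flip (M.mark i)) := ih1.flip
    have hh : M.height (M.flip (M.mark i)) = i + 1 := by unfold Up at ih1; omega
    set y := M.nextHor (M.flip (M.mark i)) with hy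
    have hyh : M.height y = i + 1 := by rw [hy, height_nextHor, hh]
    refine ⟨?_, by rw [mark, height_rot, ← hy, hyh]⟩
    rw [mark, ← hy]
    have hyhor : M.Hor y := hM.hor_nextHor (by omega)
    obtain ⟨x, hxs, hx⟩ := hM.exists_up (d := y) (by omega) (by omega)
    have hxh : M.height x = i + 1 := (height_eq_of_source hxs).trans hyh
    obtain ⟨z, hz, hzup, hznh, hzs⟩ := hM.exists_hor_before_up hx (by omega)
    obtain ⟨x', hx', hrx'⟩ :=
      exists_rot_eq_nextHor (fun y hy => hM.up_rot hy) (hM.exists_hor (by omega)) hx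
    obtain ⟨y', hy', hry'⟩ :=
      exists_rot_eq_nextHor (fun y hy => hM.dn_rot hy) (hM.exists_hor (by omega)) hd
    have hne : M.nextHor x ≠ y := by
      intro h
      rw [← hrx', hy, ← hry'] at h
      rw [M.rot.injective h] at hx'
      exact hy'.not_up hx'
    have hnx := (hM.hor_cases hyhor (hM.hor_nextHor (d := x) (by omega))
      ((source_nextHor x).trans hxs)).resolve_left hne
    have hzy : z = y := by
      rw [← hM.nextHor_nextHor hz, hznh, hnx, hM.nextHor_nextHor hyhor]
    rwa [hzy] at hzup

theorem upDart_up {i : ℕ} (hi : i < N) (k : ℕ) :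
    M.Up (M.upDart i k) ∧ M.height (M.upDart i k) = i := by
  induction k with
  | zero => exact hM.mark_up hi
  | succ k ih =>
    rw [upDart_succ]
    have h := hM.nextUp_up ih.1
    exact ⟨h.1, h.2.trans ih.2⟩

theorem stripWord_len_pos {i : ℕ} (hi : i < N) : 0 < (M.stripWord N i).1 := by
  rw [stripWord_len hi]
  exact Function.minimalPeriod_pos_of_mem_periodicPts (hM.mem_periodicPts_nextUp (hM.mark_up hi).1)

theorem height_flip_upDart {i : ℕ} (hi : i < N) (k : ℕ) :
    M.height (M.flip (M.upDart i k)) = i + 1 := by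
  have h := hM.upDart_up hi k
  unfold Up at h
  omega

theorem nextHor_mark {i : ℕ} (hi : i + 1 < N) : M.nextHor (M.mark (i + 1)) = M.start i := by
  have h1 := hM.height_flip_upDart (i := i) (by omega) 0
  change M.height (M.flip (M.mark i)) = i + 1 at h1
  rw [start, hM.nextHor_eq (d := M.nextHor (M.flip (M.mark i))) (by rw [height_nextHor]; omega)]
  · rfl
  · exact (hM.mark_up hi).1.not_hor

/-- A letter `true`: the triangle between two upward darts has its horizontal edge above. -/
theorem rot_upDart_top {i k : ℕ} (hi : i < N) (h : M.Up (M.rot (M.upDart i k))) :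
    M.rot (M.upDart i k) = M.upDart i (k + 1) ∧
    M.rot (M.flip (M.rot (M.flip (M.upDart i (k + 1))))) = M.flip (M.upDart i k) ∧
      M.Hor (M.rot (M.flip (M.upDart i (k + 1)))) := by
  have e : M.rot (M.upDart i k) = M.upDart i (k + 1) := by rw [upDart_succ, nextUp_of_up h]
  have := hM.top_triangle (hM.upDart_up hi k).1 h
  rw [e] at this
  exact ⟨e, this⟩

/-- A letter `false`: the triangle between two upward darts has its horizontal edge below. -/
theorem rot_upDart_bot {i k : ℕ} (hi : i < N) (h : ¬ M.Up (M.rot (M.upDart i k))) :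
    M.Hor (M.rot (M.upDart i k)) ∧
    M.rot (M.flip (M.rot (M.upDart i k))) = M.upDart i (k + 1) ∧
    M.rot (M.flip (M.upDart i (k + 1))) = M.flip (M.upDart i k) := by
  have hu := (hM.upDart_up hi k).1
  have hh := (hM.up_rot hu).resolve_left h
  have e : M.rot (M.flip (M.rot (M.upDart i k))) = M.upDart i (k + 1) := by
    rw [upDart_succ, nextUp_of_not_up h]
  have := (hM.bot_triangle hu hh).1
  rw [e] at this
  exact ⟨hh, e, this⟩

/-- Reading the strip below a slice runs around the slice. -/
theorem nextHor_flip_upDart {i k : ℕ} (hi : i < N) (hk : k ≤ (M.stripWord N i).1) :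
    M.nextHor (M.nextHor (M.flip (M.upDart i k))) =
      M.around^[(M.stripWord N i).cnt true k] (M.start i) := by
  induction k with
  | zero => rw [StripWord.cnt_zero]; rfl
  | succ k ih =>
    have ih := ih (by omega)
    have hh := hM.height_flip_upDart hi (k + 1)
    have hh' := hM.height_flip_upDart hi k
    by_cases h : M.Up (M.rot (M.upDart i k))
    · rw [StripWord.cnt_succ_eq _ _ ((stripWord_bit hi hk).2 h), Function.iterate_succ_apply', ← ih]
      obtain ⟨-, h2, h3⟩ := hM.rot_upDart_top hi h
      rw [nextHor_of_hor h3, around]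
      have h4 : M.nextHor (M.flip (M.rot (M.flip (M.upDart i (k + 1))))) =
          M.nextHor (M.flip (M.upDart i k)) := by
        rw [hM.nextHor_eq, h2]
        · have := h3.flip
          have := hM.one_le_of_hor this
          omega
        · rw [h2]; exact (hM.upDart_up hi k).1.flip.not_hor
      rw [← h4, hM.nextHor_nextHor h3.flip, M.flip_flip]
    · rw [StripWord.cnt_succ_ne _ _ (fun h' => h ((stripWord_bit hi hk).1 h')), ← ih]
      obtain ⟨-, -, h3⟩ := hM.rot_upDart_bot hi h
      rw [hM.nextHor_eq (d := M.flip (M.upDart i (k + 1))) (by omega), h3]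
      rw [h3]; exact (hM.upDart_up hi k).1.flip.not_hor

theorem top_eq {i k : ℕ} (hi : i < N) (hk : k < (M.stripWord N i).1)
    (h : M.Up (M.rot (M.upDart i k))) :
    M.flip (M.rot (M.flip (M.upDart i (k + 1)))) =
      M.around^[(M.stripWord N i).cnt true k] (M.start i) := by
  rw [← hM.nextHor_flip_upDart hi hk.le]
  obtain ⟨-, h2, h3⟩ := hM.rot_upDart_top hi h
  rw [← hM.nextHor_nextHor h3.flip, hM.nextHor_eq (hM.one_le_of_hor h3.flip), h2]
  rw [h2]; exact (hM.upDart_up hi k).1.flip.not_hor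

/-- Reading the strip above a slice runs around the slice. -/
theorem nextHor_upDart {i k : ℕ} (hi : i + 1 < N) (hk : k ≤ (M.stripWord N (i + 1)).1) :
    M.nextHor (M.upDart (i + 1) k) =
      M.around^[(M.stripWord N (i + 1)).cnt false k] (M.start i) := by
  induction k with
  | zero => rw [StripWord.cnt_zero]; exact hM.nextHor_mark hi
  | succ k ih =>
    have ih := ih (by omega)
    have hh := (hM.upDart_up hi (k + 1)).2
    have hh' := (hM.upDart_up hi k).2
    by_cases h : M.Up (M.rot (M.upDart (i + 1) k))
    · have hb := (stripWord_bit hi hk).2 h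
      rw [StripWord.cnt_succ_ne _ _ (by simp [hb]), ← ih]
      obtain ⟨h1, -, -⟩ := hM.rot_upDart_top hi h
      rw [hM.nextHor_eq (d := M.upDart (i + 1) k) (by omega) h.not_hor, h1]
    · have hb : (M.stripWord N (i + 1)).bit k = false := by
        simpa using fun h' => h ((stripWord_bit hi hk).1 h')
      rw [StripWord.cnt_succ_eq _ _ hb, Function.iterate_succ_apply', ← ih]
      obtain ⟨h1, h2, -⟩ := hM.rot_upDart_bot hi h
      rw [nextHor_of_hor h1, around, hM.nextHor_eq (hM.one_le_of_hor h1.flip), h2]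
      rw [h2]; exact (hM.upDart_up hi _).1.not_hor

theorem bot_eq {i k : ℕ} (hi : i + 1 < N) (hk : k < (M.stripWord N (i + 1)).1)
    (h : ¬ M.Up (M.rot (M.upDart (i + 1) k))) :
    M.rot (M.upDart (i + 1) k) =
      M.around^[(M.stripWord N (i + 1)).cnt false k] (M.start i) := by
  rw [← hM.nextHor_upDart hi hk.le, nextHor_of_hor (hM.rot_upDart_bot hi h).1]

/-- Every strip has a triangle with its horizontal edge above. -/
theorem exists_top {i : ℕ} (hi : i < N) : ∃ k < (M.stripWord N i).1,
    M.Up (M.rot (M.upDart i k)) := by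
  by_contra hno
  push Not at hno
  have hlen := hM.stripWord_len_pos hi
  -- with only `false` letters, the target of the strip would have no horizontal darts
  have key : ∀ k, k < (M.stripWord N i).1 → ∃ k' < (M.stripWord N i).1,
      M.rot (M.flip (M.upDart i k)) = M.flip (M.upDart i k') := by
    intro k hk
    cases k with
    | zero =>
      refine ⟨(M.stripWord N i).1 - 1, by omega, ?_⟩
      have := (hM.rot_upDart_bot hi (hno ((M.stripWord N i).1 - 1) (by omega))).2.2
      rw [Nat.sub_add_cancel hlen] at this
      rw [← this, upDart_len hi]
      rfl
    | succ k => exact ⟨k, by omega, (hM.rot_upDart_bot hi (hno k (by omega))).2.2⟩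
  have hh := hM.height_flip_upDart hi 0
  obtain ⟨z, ⟨k, hk, rfl⟩, hz⟩ := exists_rot_eq_nextHor (M := M) (d := M.flip (M.upDart i 0))
    (Q := fun x => ∃ k < (M.stripWord N i).1, x = M.flip (M.upDart i k))
    (fun x hx => by
      obtain ⟨k, hk, rfl⟩ := hx
      exact Or.inl (key k hk)) (hM.exists_hor (by omega)) ⟨0, hlen, rfl⟩
  obtain ⟨k', -, hk'⟩ := key k hk
  have h1 : M.Hor (M.nextHor (M.flip (M.upDart i 0))) := hM.hor_nextHor (by omega)
  rw [← hz, hk'] at h1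
  exact (hM.upDart_up hi k').1.flip.not_hor h1

theorem cnt_true_pos {i : ℕ} (hi : i < N) :
    0 < (M.stripWord N i).cnt true (M.stripWord N i).1 := by
  obtain ⟨k, hk, h⟩ := hM.exists_top hi
  exact (Nat.zero_le _).trans_lt (StripWord.cnt_lt _ true hk ((stripWord_bit hi hk).2 h))

theorem around_iterate_top {i : ℕ} (hi : i < N) :
    M.around^[(M.stripWord N i).cnt true (M.stripWord N i).1] (M.start i) = M.start i := by
  rw [← hM.nextHor_flip_upDart hi le_rfl, upDart_len hi]
  rfl

/-- The number of edges of a slice is the number of letters `true` of the strip below it. -/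
theorem minimalPeriod_top {i : ℕ} (hi : i < N) :
    Function.minimalPeriod M.around (M.start i) =
      (M.stripWord N i).cnt true (M.stripWord N i).1 := by
  refine minimalPeriod_eq (hM.cnt_true_pos hi) (hM.around_iterate_top hi) fun j h0 hj h => ?_
  obtain ⟨k, hk, hb, hc⟩ := (M.stripWord N i).exists_of_lt_cnt true hj
  obtain ⟨k₀, hk₀, hb₀, hc₀⟩ := (M.stripWord N i).exists_of_lt_cnt true (hM.cnt_true_pos hi)
  have h1 := (stripWord_bit hi hk).1 hb
  have h2 := (stripWord_bit hi hk₀).1 hb₀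
  have e1 := hM.top_eq hi hk h1
  have e2 := hM.top_eq hi hk₀ h2
  rw [hc, h] at e1
  rw [hc₀, Function.iterate_zero_apply] at e2
  have e3 := congrArg M.rot (e1.trans e2.symm)
  rw [(hM.rot_upDart_top hi h1).2.1, (hM.rot_upDart_top hi h2).2.1] at e3
  have := upDart_injOn hi hk hk₀ (M.flip.injective e3)
  subst this
  omega

/-- The mark is the first upward dart of its vertex, so the last triangle of the strip has its base
on the lower slice. -/
theorem last_not_up {i : ℕ} (hi : i + 1 < N) :
    ¬ M.Up (M.rot (M.upDart (i + 1) ((M.stripWord N (i + 1)).1 - 1))) := by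
  intro h
  have h1 := (hM.rot_upDart_top hi h).1
  rw [Nat.sub_add_cancel (hM.stripWord_len_pos hi), upDart_len hi, mark] at h1
  have h2 := M.rot.injective h1
  have h3 : M.Hor (M.nextHor (M.flip (M.mark i))) := by
    refine hM.hor_nextHor ?_
    have := hM.height_flip_upDart (i := i) (by omega) 0
    change M.height (M.flip (M.mark i)) = i + 1 at this
    omega
  rw [← h2] at h3
  exact (hM.upDart_up hi _).1.not_hor h3

/-- The number of edges of a slice is the number of letters `false` of the strip above it. -/
theorem minimalPeriod_bot {i : ℕ} (hi : i + 1 < N) :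
    Function.minimalPeriod M.around (M.start i) =
      (M.stripWord N (i + 1)).cnt false (M.stripWord N (i + 1)).1 := by
  have hlen := hM.stripWord_len_pos hi
  have hbit : ∀ {k}, k < (M.stripWord N (i + 1)).1 →
      ((M.stripWord N (i + 1)).bit k = false ↔ ¬ M.Up (M.rot (M.upDart (i + 1) k))) := by
    intro k hk
    rw [← stripWord_bit hi hk]; simp
  have hpos : 0 < (M.stripWord N (i + 1)).cnt false (M.stripWord N (i + 1)).1 :=
    (Nat.zero_le _).trans_lt (StripWord.cnt_lt _ false (Nat.sub_lt hlen Nat.one_pos)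
      ((hbit (Nat.sub_lt hlen Nat.one_pos)).2 (hM.last_not_up hi)))
  refine minimalPeriod_eq hpos ?_ fun j h0 hj h => ?_
  · rw [← hM.nextHor_upDart hi le_rfl, upDart_len hi, hM.nextHor_mark hi]
  obtain ⟨k, hk, hb, hc⟩ := (M.stripWord N (i + 1)).exists_of_lt_cnt false hj
  obtain ⟨k₀, hk₀, hb₀, hc₀⟩ := (M.stripWord N (i + 1)).exists_of_lt_cnt false hpos
  have e1 := hM.bot_eq hi hk ((hbit hk).1 hb)
  have e2 := hM.bot_eq hi hk₀ ((hbit hk₀).1 hb₀)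
  rw [hc, h] at e1
  rw [hc₀, Function.iterate_zero_apply] at e2
  have := upDart_injOn hi hk hk₀ (M.rot.injective (e1.trans e2.symm))
  subst this
  omega

/-- The words of a causal triangulation form a code. The two counts of the edges of a slice agree,
since both are the period of the walk around the slice. -/
theorem isCode : IsCode N ((M.stripWord N (N - 1)).cnt true (M.stripWord N (N - 1)).1)
    (M.stripWord N) where
  pos := hM.N_pos
  empty i hi := by rw [stripWord, if_neg (by omega)]
  first k hk := by
    rw [stripWord_bit hM.N_pos hk]
    have h := hM.upDart_up hM.N_pos k
    refine (hM.up_rot h.1).resolve_right fun h' => ?_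
    have := hM.one_le_of_hor h'
    rw [height_rot] at this
    omega
  glue i hi := by rw [← hM.minimalPeriod_bot hi, hM.minimalPeriod_top (by omega)]
  last_bit i h0 hi := by
    obtain ⟨n, rfl⟩ := Nat.exists_eq_succ_of_ne_zero h0.ne'
    have := hM.last_not_up hi
    rw [← stripWord_bit hi (Nat.sub_lt (hM.stripWord_len_pos hi) Nat.one_pos)] at this
    simpa using this
  top_pos i hi := hM.cnt_true_pos hi
  boundary := rfl

/-! ### Reconstruction of a causal triangulation from its code -/

/-- The code of a causal triangulation; the number of vertices of the last slice is read off from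
the last word. -/
noncomputable def code : Code N ((M.stripWord N (N - 1)).cnt true (M.stripWord N (N - 1)).1) :=
  ⟨M.stripWord N, hM.isCode⟩

open Classical in
/-- The darts of the map of the code are darts of the triangulation. -/
noncomputable def fromCode : hM.code.Dart → D
  | .up p => M.upDart p.lvl p.idx
  | .dn p => M.flip (M.upDart p.lvl p.idx)
  | .base p => if p.bit = true then M.rot (M.flip (M.upDart p.lvl (p.idx + 1)))
      else M.rot (M.upDart p.lvl p.idx)
  | .ext j => M.around^[j] (M.start (N - 1))

theorem bit_iff (p : hM.code.Tri) : p.bit = true ↔ M.Up (M.rot (M.upDart p.lvl p.idx)) :=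
  stripWord_bit p.lvl_lt p.idx_lt

theorem fromCode_base_top {p : hM.code.Tri} (h : p.bit = true) :
    hM.fromCode (.base p) = M.rot (M.flip (M.upDart p.lvl (p.idx + 1))) := if_pos h

theorem fromCode_base_bot {p : hM.code.Tri} (h : p.bit = false) :
    hM.fromCode (.base p) = M.rot (M.upDart p.lvl p.idx) := if_neg (by simp [h])

theorem flip_fromCode_base_top {p : hM.code.Tri} (h : p.bit = true) :
    M.flip (hM.fromCode (.base p)) = M.around^[p.rank true] (M.start p.lvl) := by
  rw [fromCode_base_top hM h]
  exact hM.top_eq p.lvl_lt p.idx_lt ((hM.bit_iff p).1 h)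

theorem upDart_next (p : hM.code.Tri) :
    M.upDart p.next.lvl p.next.idx = M.upDart p.lvl (p.idx + 1) := by
  by_cases h : p.idx + 1 = hM.code.len p.lvl
  · have h1 : p.next.idx = 0 := if_pos h
    rw [h1, h]
    exact (upDart_len p.lvl_lt).symm
  · have h1 : p.next.idx = p.idx + 1 := if_neg h
    rw [h1]
    rfl

theorem fromCode_botTri {i j : ℕ} (hi : i + 1 < N) (hj : j < hM.code.size (i + 1)) :
    hM.fromCode (.base (hM.code.botTri (i + 1) j (Nat.succ_pos _) hi hj)) =
      M.around^[j] (M.start i) := by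
  have hb := Code.bit_botTri (c := hM.code) (Nat.succ_pos _) hi hj
  have hr := Code.rank_botTri (c := hM.code) (Nat.succ_pos _) hi hj
  have h := hM.bot_eq (i := i) (k := (hM.code.botTri (i + 1) j (Nat.succ_pos _) hi hj).idx) hi
    (Code.Tri.idx_lt _) (fun h => by
      have := (hM.bit_iff (hM.code.botTri (i + 1) j (Nat.succ_pos _) hi hj)).2 h
      rw [hb] at this; cases this)
  rw [fromCode_base_bot hM hb]
  refine h.trans ?_
  exact congrArg (fun n => M.around^[n] (M.start i)) hr

theorem fromCode_flip_base_top {p : hM.code.Tri} (h : p.bit = true) :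
    hM.fromCode (hM.code.flipFun (.base p)) = M.flip (hM.fromCode (.base p)) := by
  rw [flip_fromCode_base_top hM h]
  by_cases hN : p.lvl + 1 < N
  · rw [Code.flipFun_top h hN, fromCode_botTri]
  · rw [Code.flipFun_top_last h hN]
    have : N - 1 = p.lvl := by have := p.lvl_lt; omega
    exact congrArg (fun i => M.around^[p.rank true] (M.start i)) this

theorem fromCode_flip (d : hM.code.Dart) :
    hM.fromCode (hM.code.flipFun d) = M.flip (hM.fromCode d) := by
  cases d with
  | up p => rfl
  | dn p => exact (M.flip_flip _).symm
  | base p =>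
    cases h : p.bit
    · have h1 := hM.fromCode_flip_base_top (Code.bit_topTri (c := hM.code) (i := p.lvl - 1)
        (j := p.rank false) ((Nat.sub_le _ _).trans_lt p.lvl_lt)
        ((p.succ_pred_lvl h).symm ▸ p.rank_false_lt h))
      rw [← Code.flipFun_bot h, Code.flipFun_flipFun] at h1
      rw [h1, M.flip_flip]
    · exact hM.fromCode_flip_base_top h
  | ext j =>
    have h1 := hM.fromCode_flip_base_top (Code.bit_topTri (c := hM.code) (i := N - 1) (j := j)
        hM.code.last_lt (hM.code.lt_size_last j))
    rw [show Code.Dart.base (hM.code.topTri (N - 1) j hM.code.last_lt (hM.code.lt_size_last j)) =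
      hM.code.flipFun (.ext j) from rfl, Code.flipFun_flipFun] at h1
    rw [h1, M.flip_flip]

/-- The boundary of the external face runs around the last slice. -/
theorem facePerm_ext (j : ℕ) (hj : j < hM.code.size (N - 1 + 1)) :
    M.facePerm (M.around^[j] (M.start (N - 1))) = M.around^[j + 1] (M.start (N - 1)) := by
  have hN : N - 1 < N := hM.code.last_lt
  obtain ⟨k, hk, hb, hc⟩ := (M.stripWord N (N - 1)).exists_of_lt_cnt true hj
  have h1 := (stripWord_bit hN hk).1 hb
  have e1 := hM.top_eq hN hk h1
  rw [hc] at e1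
  rw [Function.iterate_succ_apply', ← e1, facePerm_apply, around, M.flip_flip]
  obtain ⟨-, h2, h3⟩ := hM.rot_upDart_top hN h1
  set x := M.rot (M.flip (M.upDart (N - 1) (k + 1))) with hx
  have hd := (hM.upDart_up hN (k + 1)).1.flip
  have hh := hM.height_flip_upDart hN (k + 1)
  have hxh : M.height x = N := by
    rw [hx, height_rot, hh]; have := hM.N_pos; omega
  obtain ⟨z, hzs, hz, hz'⟩ := hM.exists_hor_rot_hor hxh
  -- `x` comes after a downward dart, so it is the first one of the two horizontal darts
  have hzx : x = z := by
    rcases hM.hor_cases hz h3 hzs.symm with h | h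
    · exact h
    · rw [nextHor_of_hor hz', hx] at h
      rw [← M.rot.injective h] at hz
      exact absurd hz hd.not_hor
  rw [hzx, nextHor_of_hor hz']

theorem fromCode_face (d : hM.code.Dart) :
    hM.fromCode (Code.Dart.faceFun d) = M.facePerm (hM.fromCode d) := by
  have hup : ∀ p : hM.code.Tri, hM.fromCode (.up p.next) = M.upDart p.lvl (p.idx + 1) :=
    fun p => hM.upDart_next p
  cases d with
  | up q =>
    obtain ⟨p, rfl⟩ : ∃ p : hM.code.Tri, q = p.next := ⟨q.prev, q.next_prev.symm⟩
    rw [Code.Dart.faceFun, Code.Tri.prev_next, hup]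
    cases h : p.bit
    · rw [if_neg (by simp)]
      exact (hM.rot_upDart_bot p.lvl_lt (fun h' => by
        rw [← hM.bit_iff, h] at h'; cases h')).2.2.symm
    · rw [if_pos rfl, fromCode_base_top hM h]
      rfl
  | dn p =>
    rw [Code.Dart.faceFun]
    have e : M.facePerm (hM.fromCode (.dn p)) = M.rot (M.upDart p.lvl p.idx) := by
      rw [facePerm_apply, fromCode, M.flip_flip]
    rw [e]
    cases h : p.bit
    · rw [if_neg (by simp), fromCode_base_bot hM h]
    · rw [if_pos rfl, hup]
      exact (hM.rot_upDart_top p.lvl_lt ((hM.bit_iff p).1 h)).1.symm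
  | base p =>
    rw [Code.Dart.faceFun]
    cases h : p.bit
    · rw [if_neg (by simp), hup, fromCode_base_bot hM h]
      exact (hM.rot_upDart_bot p.lvl_lt (fun h' => by
        rw [← hM.bit_iff, h] at h'; cases h')).2.1.symm
    · rw [if_pos rfl, fromCode_base_top hM h]
      exact (hM.rot_upDart_top p.lvl_lt ((hM.bit_iff p).1 h)).2.1.symm
  | ext j =>
    show M.around^[(finRotate _ j : ℕ)] (M.start (N - 1)) =
      M.facePerm (M.around^[j] (M.start (N - 1)))
    rw [hM.facePerm_ext j (hM.code.lt_size_last j), Code.finRotate_val,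
      ← Function.iterate_mod_minimalPeriod_eq (n := (j : ℕ) + 1)]
    exact congrArg (fun n => M.around^[((j : ℕ) + 1) % n] (M.start (N - 1)))
      (hM.minimalPeriod_top hM.code.last_lt).symm

theorem fromCode_rot (d : hM.code.Dart) :
    hM.fromCode (hM.code.map.rot d) = M.rot (hM.fromCode d) := by
  rw [Code.map_rot, fromCode_face, fromCode_flip, facePerm_apply, M.flip_flip]

/-- The image of the map of the code is closed under the rotation and the reversal, and the
triangulation is connected. -/
theorem fromCode_surjective : Function.Surjective hM.fromCode := by
  have hc := (dartConnected_of_connected M hM.connected).eq (fun d => d ∈ Set.range hM.fromCode)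
    (fun d => ?_) (fun d => ?_)
  · intro d
    have h : M.root ∈ Set.range hM.fromCode := ⟨hM.code.map.root, rfl⟩
    have := hc d M.root
    rw [eq_iff_iff] at this
    exact this.2 h
  · rw [eq_iff_iff]
    constructor
    · rintro ⟨y, hy⟩
      refine ⟨hM.code.map.rot.symm y, M.rot.injective ?_⟩
      rw [← fromCode_rot, Equiv.apply_symm_apply, hy]
    · rintro ⟨y, rfl⟩
      exact ⟨_, hM.fromCode_rot y⟩
  · rw [eq_iff_iff]
    constructor
    · rintro ⟨y, hy⟩
      exact ⟨hM.code.flipFun y, by rw [fromCode_flip, hy, M.flip_flip]⟩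
    · rintro ⟨y, rfl⟩
      exact ⟨_, hM.fromCode_flip y⟩

theorem hor_fromCode_base (p : hM.code.Tri) : M.Hor (hM.fromCode (.base p)) := by
  cases h : p.bit
  · rw [fromCode_base_bot hM h]
    exact (hM.rot_upDart_bot p.lvl_lt (fun h' => by rw [← hM.bit_iff, h] at h'; cases h')).1
  · rw [fromCode_base_top hM h]
    exact (hM.rot_upDart_top p.lvl_lt ((hM.bit_iff p).1 h)).2.2

theorem hor_fromCode_ext (j) : M.Hor (hM.fromCode (.ext j)) := by
  have h := hM.fromCode_flip (.ext j)
  have h1 := hM.hor_fromCode_base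
    (hM.code.topTri (N - 1) j hM.code.last_lt (hM.code.lt_size_last j))
  rw [Code.flipFun] at h
  rw [h] at h1
  have := h1.flip
  rwa [M.flip_flip] at this

theorem up_inj {p q : hM.code.Tri} (h : hM.fromCode (.up p) = hM.fromCode (.up q)) : p = q := by
  have h1 := (hM.upDart_up p.lvl_lt p.idx).2
  have h2 := (hM.upDart_up q.lvl_lt q.idx).2
  have h' : M.upDart p.lvl p.idx = M.upDart q.lvl q.idx := h
  have h3 : p.lvl = q.lvl := by rw [← h1, ← h2, h']
  rw [h3] at h'
  refine Code.Tri.ext' h3 (upDart_injOn q.lvl_lt (h3 ▸ p.idx_lt) q.idx_lt h')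

theorem dn_inj {p q : hM.code.Tri} (h : hM.fromCode (.dn p) = hM.fromCode (.dn q)) : p = q :=
  hM.up_inj (M.flip.injective h)

theorem fromCode_up_ne_dn (p q : hM.code.Tri) : hM.fromCode (.up p) ≠ hM.fromCode (.dn q) := by
  intro h
  have h1 : M.Dn (hM.fromCode (.dn q)) := (hM.upDart_up q.lvl_lt q.idx).1.flip
  rw [← h] at h1
  exact h1.not_up (hM.upDart_up p.lvl_lt p.idx).1

theorem base_inj {p q : hM.code.Tri} (h : hM.fromCode (.base p) = hM.fromCode (.base q)) :
    p = q := by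
  have h' := congrArg M.facePerm h
  rw [← fromCode_face, ← fromCode_face, Code.Dart.faceFun, Code.Dart.faceFun] at h'
  split_ifs at h' with h1 h2 h2
  · exact hM.dn_inj h'
  · exact (hM.fromCode_up_ne_dn _ _ h'.symm).elim
  · exact (hM.fromCode_up_ne_dn _ _ h').elim
  · have := congrArg Code.Tri.prev (hM.up_inj h')
    rwa [Code.Tri.prev_next, Code.Tri.prev_next] at this

theorem not_hor_up (p : hM.code.Tri) : ¬ M.Hor (hM.fromCode (.up p)) :=
  (hM.upDart_up p.lvl_lt p.idx).1.not_hor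

theorem not_hor_dn (p : hM.code.Tri) : ¬ M.Hor (hM.fromCode (.dn p)) :=
  (hM.upDart_up p.lvl_lt p.idx).1.flip.not_hor

theorem fromCode_base_ne_ext (p : hM.code.Tri) (j) :
    hM.fromCode (.base p) ≠ hM.fromCode (.ext j) := by
  intro h
  have h' := congrArg M.facePerm h
  rw [← fromCode_face, ← fromCode_face, Code.Dart.faceFun] at h'
  have h1 : M.Hor (hM.fromCode (Code.Dart.faceFun (.ext j))) := hM.hor_fromCode_ext _
  rw [← h'] at h1
  split_ifs at h1
  · exact hM.not_hor_dn _ h1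
  · exact hM.not_hor_up _ h1

theorem ext_inj {j j'} (h : hM.fromCode (.ext j) = hM.fromCode (.ext j')) : j = j' := by
  have h' := congrArg M.flip h
  rw [← fromCode_flip, ← fromCode_flip, Code.flipFun, Code.flipFun] at h'
  have h1 := congrArg (Code.Tri.rank · true) (hM.base_inj h')
  simp only [Code.rank_topTri] at h1
  exact Fin.ext h1

theorem fromCode_injective : Function.Injective hM.fromCode := by
  intro d d' h
  cases d with
  | up p =>
    cases d' with
    | up q => rw [hM.up_inj h]
    | dn q => exact (hM.fromCode_up_ne_dn _ _ h).elim
    | base q => exact (hM.not_hor_up p (h ▸ hM.hor_fromCode_base q)).elim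
    | ext j => exact (hM.not_hor_up p (h ▸ hM.hor_fromCode_ext j)).elim
  | dn p =>
    cases d' with
    | up q => exact (hM.fromCode_up_ne_dn _ _ h.symm).elim
    | dn q => rw [hM.dn_inj h]
    | base q => exact (hM.not_hor_dn p (h ▸ hM.hor_fromCode_base q)).elim
    | ext j => exact (hM.not_hor_dn p (h ▸ hM.hor_fromCode_ext j)).elim
  | base p =>
    cases d' with
    | up q => exact (hM.not_hor_up q (h ▸ hM.hor_fromCode_base p)).elim
    | dn q => exact (hM.not_hor_dn q (h ▸ hM.hor_fromCode_base p)).elim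
    | base q => rw [hM.base_inj h]
    | ext j => exact (hM.fromCode_base_ne_ext _ _ h).elim
  | ext j =>
    cases d' with
    | up q => exact (hM.not_hor_up q (h ▸ hM.hor_fromCode_ext j)).elim
    | dn q => exact (hM.not_hor_dn q (h ▸ hM.hor_fromCode_ext j)).elim
    | base q => exact (hM.fromCode_base_ne_ext _ _ h.symm).elim
    | ext j' => rw [hM.ext_inj h]

theorem code_map_iso : hM.code.map.Iso M :=
  ⟨Equiv.ofBijective _ ⟨hM.fromCode_injective, hM.fromCode_surjective⟩, hM.fromCode_rot,
    hM.fromCode_flip, rfl⟩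

/-- Every causal triangulation is the map of a code. -/
theorem exists_code : ∃ c : Code N l, c.map.Iso M := by
  have h1 := (hM.code.isCausal.of_iso hM.code_map_iso).boundary
  rw [hM.boundary] at h1
  subst h1
  exact ⟨hM.code, hM.code_map_iso⟩

end IsCausal

end RootedMap

namespace Code

open Dart

variable {N l : ℕ}

/-! ### Different codes give different triangulations -/

theorem rot_up_top {c : Code N l} {p : c.Tri} (h : p.bit = true) :
    c.map.rot (up p) = up p.next := by
  rw [map_rot, flipFun, faceFun, h, if_pos rfl]

theorem rot_up_bot {c : Code N l} {p : c.Tri} (h : p.bit = false) :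
    c.map.rot (up p) = base p := by
  rw [map_rot, flipFun, faceFun, h, if_neg (by simp)]

theorem bit_iff_label {c : Code N l} (p : c.Tri) :
    p.bit = true ↔ (c.label (c.flipFun (c.map.rot (up p)))).1 ≠ (c.label (c.map.rot (up p))).1 := by
  cases h : p.bit
  · rw [rot_up_bot h, label_flip_base]; simp
  · rw [rot_up_top h]
    simp [flipFun, label]

theorem faceFun_base_bot {c : Code N l} {p : c.Tri} (h : p.bit = false) :
    c.map.facePerm (c.map.rot (up p)) = up p.next := by
  rw [rot_up_bot h, map_facePerm, faceFun, h, if_neg (by simp)]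

/-- Passing from one strip to the next one through the last edge of the slice between them. -/
theorem up_firstTri_succ (c : Code N l) {i : ℕ} (hi : i + 1 < N)
    (hj : c.size (i + 1) - 1 < c.size (i + 1)) :
    c.map.rot (c.map.rot (dn (c.topTri i (c.size (i + 1) - 1) (by omega) hj).next)) =
      up (c.firstTri (i + 1) hi) := by
  have h1 : c.map.rot (dn (c.topTri i (c.size (i + 1) - 1) (by omega) hj).next) =
      base (c.topTri i (c.size (i + 1) - 1) (by omega) hj) := by
    rw [map_rot, flipFun, faceFun, Tri.prev_next, bit_topTri, if_pos rfl]
  have hlen := c.len_pos hi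
  set q : c.Tri := Tri.mk (i + 1) (c.len (i + 1) - 1) hi (by omega) with hq
  have hb : q.bit = false := c.2.last_bit (i + 1) (Nat.succ_pos i) hi
  have hr : q.rank false = c.size (i + 1) - 1 := by
    have h2 := Tri.cnt_succ_true false hb
    have h3 : q.idx + 1 = c.len (i + 1) := by
      show c.len (i + 1) - 1 + 1 = _
      omega
    rw [h3] at h2
    have h4 := c.cnt_false_len (Nat.succ_pos i) hi
    rw [show c.cnt q.lvl false (c.len (i + 1)) = c.size (i + 1) from h4] at h2
    omega
  have h2 : c.flipFun (base q) = base (c.topTri i (c.size (i + 1) - 1) (by omega) hj) := by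
    rw [flipFun_bot hb]
    congr 1
    refine Tri.ext' rfl ?_
    show c.pos i true (q.rank false) = c.pos i true _
    rw [hr]
  rw [h1, ← h2, map_rot, flipFun_flipFun, faceFun, hb, if_neg (by simp)]
  congr 1
  refine Tri.ext' rfl ?_
  have : q.idx + 1 = c.len q.lvl := by
    show c.len (i + 1) - 1 + 1 = _
    exact Nat.sub_add_cancel hlen
  exact if_pos this

section

variable {c c' : Code N l} (e : c.Dart ≃ c'.Dart) (hr : ∀ d, e (c.map.rot d) = c'.map.rot (e d))
  (hf : ∀ d, e (c.map.flip d) = c'.map.flip (e d)) (hroot : e c.map.root = c'.map.root)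

include hr hf hroot

theorem label_iso (d : c.Dart) : (c'.label (e d)).1 = (c.label d).1 := by
  have := RootedMap.height_iso c.connected e hr hf hroot d
  rw [← dist_source, ← dist_source]
  exact this

theorem bit_iso {p : c.Tri} {p' : c'.Tri} (h : e (up p) = up p') : p.bit = p'.bit := by
  rw [Bool.eq_iff_iff, bit_iff_label, bit_iff_label, ← h, ← hr]
  have h1 : c'.flipFun (e (c.map.rot (up p))) = e (c.flipFun (c.map.rot (up p))) := (hf _).symm
  rw [h1, label_iso e hr hf hroot, label_iso e hr hf hroot]

theorem up_next_iso {p : c.Tri} {p' : c'.Tri} (h : e (up p) = up p') :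
    e (up p.next) = up p'.next := by
  have hb := bit_iso e hr hf hroot h
  cases h' : p.bit
  · rw [← faceFun_base_bot h', RootedMap.iso_facePerm e hr hf, hr, h,
      faceFun_base_bot (hb ▸ h')]
  · rw [← rot_up_top h', hr, h, rot_up_top (hb ▸ h')]

theorem up_iso {i : ℕ} (hi : i < N) (h0 : e (up (c.firstTri i hi)) = up (c'.firstTri i hi)) {k : ℕ}
    (hk : k < c.len i) :
    ∃ hk' : k < c'.len i, e (up (Tri.mk i k hi hk)) = up (Tri.mk i k hi hk') := by
  induction k with
  | zero => exact ⟨c'.len_pos hi, h0⟩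
  | succ k ih =>
    obtain ⟨hk', h⟩ := ih (by omega)
    have h1 := up_next_iso e hr hf hroot h
    have h2 : (Tri.mk i k hi (by omega) : c.Tri).next = Tri.mk i (k + 1) hi hk :=
      Tri.ext' rfl (if_neg (show ¬ k + 1 = c.len i by omega))
    rw [h2] at h1
    by_cases hlast : k + 1 = c'.len i
    · have h3 : (Tri.mk i k hi hk' : c'.Tri).next = c'.firstTri i hi :=
        Tri.ext' rfl (if_pos hlast)
      rw [h3, ← h0] at h1
      have h4 := congrArg Tri.idx (Dart.up.inj (e.injective h1))
      exact absurd h4 (Nat.succ_ne_zero k)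
    · refine ⟨by omega, ?_⟩
      rw [h1]
      congr 1
      exact Tri.ext' rfl (if_neg hlast)

/-- An isomorphism that respects the first triangle of a strip respects its letters. -/
theorem word_eq_of_iso {i : ℕ} (hi : i < N)
    (h0 : e (up (c.firstTri i hi)) = up (c'.firstTri i hi)) : c.1 i = c'.1 i := by
  have hr' : ∀ d, e.symm (c'.map.rot d) = c.map.rot (e.symm d) := fun d => by
    rw [Equiv.symm_apply_eq, hr, Equiv.apply_symm_apply]
  have hf' : ∀ d, e.symm (c'.map.flip d) = c.map.flip (e.symm d) := fun d => by
    rw [Equiv.symm_apply_eq, hf, Equiv.apply_symm_apply]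
  have hroot' : e.symm c'.map.root = c.map.root := by rw [Equiv.symm_apply_eq, hroot]
  have h0' : e.symm (up (c'.firstTri i hi)) = up (c.firstTri i hi) := by
    rw [Equiv.symm_apply_eq, h0]
  have hle : c.len i ≤ c'.len i := by
    obtain ⟨h, -⟩ := up_iso e hr hf hroot hi h0 (Nat.sub_lt (c.len_pos hi) Nat.one_pos)
    omega
  have hge : c'.len i ≤ c.len i := by
    obtain ⟨h, -⟩ := up_iso e.symm hr' hf' hroot' hi h0' (Nat.sub_lt (c'.len_pos hi) Nat.one_pos)
    omega
  refine StripWord.ext_bit (le_antisymm hle hge) fun k hk => ?_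
  obtain ⟨hk', h⟩ := up_iso e hr hf hroot hi h0 hk
  exact bit_iso e hr hf hroot h

/-- The first triangles of all strips are determined by the root, hence respected by an
isomorphism. -/
theorem up_firstTri_iso (i : ℕ) (hi : i < N) :
    e (up (c.firstTri i hi)) = up (c'.firstTri i hi) := by
  induction i with
  | zero => exact hroot
  | succ i ih =>
    have h0 := ih (by omega)
    have hw := word_eq_of_iso e hr hf hroot (by omega) h0
    have hs : c.size (i + 1) = c'.size (i + 1) := by
      rw [size_succ, size_succ, cnt, cnt, len, len, hw]
    have hpos := c.size_pos (i := i + 1) hi.le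
    rw [← c.up_firstTri_succ hi (by omega), ← c'.up_firstTri_succ hi (by omega), hr, hr]
    congr 2
    have hflip : ∀ {q : c.Tri} {q' : c'.Tri}, e (up q) = up q' → e (dn q) = dn q' := by
      intro q q' h
      have := hf (up q)
      rwa [h] at this
    apply hflip
    apply up_next_iso e hr hf hroot
    obtain ⟨hk', h⟩ := up_iso e hr hf hroot (by omega : i < N) h0
      (c.pos_true (i := i) (j := c.size (i + 1) - 1) (by omega)).1
    refine Eq.trans h ?_
    congr 1
    refine Tri.ext' rfl ?_
    show (c.1 i).pos true (c.size (i + 1) - 1) = (c'.1 i).pos true (c'.size (i + 1) - 1)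
    rw [hw, hs]

end

theorem eq_of_iso {c c' : Code N l} (h : c.map.Iso c'.map) : c = c' := by
  obtain ⟨e, hr, hf, hroot⟩ := h
  refine Subtype.ext (funext fun i => ?_)
  by_cases hi : i < N
  · exact word_eq_of_iso e hr hf hroot hi (up_firstTri_iso e hr hf hroot i hi)
  · rw [c.2.empty i (by omega), c'.2.empty i (by omega)]

end Code

/-! ### Triangulations and codes -/

namespace RootedMap

variable {D : Type} (M : RootedMap D)

/-- Transport of a rooted map along a bijection of the darts. -/
def relabel {D' : Type} (e : D ≃ D') : RootedMap D' where
  rot := (e.symm.trans M.rot).trans e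
  flip := (e.symm.trans M.flip).trans e
  root := e M.root
  flip_flip d := by simp [M.flip_flip]
  flip_ne d h := M.flip_ne (e.symm d) (by
    rw [Equiv.eq_symm_apply]; exact h)

theorem iso_relabel {D' : Type} (e : D ≃ D') : M.Iso (M.relabel e) :=
  ⟨e, fun d => by simp [relabel], fun d => by simp [relabel], rfl⟩

end RootedMap

variable {N l : ℕ}

/-- The labelled triangulation of a code. -/
noncomputable def Code.toLabelled (c : Code N l) : LabelledTriangulation N l :=
  ⟨⟨Fintype.card c.Dart, c.map.relabel (Fintype.equivFin c.Dart)⟩,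
    c.isCausal.of_iso (c.map.iso_relabel _)⟩

/-- The triangulation of a code. -/
noncomputable def Code.toTriangulation (c : Code N l) : Triangulation N l :=
  Quotient.mk _ c.toLabelled

theorem Code.map_iso_labelled (c : Code N l) : c.map.Iso c.toLabelled.1.2 := c.map.iso_relabel _

theorem Code.map_iso_toMap (c : Code N l) : c.map.Iso c.toTriangulation.toMap := by
  have h : c.toTriangulation.toMap.Iso c.toLabelled.1.2 :=
    Quotient.exact (Quotient.out_eq c.toTriangulation)
  exact c.map_iso_labelled.trans h.symm

theorem Triangulation.isCausal (T : Triangulation N l) : T.toMap.IsCausal N l :=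
  (Quotient.out T).2

theorem Code.toTriangulation_bijective :
    Function.Bijective (Code.toTriangulation : Code N l → Triangulation N l) := by
  constructor
  · intro c c' h
    have h1 : c.toLabelled.1.2.Iso c'.toLabelled.1.2 := Quotient.exact h
    exact Code.eq_of_iso ((c.map_iso_labelled.trans h1).trans c'.map_iso_labelled.symm)
  · intro T
    obtain ⟨c, hc⟩ := T.isCausal.exists_code
    refine ⟨c, ?_⟩
    rw [← Quotient.out_eq T]
    exact Quotient.sound (c.map_iso_labelled.symm.trans hc)

theorem dualPartitionFunction_eq (β μ : ℝ) :
    dualPartitionFunction N l β μ = ∑' c : Code N l, c.map.dualWeight β μ := by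
  rw [dualPartitionFunction, ← (Equiv.ofBijective _ Code.toTriangulation_bijective).tsum_eq]
  exact tsum_congr fun c => (RootedMap.dualWeight_iso c.map_iso_toMap β μ).symm

/-- The number of darts: three for each triangle, and `l` for the external face. -/
theorem RootedMap.IsCausal.card_darts {D : Type} [Fintype D] {M : RootedMap D}
    (hM : M.IsCausal N l) : Fintype.card D = 3 * M.triangleCount + l := by
  obtain ⟨c, e, hr, hf, -⟩ := hM.exists_code
  rw [← Fintype.card_congr e, Code.Dart.card_eq, ← c.triangleCount_map, RootedMap.triangleCount,
    RootedMap.triangleCount, Nat.card_congr (RootedMap.faceEquiv e hr hf)]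

/-! ### Weights of a single map and the Kramers–Wannier duality -/

namespace RootedMap

variable {D : Type} [Fintype D] (M : RootedMap D)

theorem weight_eq (β μ : ℝ) : M.weight β μ =
    ENNReal.ofReal (Real.exp (-μ * M.triangleCount) * ∑ s, Real.exp (-β * M.energy s)) := by
  rw [weight, tsum_fintype, ← ENNReal.ofReal_sum_of_nonneg fun _ _ => (Real.exp_pos _).le,
    Finset.mul_sum]
  congr 1
  refine Finset.sum_congr rfl fun s _ => ?_
  rw [← Real.exp_add]
  ring_nf

theorem dualWeight_eq (β μ : ℝ) : M.dualWeight β μ =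
    ENNReal.ofReal (Real.exp (-μ * M.triangleCount) * ∑ s, Real.exp (-β * M.dualEnergy s)) := by
  rw [dualWeight, tsum_fintype, ← ENNReal.ofReal_sum_of_nonneg fun _ _ => (Real.exp_pos _).le,
    Finset.mul_sum]
  congr 1
  refine Finset.sum_congr rfl fun s _ => ?_
  rw [← Real.exp_add]
  ring_nf

theorem card_face_eq : Fintype.card M.Face = M.triangleCount + 1 := by
  rw [triangleCount, Nat.card_eq_fintype_card]
  have : 0 < Fintype.card M.Face := Fintype.card_pos
  omega

theorem IsCausal.two_mul_card_edge {N l : ℕ} {M : RootedMap D} (hM : M.IsCausal N l) :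
    2 * Fintype.card M.Edge = 3 * M.triangleCount + l := by
  rw [← M.card_darts, hM.card_darts]

theorem IsCausal.cast_card_edge {N l : ℕ} {M : RootedMap D} (hM : M.IsCausal N l) :
    (Fintype.card M.Edge : ℝ) = 3 / 2 * M.triangleCount + l / 2 := by
  have : (2 * Fintype.card M.Edge : ℝ) = 3 * M.triangleCount + l := by
    exact_mod_cast hM.two_mul_card_edge
  linarith

end RootedMap

/-- The duality relation between two inverse temperatures, in the form in which it enters the
weight of an edge. -/
theorem cosh_of_tanh_eq {β βs : ℝ} (hβ : 0 < β) (h : Real.tanh βs = Real.exp (-2 * β)) :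
    Real.cosh βs =
      Real.exp (β - (Real.log 2 + Real.log (Real.sinh (2 * β))) / 2) := by
  have hs : 0 < Real.sinh (2 * β) := Real.sinh_pos_iff.2 (by linarith)
  have hc := Real.cosh_pos βs
  have h1 : Real.cosh βs ^ 2 * (1 - Real.exp (-2 * β) ^ 2) = 1 := by
    rw [← h, Real.tanh_eq_sinh_div_cosh]
    field_simp
    linarith [Real.cosh_sq βs]
  have h2 : 1 - Real.exp (-2 * β) ^ 2 = Real.exp (-2 * β) * (2 * Real.sinh (2 * β)) := by
    rw [Real.sinh_eq, show -(2 * β) = -2 * β by ring]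
    have : Real.exp (2 * β) * Real.exp (-2 * β) = 1 := by
      rw [← Real.exp_add]; simp
    linear_combination -this
  have h3 : Real.cosh βs ^ 2 =
      (Real.exp (β - (Real.log 2 + Real.log (Real.sinh (2 * β))) / 2)) ^ 2 := by
    rw [h2] at h1
    have h4 : (Real.exp (β - (Real.log 2 + Real.log (Real.sinh (2 * β))) / 2)) ^ 2 *
        (Real.exp (-2 * β) * (2 * Real.sinh (2 * β))) = 1 := by
      rw [← Real.exp_nat_mul]
      have : 2 * Real.sinh (2 * β) = Real.exp (Real.log 2 + Real.log (Real.sinh (2 * β))) := by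
        rw [Real.exp_add, Real.exp_log two_pos, Real.exp_log hs]
      rw [this, ← Real.exp_add, ← Real.exp_add, Real.exp_eq_one_iff]
      push_cast
      ring
    have h5 : Real.exp (-2 * β) * (2 * Real.sinh (2 * β)) ≠ 0 := by positivity
    exact mul_right_cancel₀ h5 (h1.trans h4.symm)
  exact (pow_left_inj₀ hc.le (Real.exp_pos _).le two_ne_zero).1 h3

/-- Kramers–Wannier duality for a single triangulation: the high-temperature expansion of the spins
on the faces and the low-temperature expansion of the spins on the vertices run over the same
sets of edges. -/
theorem RootedMap.IsCausal.dualWeight_dual {D : Type} [Fintype D] {M : RootedMap D} {N l : ℕ}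
    (hM : M.IsCausal N l) {β βs : ℝ} (hβ : 0 < β) (h : Real.tanh βs = Real.exp (-2 * β)) (μ : ℝ) :
    M.dualWeight βs (μ + 1 / 4 * Real.log 2 - 3 / 4 * Real.log (Real.sinh (2 * β))) =
      ENNReal.ofReal ((2 * Real.sinh (2 * β)) ^ (-(l : ℝ) / 4)) * M.weight β μ := by
  have hs : 0 < Real.sinh (2 * β) := Real.sinh_pos_iff.2 (by linarith)
  rw [M.dualWeight_eq, M.weight_eq, ← ENNReal.ofReal_mul (by positivity), M.sum_exp_dualEnergy,
    M.sum_exp_energy β (M.dartConnected_of_connected hM.connected) hM.planar, h,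
    cosh_of_tanh_eq hβ h, ← Real.exp_nat_mul, M.card_face_eq, pow_succ,
    Real.rpow_def_of_pos (by positivity),
    Real.log_mul two_ne_zero hs.ne', hM.cast_card_edge]
  have h2 : (2 : ℝ) ^ M.triangleCount = Real.exp (M.triangleCount * Real.log 2) := by
    rw [Real.exp_nat_mul, Real.exp_log two_pos]
  rw [h2]
  congr 1
  generalize ∑ A ∈ M.dualEvenSets, Real.exp (-2 * β) ^ A.card = S
  -- both prefactors are exponentials, up to the common factor `2`
  have h3 : ∀ a b c d e f : ℝ, a + b + c = d + e + f →
      Real.exp a * (Real.exp b * (Real.exp c * 2 * S)) =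
        Real.exp d * (Real.exp e * (2 * (Real.exp f * S))) := by
    intro a b c d e f hh
    have := congrArg Real.exp hh
    simp only [Real.exp_add] at this
    linear_combination 2 * S * this
  apply h3
  ring

theorem tanh_le_tanh {x y : ℝ} (h : x ≤ y) : Real.tanh x ≤ Real.tanh y := by
  rw [Real.tanh_eq_sinh_div_cosh, Real.tanh_eq_sinh_div_cosh,
    div_le_div_iff₀ (Real.cosh_pos x) (Real.cosh_pos y)]
  have := Real.sinh_nonneg_iff.2 (sub_nonneg.2 h)
  rw [Real.sinh_sub] at this
  linarith

theorem tanh_nonneg {x : ℝ} (h : 0 ≤ x) : 0 ≤ Real.tanh x := Real.tanh_zero ▸ tanh_le_tanh h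

section Bounds

variable {D : Type} [Fintype D] {M : RootedMap D} {N l : ℕ}

open RootedMap

/-- All spins equal: the ground state. -/
theorem RootedMap.dualEnergy_one : M.dualEnergy 1 = -Fintype.card M.Edge := by
  rw [← neg_eq_iff_eq_neg, M.neg_dualEnergy]
  simp

/-- The high-temperature expansion has nonnegative coefficients, and `cosh` and `tanh` increase. -/
theorem RootedMap.dualWeight_mono (μ : ℝ) : MonotoneOn (fun β => M.dualWeight β μ) (Set.Ici 0) := by
  intro β hβ β' hβ' h
  rw [Set.mem_Ici] at hβ hβ'
  simp only [M.dualWeight_eq, M.sum_exp_dualEnergy]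
  refine ENNReal.ofReal_le_ofReal ?_
  have h1 : Real.cosh β ≤ Real.cosh β' := by
    rw [Real.cosh_le_cosh, abs_of_nonneg hβ, abs_of_nonneg hβ']; exact h
  have h2 : Real.tanh β ≤ Real.tanh β' := tanh_le_tanh h
  have h3 := tanh_nonneg hβ
  have h4 := Real.cosh_pos β
  gcongr

/-- The term of the empty set in the high-temperature expansion. -/
theorem RootedMap.IsCausal.le_dualWeight_cosh (hM : M.IsCausal N l) {β : ℝ} (hβ : 0 ≤ β) (μ : ℝ) :
    ENNReal.ofReal (Real.exp ((Real.log 2 + 3 / 2 * Real.log (Real.cosh β) - μ) *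
      M.triangleCount)) ≤ M.dualWeight β μ := by
  have ht := tanh_nonneg hβ
  rw [M.dualWeight_eq, M.sum_exp_dualEnergy]
  refine ENNReal.ofReal_le_ofReal ?_
  have h1 : 1 ≤ ∑ A ∈ M.dualEvenSets, Real.tanh β ^ A.card := by
    have := Finset.single_le_sum (f := fun A : Finset M.Edge => Real.tanh β ^ A.card)
      (fun A _ => pow_nonneg ht _) (empty_mem_evenSets _ _ : ∅ ∈ M.dualEvenSets)
    simpa using this
  have hc : Real.cosh β ^ Fintype.card M.Edge =
      Real.exp ((3 / 2 * M.triangleCount + l / 2) * Real.log (Real.cosh β)) := by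
    rw [← hM.cast_card_edge, Real.exp_nat_mul, Real.exp_log (Real.cosh_pos β)]
  have h2 : (2 : ℝ) ^ Fintype.card M.Face = Real.exp ((M.triangleCount + 1) * Real.log 2) := by
    have := Real.exp_nat_mul (Real.log 2) (M.triangleCount + 1)
    rw [Real.exp_log two_pos] at this
    rw [M.card_face_eq, ← this]; push_cast; rfl
  have hl : 0 ≤ Real.log (Real.cosh β) := Real.log_nonneg (Real.one_le_cosh β)
  have hl2 : 0 ≤ Real.log 2 := Real.log_nonneg one_le_two
  calc Real.exp ((Real.log 2 + 3 / 2 * Real.log (Real.cosh β) - μ) * M.triangleCount)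
      ≤ Real.exp (-μ * M.triangleCount + ((3 / 2 * M.triangleCount + l / 2) *
          Real.log (Real.cosh β) + (M.triangleCount + 1) * Real.log 2)) := by
        apply Real.exp_le_exp.2
        nlinarith [mul_nonneg (Nat.cast_nonneg (α := ℝ) l) hl]
    _ = Real.exp (-μ * M.triangleCount) * (Real.cosh β ^ Fintype.card M.Edge *
          (2 ^ Fintype.card M.Face * 1)) := by
        rw [hc, h2, mul_one, Real.exp_add, Real.exp_add]
    _ ≤ _ := by
        have := Real.cosh_pos β
        gcongr

/-- The contribution of the ground state. -/
theorem RootedMap.IsCausal.le_dualWeight_ground (hM : M.IsCausal N l) {β : ℝ} (hβ : 0 ≤ β) (μ : ℝ) :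
    ENNReal.ofReal (Real.exp ((3 / 2 * β - μ) * M.triangleCount)) ≤ M.dualWeight β μ := by
  rw [M.dualWeight_eq]
  refine ENNReal.ofReal_le_ofReal ?_
  have h1 := Finset.single_le_sum (f := fun s => Real.exp (-β * M.dualEnergy s))
      (fun s _ => (Real.exp_pos _).le) (Finset.mem_univ (1 : M.Face → ℤˣ))
  refine le_trans ?_ (mul_le_mul_of_nonneg_left h1 (Real.exp_pos _).le)
  rw [M.dualEnergy_one, ← Real.exp_add, hM.cast_card_edge]
  apply Real.exp_le_exp.2
  nlinarith [mul_nonneg hβ (Nat.cast_nonneg (α := ℝ) l)]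

end Bounds

/-! ### Upper bound: independent strips -/

namespace Code

open Dart

variable {N l : ℕ} (c : Code N l)

/-- The sum of the interactions of spins on the triangles and on the external face, over the
darts; every edge is counted twice. -/
noncomputable def interaction (s : Option c.Tri → ℤˣ) : ℝ :=
  ∑ d : c.Dart, (((s (c.faceLabel d) * s (c.faceLabel (c.flipFun d)) : ℤˣ) : ℤ) : ℝ)

theorem sum_exp_dualEnergy (β : ℝ) : ∑ s, Real.exp (-β * c.map.dualEnergy s) =
    ∑ s, Real.exp (β / 2 * c.interaction s) := by
  rw [← (c.faceEquiv.arrowCongr (Equiv.refl ℤˣ)).sum_comp]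
  refine Finset.sum_congr rfl fun s _ => ?_
  have h : ∀ d, (c.faceEquiv.arrowCongr (Equiv.refl ℤˣ)) s (c.map.face d) = s (c.faceLabel d) := by
    intro d
    rw [← c.faceEquiv_faceLabel d]
    simp [Equiv.arrowCongr]
  congr 1
  rw [RootedMap.dualEnergy, interaction]
  simp only [h, map_flip, Units.val_mul, Int.cast_mul]
  ring

theorem spin_le_one (u : ℤˣ) : ((u : ℤ) : ℝ) ≤ 1 := by
  rcases Int.units_eq_one_or u with rfl | rfl <;> norm_num

theorem neg_one_le_spin (u : ℤˣ) : -1 ≤ ((u : ℤ) : ℝ) := by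
  rcases Int.units_eq_one_or u with rfl | rfl <;> norm_num

/-- Only the interactions along the strips are kept, those across the slices are bounded
trivially. -/
theorem interaction_le (s : Option c.Tri → ℤˣ) : c.interaction s ≤
    2 * (∑ p : c.Tri, (((s (some p) * s (some p.prev) : ℤˣ) : ℤ) : ℝ)) +
      (Fintype.card c.Tri + l) := by
  rw [interaction, Dart.sum_eq]
  have h1 : ∑ p : c.Tri, (((s (c.faceLabel (base p)) *
      s (c.faceLabel (c.flipFun (base p))) : ℤˣ) : ℤ) : ℝ) ≤ Fintype.card c.Tri := by
    refine (Finset.sum_le_card_nsmul _ _ 1 fun p _ => spin_le_one _).trans (by simp)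
  have h2 : ∑ j : Fin l, (((s (c.faceLabel (ext j)) *
      s (c.faceLabel (c.flipFun (ext j))) : ℤˣ) : ℤ) : ℝ) ≤ l := by
    refine (Finset.sum_le_card_nsmul _ _ 1 fun p _ => spin_le_one _).trans (by simp)
  have h3 : ∑ p : c.Tri, (((s (c.faceLabel (up p)) *
      s (c.faceLabel (c.flipFun (up p))) : ℤˣ) : ℤ) : ℝ) =
      ∑ p : c.Tri, (((s (some p) * s (some p.prev) : ℤˣ) : ℤ) : ℝ) :=
    Finset.sum_congr rfl fun p _ => by rw [mul_comm (s (some p))]; rfl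
  have h4 : ∑ p : c.Tri, (((s (c.faceLabel (dn p)) *
      s (c.faceLabel (c.flipFun (dn p))) : ℤˣ) : ℤ) : ℝ) =
      ∑ p : c.Tri, (((s (some p) * s (some p.prev) : ℤˣ) : ℤ) : ℝ) := rfl
  rw [h3, h4]
  linarith

/-- The even sets of the disjoint union of the cyclic chains of triangles in the strips. -/
noncomputable abbrev chainEvenSets : Finset (Finset c.Tri) :=
  evenSets (fun p : c.Tri => p) fun p => p.prev

theorem mem_of_mem_chainEvenSets {A : Finset c.Tri} (hA : A ∈ c.chainEvenSets) (p : c.Tri) :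
    p.next ∈ A ↔ p ∈ A := by
  have hA' : IsEvenSet (fun p : c.Tri => p) (fun p => p.prev) A := by simpa [evenSets] using hA
  have h := hA' fun q => if q = p then -1 else 1
  have h1 : ∀ q : c.Tri, q.prev = p ↔ q = p.next := fun q =>
    ⟨fun h => by rw [← h, Tri.next_prev], fun h => by rw [h, Tri.prev_next]⟩
  simp only [h1, Finset.prod_mul_distrib, Finset.prod_ite_eq'] at h
  by_cases h2 : p ∈ A <;> by_cases h3 : p.next ∈ A <;> simp_all

/-- An even set of a cycle is empty or the whole cycle. -/
theorem card_chainEvenSets_le : c.chainEvenSets.card ≤ 2 ^ N := by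
  classical
  have h : ∀ A ∈ c.chainEvenSets, ∀ i (hi : i < N) k (hk : k < c.len i),
      Tri.mk i k hi hk ∈ A ↔ c.firstTri i hi ∈ A := by
    intro A hA i hi k
    induction k with
    | zero => exact fun _ => Iff.rfl
    | succ k ih =>
      intro hk
      have hk' : k < c.len i := by omega
      have : (Tri.mk i k hi hk' : c.Tri).next = Tri.mk i (k + 1) hi hk :=
        Tri.ext' rfl (if_neg hk.ne)
      rw [← ih hk', ← this, c.mem_of_mem_chainEvenSets hA]
  have h2 : Fintype.card (Fin N → Bool) = 2 ^ N := by simp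
  rw [← h2]
  refine Finset.card_le_card_of_injOn (t := Finset.univ)
    (fun A (i : Fin N) => decide (c.firstTri i i.2 ∈ A)) (fun _ _ => Finset.mem_univ _) ?_
  intro A hA B hB hAB
  ext p
  have h3 := h A hA p.lvl p.lvl_lt p.idx p.idx_lt
  have h4 := h B hB p.lvl p.lvl_lt p.idx p.idx_lt
  have h5 : c.firstTri p.lvl p.lvl_lt ∈ A ↔ c.firstTri p.lvl p.lvl_lt ∈ B := by
    have := congrFun hAB ⟨p.lvl, p.lvl_lt⟩
    simpa using this
  exact h3.trans (h5.trans h4.symm)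

/-- The partition function of the independent Ising chains in the strips. -/
theorem sum_exp_chain_le {β : ℝ} (hβ : 0 ≤ β) :
    ∑ s : c.Tri → ℤˣ, Real.exp (β * ∑ p, (((s p * s p.prev : ℤˣ) : ℤ) : ℝ)) ≤
      (2 * Real.cosh β) ^ Fintype.card c.Tri * 2 ^ N := by
  have h := high_temperature (fun p : c.Tri => p) (fun p => p.prev) β
  have h1 : ∑ A ∈ c.chainEvenSets, Real.tanh β ^ A.card ≤ 2 ^ N := by
    refine (Finset.sum_le_card_nsmul _ _ 1 fun A _ =>
      pow_le_one₀ (tanh_nonneg hβ) (Real.tanh_lt_one β).le).trans ?_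
    rw [nsmul_eq_mul, mul_one]
    exact_mod_cast c.card_chainEvenSets_le
  rw [h]
  have := Real.cosh_pos β
  calc _ ≤ Real.cosh β ^ Fintype.card c.Tri * (2 ^ Fintype.card c.Tri * 2 ^ N) := by
        gcongr
    _ = _ := by rw [mul_pow]; ring

theorem sum_exp_dualEnergy_le {β : ℝ} (hβ : 0 ≤ β) :
    ∑ s, Real.exp (-β * c.map.dualEnergy s) ≤
      2 ^ (N + 1) * Real.exp (β / 2 * l) *
        (2 * Real.cosh β * Real.exp (β / 2)) ^ Fintype.card c.Tri := by
  rw [sum_exp_dualEnergy]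
  have h1 : ∀ s : Option c.Tri → ℤˣ, Real.exp (β / 2 * c.interaction s) ≤
      Real.exp (β / 2 * l) * Real.exp (β / 2) ^ Fintype.card c.Tri *
      Real.exp (β * ∑ p : c.Tri, (((s (some p) * s (some p.prev) : ℤˣ) : ℤ) : ℝ)) := by
    intro s
    rw [← Real.exp_nat_mul, ← Real.exp_add, ← Real.exp_add]
    apply Real.exp_le_exp.2
    have := mul_le_mul_of_nonneg_left (c.interaction_le s) (by linarith : 0 ≤ β / 2)
    linarith
  refine (Finset.sum_le_sum fun s _ => h1 s).trans ?_
  rw [← Finset.mul_sum]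
  have h2 : ∑ s : Option c.Tri → ℤˣ,
      Real.exp (β * ∑ p : c.Tri, (((s (some p) * s (some p.prev) : ℤˣ) : ℤ) : ℝ)) =
      2 * ∑ s : c.Tri → ℤˣ, Real.exp (β * ∑ p, (((s p * s p.prev : ℤˣ) : ℤ) : ℝ)) := by
    rw [← (Equiv.piOptionEquivProd (β := fun _ : Option c.Tri => ℤˣ)).symm.sum_comp,
      Fintype.sum_prod_type]
    simp [Equiv.piOptionEquivProd]
  rw [h2, mul_pow]
  calc _ ≤ Real.exp (β / 2 * l) * Real.exp (β / 2) ^ Fintype.card c.Tri *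
        (2 * ((2 * Real.cosh β) ^ Fintype.card c.Tri * 2 ^ N)) := by
        gcongr
        exact c.sum_exp_chain_le hβ
    _ = _ := by ring

/-- Up to a constant, the bound is a product over the letters of the words. -/
theorem dualWeight_le {β : ℝ} (hβ : 0 ≤ β) (μ : ℝ) : c.map.dualWeight β μ ≤
    ENNReal.ofReal (2 ^ (N + 1) * Real.exp (β / 2 * l)) * ∏ i : Fin N,
      ENNReal.ofReal (2 * Real.cosh β * Real.exp (β / 2 - μ)) ^ (c.1 i).1 := by
  have hc := Real.cosh_pos β
  have h1 : ∑ i : Fin N, (c.1 i).1 = Fintype.card c.Tri := by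
    rw [c.card_tri, Finset.sum_range]
    rfl
  rw [Finset.prod_pow_eq_pow_sum, h1, ← ENNReal.ofReal_pow (by positivity),
    ← ENNReal.ofReal_mul (by positivity), RootedMap.dualWeight_eq, c.triangleCount_map]
  refine ENNReal.ofReal_le_ofReal ?_
  calc _ ≤ Real.exp (-μ * Fintype.card c.Tri) * (2 ^ (N + 1) * Real.exp (β / 2 * l) *
        (2 * Real.cosh β * Real.exp (β / 2)) ^ Fintype.card c.Tri) := by
        gcongr
        exact c.sum_exp_dualEnergy_le hβ
    _ = _ := by
        rw [sub_eq_add_neg, Real.exp_add, mul_comm (-μ), Real.exp_nat_mul,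
          ← mul_assoc _ _ (Real.exp (-μ)),
          mul_pow _ (Real.exp (-μ))]
        ring

/-- The words of a code determine it. -/
theorem words_injective :
    Function.Injective (fun (c : Code N l) (i : Fin N) => c.1 i) := by
  intro c c' h
  refine Subtype.ext (funext fun i => ?_)
  by_cases hi : i < N
  · exact congrFun h ⟨i, hi⟩
  · rw [c.2.empty i (not_lt.1 hi), c'.2.empty i (not_lt.1 hi)]

end Code

/-- Sums of products over families factorise. -/
theorem tsum_fin_prod {W : Type*} (g : W → ℝ≥0∞) (n : ℕ) :
    ∑' f : Fin n → W, ∏ i, g (f i) = (∑' w, g w) ^ n := by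
  induction n with
  | zero => simp
  | succ n ih =>
    rw [← (Fin.consEquiv fun _ => W).tsum_eq, ENNReal.tsum_prod', pow_succ',
      ← ENNReal.tsum_mul_right]
    refine tsum_congr fun w => ?_
    rw [← ih, ← ENNReal.tsum_mul_left]
    refine tsum_congr fun f => ?_
    rw [Fin.prod_univ_succ]
    simp [Fin.consEquiv]

/-- There are `2 ^ n` words of length `n`. -/
theorem tsum_stripWord (x : ℝ≥0∞) : ∑' w : StripWord, x ^ w.1 = (1 - 2 * x)⁻¹ := by
  rw [ENNReal.tsum_sigma', ← ENNReal.tsum_geometric]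
  refine tsum_congr fun n => ?_
  simp [mul_pow]

/-- The strips are summed independently; the geometric series of the words converges. -/
theorem dualPartitionFunction_lt_top (N l : ℕ) {β μ : ℝ} (hβ : 0 ≤ β)
    (hμ : 2 * Real.log 2 + 1 / 2 * β + Real.log (Real.cosh β) < μ) :
    dualPartitionFunction N l β μ < ∞ := by
  have hc := Real.cosh_pos β
  set x : ℝ := 2 * Real.cosh β * Real.exp (β / 2 - μ) with hx
  have hx2 : 2 * x < 1 := by
    have : 2 * x = Real.exp (2 * Real.log 2 + 1 / 2 * β + Real.log (Real.cosh β) - μ) := by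
      rw [hx, show 2 * Real.log 2 + 1 / 2 * β + Real.log (Real.cosh β) - μ =
        Real.log 2 + (Real.log 2 + (Real.log (Real.cosh β) + (β / 2 - μ))) by ring,
        Real.exp_add, Real.exp_add, Real.exp_add, Real.exp_log two_pos, Real.exp_log hc]
      ring
    rw [this, Real.exp_lt_one_iff]
    linarith
  rw [dualPartitionFunction_eq]
  calc ∑' c : Code N l, c.map.dualWeight β μ
      ≤ ∑' c : Code N l, ENNReal.ofReal (2 ^ (N + 1) * Real.exp (β / 2 * l)) *
          ∏ i : Fin N, ENNReal.ofReal x ^ (c.1 i).1 :=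
        ENNReal.tsum_le_tsum fun c => c.dualWeight_le hβ μ
    _ = ENNReal.ofReal (2 ^ (N + 1) * Real.exp (β / 2 * l)) *
          ∑' c : Code N l, ∏ i : Fin N, ENNReal.ofReal x ^ (c.1 i).1 := ENNReal.tsum_mul_left
    _ ≤ ENNReal.ofReal (2 ^ (N + 1) * Real.exp (β / 2 * l)) *
          ∑' f : Fin N → StripWord, ∏ i : Fin N, ENNReal.ofReal x ^ (f i).1 := by
        gcongr
        exact ENNReal.tsum_comp_le_tsum_of_injective Code.words_injective
          fun f : Fin N → StripWord => ∏ i : Fin N, ENNReal.ofReal x ^ (f i).1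
    _ < ∞ := by
        rw [tsum_fin_prod fun w : StripWord => ENNReal.ofReal x ^ w.1, tsum_stripWord]
        refine ENNReal.mul_lt_top ENNReal.ofReal_lt_top (ENNReal.pow_lt_top ?_)
        rw [ENNReal.inv_lt_top, tsub_pos_iff_lt, ← ENNReal.ofReal_ofNat 2,
          ← ENNReal.ofReal_mul zero_le_two, ENNReal.ofReal_lt_one]
        exact hx2

/-! ### Adding a strip -/

/-- A word that can be placed on top of a slice with `a` vertices, below one with `b` vertices. -/
structure IsLayer (a b : ℕ) (w : StripWord) : Prop where
  false_eq : w.cnt false w.1 = a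
  true_eq : w.cnt true w.1 = b
  last_bit : w.bit (w.1 - 1) = false

/-- The word of length `n` whose letters `true` stand at the positions in `S`. -/
def StripWord.ofSet (n : ℕ) (S : Finset ℕ) : StripWord := ⟨n, fun k => decide ((k : ℕ) ∈ S)⟩

theorem StripWord.cnt_ofSet {n : ℕ} {S : Finset ℕ} (hS : S ⊆ Finset.range n) :
    (StripWord.ofSet n S).cnt true n = S.card := by
  rw [StripWord.cnt, Nat.count_eq_card_filter_range]
  congr 1
  ext k
  rw [Finset.mem_filter, Finset.mem_range]
  constructor
  · rintro ⟨hk, h⟩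
    rw [StripWord.ofSet, StripWord.bit_mk _ hk] at h
    simpa using h
  · intro h
    have hk := Finset.mem_range.1 (hS h)
    exact ⟨hk, by rw [StripWord.ofSet, StripWord.bit_mk _ hk]; simpa using h⟩

theorem isLayer_ofSet {a b : ℕ} {S : Finset ℕ} (ha : 0 < a) (hS : S ⊆ Finset.range (a + b - 1))
    (hb : S.card = b) : IsLayer a b (StripWord.ofSet (a + b) S) := by
  have h1 := StripWord.cnt_ofSet
    (hS.trans (Finset.range_subset_range.2 (Nat.sub_le (a + b) 1)))
  have h2 : (StripWord.ofSet (a + b) S).cnt true (a + b) +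
      (StripWord.ofSet (a + b) S).cnt false (a + b) = a + b := StripWord.cnt_add _ _
  refine ⟨?_, h1.trans hb, ?_⟩
  · show (StripWord.ofSet (a + b) S).cnt false (a + b) = a
    omega
  · show (StripWord.ofSet (a + b) S).bit (a + b - 1) = false
    rw [StripWord.ofSet, StripWord.bit_mk _ (by omega)]
    simp only [decide_eq_false_iff_not]
    exact fun h => lt_irrefl _ (Finset.mem_range.1 (hS h))

/-- First all the triangles pointing down, then all those pointing up. -/
theorem isLayer_range {a : ℕ} (b : ℕ) (ha : 0 < a) :
    IsLayer a b (StripWord.ofSet (a + b) (Finset.range b)) :=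
  isLayer_ofSet ha (Finset.range_subset_range.2 (by omega)) (Finset.card_range b)

namespace Code

open Dart

variable {N a b : ℕ}

/-- The triangulation with one more strip. -/
def snoc (c : Code N a) {w : StripWord} (hw : IsLayer a b w) (hb : 0 < b) : Code (N + 1) b := by
  refine ⟨Function.update c.1 N w, ?_⟩
  have hN := c.N_pos
  have hlt : ∀ i < N, Function.update c.1 N w i = c.1 i := fun i hi =>
    Function.update_of_ne hi.ne _ _
  have hlast : Function.update c.1 N w N = w := Function.update_self _ _ _
  constructor
  · exact Nat.succ_pos N
  · intro i hi
    rw [Function.update_of_ne (by omega)]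
    exact c.2.empty i (by omega)
  · rw [hlt 0 hN]
    exact c.2.first
  · intro i hi
    rw [hlt i (by omega)]
    rcases Nat.lt_or_ge (i + 1) N with h | h
    · rw [hlt _ h]
      exact c.2.glue i h
    · obtain rfl : i + 1 = N := by omega
      rw [hlast, hw.false_eq]
      exact c.2.boundary.symm
  · intro i h0 hi
    rcases Nat.lt_or_ge i N with h | h
    · rw [hlt _ h]
      exact c.2.last_bit i h0 h
    · obtain rfl : i = N := by omega
      rw [hlast]
      exact hw.last_bit
  · intro i hi
    rcases Nat.lt_or_ge i N with h | h
    · rw [hlt _ h]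
      exact c.2.top_pos i h
    · obtain rfl : i = N := by omega
      rw [hlast, hw.true_eq]
      exact hb
  · rw [Nat.add_sub_cancel, hlast]
    exact hw.true_eq

variable (c : Code N a) {w : StripWord} (hw : IsLayer a b w) (hb : 0 < b)

theorem snoc_word_of_lt {i : ℕ} (hi : i < N) : (c.snoc hw hb).1 i = c.1 i :=
  Function.update_of_ne hi.ne _ _

theorem snoc_word_last : (c.snoc hw hb).1 N = w := Function.update_self _ _ _

theorem snoc_inj {c c' : Code N a} {w w' : StripWord} {hw : IsLayer a b w} {hw' : IsLayer a b w'}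
    {hb : 0 < b} (h : c.snoc hw hb = c'.snoc hw' hb) : c = c' ∧ w = w' := by
  refine ⟨words_injective (funext fun i => ?_), ?_⟩
  · show c.1 i = c'.1 i
    rw [← c.snoc_word_of_lt hw hb i.2, h, snoc_word_of_lt _ _ _ i.2]
  · rw [← c.snoc_word_last hw hb, h, snoc_word_last]

theorem card_tri_snoc : Fintype.card (c.snoc hw hb).Tri = Fintype.card c.Tri + w.1 := by
  rw [card_tri, card_tri, Finset.sum_range_succ]
  congr 1
  · refine Finset.sum_congr rfl fun i hi => ?_
    rw [len, len, snoc_word_of_lt _ _ _ (Finset.mem_range.1 hi)]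
  · rw [len, snoc_word_last]

/-- The inclusion of the triangles. -/
def snocTri (p : c.Tri) : (c.snoc hw hb).Tri :=
  Tri.mk p.lvl p.idx (p.lvl_lt.trans (Nat.lt_succ_self N)) (by
    rw [len, snoc_word_of_lt _ _ _ p.lvl_lt]
    exact p.idx_lt)

theorem snocTri_injective : Function.Injective (c.snocTri hw hb) := fun p q h => by
  have h1 := congrArg Tri.lvl h
  have h2 := congrArg Tri.idx h
  exact Tri.ext' h1 h2

theorem bit_snocTri (p : c.Tri) : (c.snocTri hw hb p).bit = p.bit := by
  show (c.snoc hw hb).bit p.lvl p.idx = c.bit p.lvl p.idx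
  rw [bit, bit, snoc_word_of_lt _ _ _ p.lvl_lt]

theorem rank_snocTri (p : c.Tri) (b' : Bool) : (c.snocTri hw hb p).rank b' = p.rank b' := by
  show (c.snoc hw hb).cnt p.lvl b' p.idx = c.cnt p.lvl b' p.idx
  rw [cnt, cnt, snoc_word_of_lt _ _ _ p.lvl_lt]

theorem prev_snocTri (p : c.Tri) : (c.snocTri hw hb p).prev = c.snocTri hw hb p.prev := by
  refine Tri.ext' rfl ?_
  show (if p.idx = 0 then (c.snoc hw hb).len p.lvl - 1 else p.idx - 1) =
    (if p.idx = 0 then c.len p.lvl - 1 else p.idx - 1)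
  rw [len, len, snoc_word_of_lt _ _ _ p.lvl_lt]

/-- Spins on the larger triangulation: all new triangles get the spin of the old external face. -/
def snocSpin (s : Option c.Tri → ℤˣ) : Option (c.snoc hw hb).Tri → ℤˣ
  | none => s none
  | some q => if h : q.lvl < N then
      s (some (Tri.mk q.lvl q.idx h (by
        have := q.idx_lt
        rwa [len, snoc_word_of_lt _ _ _ h] at this)))
    else s none

theorem snocSpin_tri (s : Option c.Tri → ℤˣ) (p : c.Tri) :
    c.snocSpin hw hb s (some (c.snocTri hw hb p)) = s (some p) := dif_pos p.lvl_lt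

theorem snocSpin_injective : Function.Injective (c.snocSpin hw hb) := by
  intro s s' h
  funext o
  cases o with
  | none => exact congrFun h none
  | some p =>
    have := congrFun h (some (c.snocTri hw hb p))
    rwa [snocSpin_tri, snocSpin_tri] at this

/-- The spins across every old edge are unchanged; the old external face corresponds to the new
strip. -/
theorem snocSpin_flip_base (s : Option c.Tri → ℤˣ) (p : c.Tri) :
    c.snocSpin hw hb s ((c.snoc hw hb).faceLabel
      ((c.snoc hw hb).flipFun (base (c.snocTri hw hb p)))) =
      s (c.faceLabel (c.flipFun (base p))) := by
  cases h : p.bit with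
  | true =>
    have h' : (c.snocTri hw hb p).bit = true := by rw [bit_snocTri, h]
    rw [flipFun_top h' (Nat.succ_lt_succ p.lvl_lt)]
    by_cases hN : p.lvl + 1 < N
    · rw [flipFun_top h hN]
      have h2 := c.bit_botTri (Nat.succ_pos _) hN (p.rank_true_lt h)
      have h3 := c.rank_botTri (Nat.succ_pos _) hN (p.rank_true_lt h)
      set q := c.botTri (p.lvl + 1) (p.rank true) (Nat.succ_pos _) hN (p.rank_true_lt h) with hq
      have h4 : c.snocTri hw hb q = (c.snoc hw hb).botTri (p.lvl + 1)
          ((c.snocTri hw hb p).rank true) (Nat.succ_pos _) (Nat.succ_lt_succ p.lvl_lt)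
          (Tri.rank_true_lt h') :=
        eq_botTri (by rw [bit_snocTri, h2]) rfl (by rw [rank_snocTri, rank_snocTri, h3])
      exact (congrArg (fun x => c.snocSpin hw hb s (some x)) h4.symm).trans
        (c.snocSpin_tri hw hb s q)
    · rw [flipFun_top_last h hN]
      exact dif_neg hN
  | false =>
    have h' : (c.snocTri hw hb p).bit = false := by rw [bit_snocTri, h]
    rw [flipFun_bot h', flipFun_bot h]
    have hi : p.lvl - 1 < N := (Nat.sub_le _ _).trans_lt p.lvl_lt
    have hj : p.rank false < c.size (p.lvl - 1 + 1) := (p.succ_pred_lvl h).symm ▸ p.rank_false_lt h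
    have h2 := c.bit_topTri hi hj
    have h3 := c.rank_topTri hi hj
    set q := c.topTri (p.lvl - 1) (p.rank false) hi hj with hq
    have h4 : c.snocTri hw hb q = (c.snoc hw hb).topTri (p.lvl - 1)
        ((c.snocTri hw hb p).rank false) (hi.trans (Nat.lt_succ_self N))
        ((Tri.succ_pred_lvl h').symm ▸ Tri.rank_false_lt h') :=
      eq_topTri (by rw [bit_snocTri, h2]) rfl (by rw [rank_snocTri, rank_snocTri, h3])
    exact (congrArg (fun x => c.snocSpin hw hb s (some x)) h4.symm).trans
      (c.snocSpin_tri hw hb s q)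

theorem sum_snocTri_le (G : (c.snoc hw hb).Tri → ℝ) (hG : ∀ q, -1 ≤ G q) :
    ∑ p, G (c.snocTri hw hb p) - w.1 ≤ ∑ q, G q := by
  have h1 : ∑ p, (G (c.snocTri hw hb p) + 1) ≤ ∑ q, (G q + 1) := by
    have := Finset.sum_le_univ_sum_of_nonneg (f := fun q => G q + 1)
      (s := Finset.univ.map ⟨_, c.snocTri_injective hw hb⟩) fun q => by linarith [hG q]
    rwa [Finset.sum_map] at this
  simp only [Finset.sum_add_distrib, Finset.sum_const, Finset.card_univ, nsmul_eq_mul, mul_one,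
    card_tri_snoc] at h1
  push_cast at h1
  linarith

theorem interaction_snoc (s : Option c.Tri → ℤˣ) :
    c.interaction s - (3 * w.1 + a + b) ≤ (c.snoc hw hb).interaction (c.snocSpin hw hb s) := by
  rw [interaction, interaction, Dart.sum_eq, Dart.sum_eq]
  have h1 := c.sum_snocTri_le hw hb (fun q => (((c.snocSpin hw hb s
    ((c.snoc hw hb).faceLabel (up q)) * c.snocSpin hw hb s ((c.snoc hw hb).faceLabel
      ((c.snoc hw hb).flipFun (up q))) : ℤˣ) : ℤ) : ℝ)) fun q => neg_one_le_spin _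
  have h2 := c.sum_snocTri_le hw hb (fun q => (((c.snocSpin hw hb s
    ((c.snoc hw hb).faceLabel (dn q)) * c.snocSpin hw hb s ((c.snoc hw hb).faceLabel
      ((c.snoc hw hb).flipFun (dn q))) : ℤˣ) : ℤ) : ℝ)) fun q => neg_one_le_spin _
  have h3 := c.sum_snocTri_le hw hb (fun q => (((c.snocSpin hw hb s
    ((c.snoc hw hb).faceLabel (base q)) * c.snocSpin hw hb s ((c.snoc hw hb).faceLabel
      ((c.snoc hw hb).flipFun (base q))) : ℤˣ) : ℤ) : ℝ)) fun q => neg_one_le_spin _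
  have h4 : ∑ j : Fin a, (((s (c.faceLabel (ext j)) *
      s (c.faceLabel (c.flipFun (ext j))) : ℤˣ) : ℤ) : ℝ) ≤ a :=
    (Finset.sum_le_card_nsmul _ _ 1 fun p _ => spin_le_one _).trans (by simp)
  have h5 : -(b : ℝ) ≤ ∑ j : Fin b, (((c.snocSpin hw hb s ((c.snoc hw hb).faceLabel (ext j)) *
      c.snocSpin hw hb s ((c.snoc hw hb).faceLabel
        ((c.snoc hw hb).flipFun (ext j))) : ℤˣ) : ℤ) : ℝ) :=
    le_trans (by simp) (Finset.card_nsmul_le_sum _ _ (-1) fun p _ => neg_one_le_spin _)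
  have hup : ∀ p : c.Tri, c.snocSpin hw hb s ((c.snoc hw hb).faceLabel
      (up (c.snocTri hw hb p))) = s (c.faceLabel (up p)) := fun p => by
    rw [faceLabel, prev_snocTri]
    exact c.snocSpin_tri hw hb s p.prev
  have hdn : ∀ p : c.Tri, c.snocSpin hw hb s ((c.snoc hw hb).faceLabel
      (dn (c.snocTri hw hb p))) = s (c.faceLabel (dn p)) := c.snocSpin_tri hw hb s
  have hbase : ∀ p : c.Tri, c.snocSpin hw hb s ((c.snoc hw hb).faceLabel
      (base (c.snocTri hw hb p))) = s (c.faceLabel (base p)) := c.snocSpin_tri hw hb s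
  have hup' : ∀ p : c.Tri, c.snocSpin hw hb s ((c.snoc hw hb).faceLabel ((c.snoc hw hb).flipFun
      (up (c.snocTri hw hb p)))) = s (c.faceLabel (c.flipFun (up p))) := hdn
  have hdn' : ∀ p : c.Tri, c.snocSpin hw hb s ((c.snoc hw hb).faceLabel ((c.snoc hw hb).flipFun
      (dn (c.snocTri hw hb p)))) = s (c.faceLabel (c.flipFun (dn p))) := hup
  simp only [hup, hup'] at h1
  simp only [hdn, hdn'] at h2
  simp only [hbase, c.snocSpin_flip_base hw hb s] at h3
  linarith

/-- Adding a strip changes the weight by at most a constant factor, for a fixed number of new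
triangles. -/
theorem dualWeight_snoc {β : ℝ} (hβ : 0 ≤ β) (μ : ℝ) :
    ENNReal.ofReal (Real.exp (-μ * w.1 - β / 2 * (3 * w.1 + a + b))) * c.map.dualWeight β μ ≤
      (c.snoc hw hb).map.dualWeight β μ := by
  rw [RootedMap.dualWeight_eq, RootedMap.dualWeight_eq, sum_exp_dualEnergy, sum_exp_dualEnergy,
    ← ENNReal.ofReal_mul (Real.exp_pos _).le]
  refine ENNReal.ofReal_le_ofReal ?_
  rw [triangleCount_map, triangleCount_map, card_tri_snoc]
  have h1 : Real.exp (-(β / 2 * (3 * w.1 + a + b))) * ∑ s, Real.exp (β / 2 * c.interaction s) ≤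
      ∑ s, Real.exp (β / 2 * (c.snoc hw hb).interaction s) := by
    refine le_trans ?_ (Finset.sum_le_univ_sum_of_nonneg
      (s := Finset.univ.map ⟨_, c.snocSpin_injective hw hb⟩) fun s => (Real.exp_pos _).le)
    rw [Finset.sum_map, Finset.mul_sum]
    refine Finset.sum_le_sum fun s _ => ?_
    rw [← Real.exp_add]
    apply Real.exp_le_exp.2
    have := mul_le_mul_of_nonneg_left (c.interaction_snoc hw hb s) (by linarith : 0 ≤ β / 2)
    simp only [Function.Embedding.coeFn_mk]
    linarith
  have h2 : Real.exp (-μ * ((Fintype.card c.Tri + w.1 : ℕ) : ℝ)) =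
      Real.exp (-μ * w.1) * Real.exp (-μ * Fintype.card c.Tri) := by
    rw [← Real.exp_add]; push_cast; ring_nf
  rw [h2, sub_eq_add_neg, Real.exp_add]
  calc _ = Real.exp (-μ * w.1) * Real.exp (-μ * Fintype.card c.Tri) *
        (Real.exp (-(β / 2 * (3 * w.1 + a + b))) *
          ∑ s, Real.exp (β / 2 * c.interaction s)) := by ring
    _ ≤ _ := by gcongr

end Code

/-- A finite partition function stays finite when the last strip is removed and the length of the
boundary is changed. -/
theorem dualPartitionFunction_lt_top_of_succ {N l l' : ℕ} (hl : 0 < l) {β μ : ℝ} (hβ : 0 ≤ β)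
    (h : dualPartitionFunction (N + 1) l β μ < ∞) : dualPartitionFunction N l' β μ < ∞ := by
  rw [dualPartitionFunction_eq] at h ⊢
  have hw : ∀ c : Code N l', IsLayer l' l (StripWord.ofSet (l' + l) (Finset.range l)) :=
    fun c => isLayer_range l c.l_pos
  have hinj : Function.Injective fun c : Code N l' => c.snoc (hw c) hl := fun c c' h =>
    (Code.snoc_inj h).1
  have h1 : ENNReal.ofReal (Real.exp (-μ * (l' + l : ℕ) - β / 2 * (3 * (l' + l : ℕ) + l' + l))) *
      ∑' c : Code N l', c.map.dualWeight β μ < ∞ := by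
    rw [← ENNReal.tsum_mul_left]
    refine lt_of_le_of_lt (ENNReal.tsum_le_tsum fun c => c.dualWeight_snoc (hw c) hl hβ μ)
      (lt_of_le_of_lt (ENNReal.tsum_comp_le_tsum_of_injective hinj
        fun c => c.map.dualWeight β μ) h)
  refine ENNReal.lt_top_of_mul_ne_top_right h1.ne ?_
  simpa using Real.exp_pos _

/-! ### Lower bound: slices of equal length -/

/-- The words between two slices of length `m + 1`. -/
def balancedWords (m : ℕ) : Finset StripWord :=
  ((Finset.range (2 * m + 1)).powersetCard (m + 1)).image (StripWord.ofSet (m + 1 + (m + 1)))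

theorem card_balancedWords (m : ℕ) : (balancedWords m).card = (2 * m + 1).choose (m + 1) := by
  rw [balancedWords, Finset.card_image_of_injOn, Finset.card_powersetCard, Finset.card_range]
  intro S hS S' hS' h
  have hS := (Finset.mem_powersetCard.1 hS).1
  have hS' := (Finset.mem_powersetCard.1 hS').1
  ext k
  by_cases hk : k < m + 1 + (m + 1)
  · have := congrArg (fun w : StripWord => w.bit k) h
    simp only [StripWord.ofSet, StripWord.bit_mk _ hk] at this
    simpa using this
  · constructor <;> intro h
    · have := Finset.mem_range.1 (hS h); omega
    · have := Finset.mem_range.1 (hS' h); omega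

theorem isLayer_of_mem_balancedWords {m : ℕ} {w : StripWord} (hw : w ∈ balancedWords m) :
    IsLayer (m + 1) (m + 1) w := by
  obtain ⟨S, hS, rfl⟩ := Finset.mem_image.1 hw
  obtain ⟨h1, h2⟩ := Finset.mem_powersetCard.1 hS
  exact isLayer_ofSet (Nat.succ_pos m) (h1.trans (Finset.range_subset_range.2 (by omega))) h2

theorem length_of_mem_balancedWords {m : ℕ} {w : StripWord} (hw : w ∈ balancedWords m) :
    w.1 = 2 * (m + 1) := by
  obtain ⟨S, -, rfl⟩ := Finset.mem_image.1 hw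
  exact (two_mul _).symm

/-- The disc made of `a` triangles around the root. -/
def diskCode (a : ℕ) (ha : 0 < a) : Code 1 a := by
  refine ⟨Function.update (fun _ => ⟨0, fun _ => false⟩) 0 (StripWord.ofSet a (Finset.range a)), ?_⟩
  have h0 : Function.update (fun _ => (⟨0, fun _ => false⟩ : StripWord)) 0
      (StripWord.ofSet a (Finset.range a)) 0 = StripWord.ofSet a (Finset.range a) :=
    Function.update_self _ _ _
  have h1 : (StripWord.ofSet a (Finset.range a)).cnt true a = a :=
    (StripWord.cnt_ofSet subset_rfl).trans (Finset.card_range a)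
  constructor
  · exact Nat.one_pos
  · intro i hi
    exact Function.update_of_ne (by omega) _ _
  · rw [h0]
    intro k (hk : k < a)
    rw [StripWord.ofSet, StripWord.bit_mk _ hk]
    simpa using hk
  · intro i hi
    omega
  · intro i h0 hi
    omega
  · intro i hi
    obtain rfl : i = 0 := by omega
    rw [h0]
    exact ha.trans_eq h1.symm
  · rw [Nat.sub_self, h0]
    exact h1

theorem card_tri_diskCode (a : ℕ) (ha : 0 < a) : Fintype.card (diskCode a ha).Tri = a := by
  rw [Code.card_tri, Finset.sum_range_one]
  rfl

/-- Many triangulations all of whose slices have the same length. -/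
theorem exists_codes (m K : ℕ) : ∃ C : Finset (Code (K + 1) (m + 1)),
    C.card = (2 * m + 1).choose (m + 1) ^ K ∧
      ∀ c ∈ C, Fintype.card c.Tri = (m + 1) + K * (2 * (m + 1)) := by
  classical
  induction K with
  | zero => exact ⟨{diskCode (m + 1) m.succ_pos}, by simp, by simp [card_tri_diskCode]⟩
  | succ K ih =>
    obtain ⟨C, h1, h2⟩ := ih
    have hinj : Function.Injective fun x : Code (K + 1) (m + 1) × {w // w ∈ balancedWords m} =>
        x.1.snoc (isLayer_of_mem_balancedWords x.2.2) m.succ_pos := fun x y h => by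
      obtain ⟨h3, h4⟩ := Code.snoc_inj h
      exact Prod.ext h3 (Subtype.ext h4)
    refine ⟨(C ×ˢ (balancedWords m).attach).map ⟨_, hinj⟩, ?_, ?_⟩
    · rw [Finset.card_map, Finset.card_product, Finset.card_attach, h1,
        card_balancedWords, pow_succ]
    · intro c hc
      obtain ⟨x, hx, rfl⟩ := Finset.mem_map.1 hc
      show Fintype.card (x.1.snoc (isLayer_of_mem_balancedWords x.2.2) m.succ_pos).Tri = _
      rw [Code.card_tri_snoc, h2 _ (Finset.mem_product.1 hx).1,
        length_of_mem_balancedWords x.2.2]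
      ring

theorem le_choose (m : ℕ) : (4 : ℝ) ^ (m + 1) / (4 * (m + 1)) ≤ (2 * m + 1).choose (m + 1) := by
  have h1 := Nat.four_pow_le_two_mul_self_mul_centralBinom (m + 1) m.succ_pos
  have h2 : (m + 1).centralBinom = 2 * (2 * m + 1).choose (m + 1) := by
    rw [Nat.centralBinom, show 2 * (m + 1) = (2 * m + 1) + 1 by ring, Nat.choose_succ_succ,
      Nat.choose_symm_half]
    ring
  rw [h2] at h1
  have h3 : (4 : ℝ) ^ (m + 1) ≤ 2 * (m + 1) * (2 * (2 * m + 1).choose (m + 1)) := by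
    exact_mod_cast h1
  rw [div_le_iff₀ (by positivity)]
  linarith

/-- When every triangle contributes at least `b` to the exponent, the entropy `log 2` per triangle
of the triangulations comes on top; a fixed number of strips loses a fraction of it. -/
theorem le_of_dualPartitionFunction_lt_top {K l : ℕ} (hl : 0 < l) {β μ b : ℝ}
    (hb : ∀ c : Code (K + 2) l,
      ENNReal.ofReal (Real.exp ((b - μ) * Fintype.card c.Tri)) ≤ c.map.dualWeight β μ)
    (h : dualPartitionFunction (K + 2) l β μ < ∞) :
    b + K / (K + 1) * Real.log 2 ≤ μ := by
  by_contra! hlt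
  rw [dualPartitionFunction_eq] at h
  set θ : ℝ := 2 * K * Real.log 2 + 2 * (K + 1) * (b - μ) with hθ
  have hθ0 : 0 < θ := by
    have : μ * (K + 1) < (b + K / (K + 1) * Real.log 2) * (K + 1) :=
      mul_lt_mul_of_pos_right hlt (by positivity)
    have h2 : (b + K / (K + 1) * Real.log 2) * (K + 1) = b * (K + 1) + K * Real.log 2 := by
      field_simp
    rw [hθ]
    linarith
  -- the contribution of the triangulations with slices of length `m + 1`
  have key : ∀ m : ℕ, ENNReal.ofReal (Real.exp (θ * (m + 1 : ℕ)) / ((m + 1 : ℕ) : ℝ) ^ (K : ℝ) *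
      (Real.exp ((b - μ) * l) / 4 ^ K)) ≤ ∑' c : Code (K + 2) l, c.map.dualWeight β μ := by
    intro m
    obtain ⟨C, h1, h2⟩ := exists_codes m K
    have hinj : Function.Injective fun c : Code (K + 1) (m + 1) =>
        c.snoc (isLayer_range l m.succ_pos) hl := fun c c' h => (Code.snoc_inj h).1
    refine le_trans ?_ (ENNReal.tsum_comp_le_tsum_of_injective hinj fun c => c.map.dualWeight β μ)
    refine le_trans ?_ (ENNReal.sum_le_tsum C)
    have h3 : ∀ c ∈ C, ENNReal.ofReal (Real.exp ((b - μ) * (2 * (K + 1) * (m + 1) + l))) ≤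
        (c.snoc (isLayer_range l m.succ_pos) hl).map.dualWeight β μ := by
      intro c hc
      refine le_trans (le_of_eq ?_) (hb _)
      rw [Code.card_tri_snoc, h2 c hc]
      congr 3
      show _ = (((m + 1 + K * (2 * (m + 1)) + (m + 1 + l) : ℕ)) : ℝ)
      push_cast
      ring
    refine le_trans ?_ (Finset.card_nsmul_le_sum _ _ _ h3)
    rw [h1, nsmul_eq_mul, ← ENNReal.ofReal_natCast, ← ENNReal.ofReal_mul (Nat.cast_nonneg _)]
    refine ENNReal.ofReal_le_ofReal ?_
    have h4 : ((4 : ℝ) ^ (m + 1) / (4 * (m + 1))) ^ K ≤ ((2 * m + 1).choose (m + 1) : ℝ) ^ K :=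
      pow_le_pow_left₀ (by positivity) (le_choose m) K
    have h5 : ((4 : ℝ) ^ (m + 1)) ^ K = Real.exp (2 * K * Real.log 2 * (m + 1)) := by
      rw [show (4 : ℝ) = 2 ^ 2 by norm_num, ← pow_mul, ← pow_mul,
        show 2 * K * Real.log 2 * (m + 1) = ((2 * (m + 1) * K : ℕ) : ℝ) * Real.log 2 by
          push_cast; ring, Real.exp_nat_mul, Real.exp_log two_pos, mul_assoc 2]
    have h6 : Real.exp (θ * (m + 1)) * Real.exp ((b - μ) * l) =
        Real.exp (2 * K * Real.log 2 * (m + 1)) *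
          Real.exp ((b - μ) * (2 * (K + 1) * (m + 1) + l)) := by
      rw [← Real.exp_add, ← Real.exp_add, hθ]
      ring_nf
    push_cast
    calc _ = ((4 : ℝ) ^ (m + 1) / (4 * (m + 1))) ^ K *
          Real.exp ((b - μ) * (2 * (K + 1) * (m + 1) + l)) := by
          rw [div_pow, h5, Real.rpow_natCast, mul_pow, div_mul_div_comm, h6, mul_comm (4 ^ K),
            mul_div_right_comm]
      _ ≤ _ := by gcongr
  have h6 : Tendsto (fun m : ℕ => Real.exp (θ * (m + 1 : ℕ)) / ((m + 1 : ℕ) : ℝ) ^ (K : ℝ) *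
      (Real.exp ((b - μ) * l) / 4 ^ K)) atTop atTop :=
    (((tendsto_exp_mul_div_rpow_atTop K θ hθ0).comp tendsto_natCast_atTop_atTop).comp
      (tendsto_add_atTop_nat 1)).atTop_mul_const (by positivity)
  obtain ⟨m, hm⟩ := (h6.eventually_gt_atTop
    (∑' c : Code (K + 2) l, c.map.dualWeight β μ).toReal).exists
  have h7 := (ENNReal.ofReal_le_iff_le_toReal h.ne).1 (key m)
  exact absurd hm (not_lt.2 h7)

/-! ### Critical points and the critical line -/

theorem threshold_mono {Z Z' : ℝ → ℝ≥0∞} (h : ∀ μ, Z' μ < ∞ → Z μ < ∞) :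
    threshold Z ≤ threshold Z' :=
  sInf_le_sInf (Set.image_mono fun μ => h μ)

theorem threshold_le {Z : ℝ → ℝ≥0∞} {u : ℝ} (h : ∀ μ, u < μ → Z μ < ∞) : threshold Z ≤ u :=
  EReal.le_of_forall_lt_iff_le.1 fun μ hμ =>
    sInf_le (Set.mem_image_of_mem _ (h μ (EReal.coe_lt_coe_iff.1 hμ)))

theorem le_threshold {Z : ℝ → ℝ≥0∞} {b : ℝ} (h : ∀ μ, Z μ < ∞ → b ≤ μ) : b ≤ threshold Z := by
  refine le_sInf ?_
  rintro _ ⟨μ, hμ, rfl⟩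
  exact EReal.coe_le_coe_iff.2 (h μ hμ)

theorem threshold_le_add {Z Z' : ℝ → ℝ≥0∞} {a : ℝ} (h : ∀ μ, Z μ < ∞ → Z' (μ + a) < ∞) :
    threshold Z' ≤ threshold Z + a := by
  rw [← EReal.sub_le_iff_le_add (.inl (EReal.coe_ne_bot a)) (.inl (EReal.coe_ne_top a))]
  refine le_sInf ?_
  rintro _ ⟨μ, hμ, rfl⟩
  rw [EReal.sub_le_iff_le_add (.inl (EReal.coe_ne_bot a)) (.inl (EReal.coe_ne_top a)),
    ← EReal.coe_add]
  exact sInf_le (Set.mem_image_of_mem _ (h μ hμ))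

theorem dualCriticalPoint_le (N l : ℕ) {β : ℝ} (hβ : 0 ≤ β) : dualCriticalPoint N l β ≤
    ((2 * Real.log 2 + 1 / 2 * β + Real.log (Real.cosh β) : ℝ) : EReal) :=
  threshold_le fun _ hμ => dualPartitionFunction_lt_top N l hβ hμ

theorem dualCriticalPoint_le_succ {N l l' : ℕ} (hl : 0 < l) {β : ℝ} (hβ : 0 ≤ β) :
    dualCriticalPoint N l' β ≤ dualCriticalPoint (N + 1) l β :=
  threshold_mono fun _ h => dualPartitionFunction_lt_top_of_succ hl hβ h

theorem dualCriticalPoint_mono (N l : ℕ) : MonotoneOn (dualCriticalPoint N l) (Set.Ici 0) :=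
  fun _ hβ _ hβ' h => threshold_mono fun μ => lt_of_le_of_lt
    (ENNReal.tsum_le_tsum fun T => T.toMap.dualWeight_mono μ hβ hβ' h)

theorem le_dualCriticalPoint_cosh (K : ℕ) {l : ℕ} (hl : 0 < l) {β : ℝ} (hβ : 0 ≤ β) :
    ((Real.log 2 + 3 / 2 * Real.log (Real.cosh β) + K / (K + 1) * Real.log 2 : ℝ) : EReal) ≤
      dualCriticalPoint (K + 2) l β :=
  le_threshold fun μ hμ => le_of_dualPartitionFunction_lt_top hl
    (fun c => c.triangleCount_map ▸ c.isCausal.le_dualWeight_cosh hβ μ) hμ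

theorem le_dualCriticalPoint_ground (K : ℕ) {l : ℕ} (hl : 0 < l) {β : ℝ} (hβ : 0 ≤ β) :
    ((3 / 2 * β + K / (K + 1) * Real.log 2 : ℝ) : EReal) ≤ dualCriticalPoint (K + 2) l β :=
  le_threshold fun μ hμ => le_of_dualPartitionFunction_lt_top hl
    (fun c => c.triangleCount_map ▸ c.isCausal.le_dualWeight_ground hβ μ) hμ

/-- The supremum in the definition of the dual critical line is finite. -/
theorem coe_dualCriticalLine {β : ℝ} (hβ : 0 ≤ β) :
    (dualCriticalLine β : EReal) = ⨆ N, ⨆ l, dualCriticalPoint N l β := by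
  refine EReal.coe_toReal (ne_of_lt ?_) (ne_of_gt ?_)
  · exact lt_of_le_of_lt (iSup₂_le fun N l => dualCriticalPoint_le N l hβ) (EReal.coe_lt_top _)
  · exact lt_of_lt_of_le (EReal.bot_lt_coe _) ((le_dualCriticalPoint_ground 0 one_pos hβ).trans
      (le_iSup₂ (f := fun N l => dualCriticalPoint N l β) _ _))

theorem dualCriticalLine_le {β : ℝ} (hβ : 0 ≤ β) :
    dualCriticalLine β ≤ 2 * Real.log 2 + 1 / 2 * β + Real.log (Real.cosh β) := by
  rw [← EReal.coe_le_coe_iff, coe_dualCriticalLine hβ]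
  exact iSup₂_le fun N l => dualCriticalPoint_le N l hβ

theorem le_dualCriticalLine {β b : ℝ} (hβ : 0 ≤ β)
    (h : ∀ K : ℕ, ((b + K / (K + 1) * Real.log 2 : ℝ) : EReal) ≤ dualCriticalPoint (K + 2) 1 β) :
    b + Real.log 2 ≤ dualCriticalLine β := by
  have h1 : Tendsto (fun K : ℕ => b + K / (K + 1) * Real.log 2) atTop
      (𝓝 (b + 1 * Real.log 2)) :=
    ((tendsto_natCast_div_add_atTop (1 : ℝ)).mul_const _).const_add b
  rw [one_mul] at h1
  refine le_of_tendsto' h1 fun K => ?_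
  rw [← EReal.coe_le_coe_iff, coe_dualCriticalLine hβ]
  exact (h K).trans (le_iSup₂ (f := fun N l => dualCriticalPoint N l β) _ _)

theorem le_dualCriticalLine_cosh {β : ℝ} (hβ : 0 ≤ β) :
    2 * Real.log 2 + 3 / 2 * Real.log (Real.cosh β) ≤ dualCriticalLine β := by
  have := le_dualCriticalLine hβ fun K => le_dualCriticalPoint_cosh K one_pos hβ
  linarith

theorem le_dualCriticalLine_ground {β : ℝ} (hβ : 0 ≤ β) :
    Real.log 2 + 3 / 2 * β ≤ dualCriticalLine β := by
  have := le_dualCriticalLine hβ fun K => le_dualCriticalPoint_ground K one_pos hβ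
  linarith

theorem tendsto_dualCriticalPoint {β : ℝ} (hβ : 0 ≤ β) {l : ℕ} (hl : 1 ≤ l) :
    Tendsto (fun N : ℕ => dualCriticalPoint N l β) atTop (𝓝 (dualCriticalLine β : EReal)) := by
  have h1 : (⨆ N, ⨆ l', dualCriticalPoint N l' β) = ⨆ N, dualCriticalPoint N l β :=
    le_antisymm
      (iSup₂_le fun N l' => (dualCriticalPoint_le_succ hl hβ).trans
        (le_iSup (fun N => dualCriticalPoint N l β) (N + 1)))
      (iSup_mono fun N => le_iSup (fun l' => dualCriticalPoint N l' β) l)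
  rw [coe_dualCriticalLine hβ, h1]
  exact tendsto_atTop_iSup (monotone_nat_of_le_succ fun N => dualCriticalPoint_le_succ hl hβ)

theorem monotoneOn_dualCriticalLine : MonotoneOn dualCriticalLine (Set.Ici 0) := by
  intro β hβ β' hβ' h
  rw [← EReal.coe_le_coe_iff, coe_dualCriticalLine hβ, coe_dualCriticalLine hβ']
  exact iSup₂_mono fun N l => dualCriticalPoint_mono N l hβ hβ' h

theorem dualPartitionFunction_dual (N l : ℕ) {β βs : ℝ} (hβ : 0 < β)
    (h : Real.tanh βs = Real.exp (-2 * β)) (μ : ℝ) :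
    dualPartitionFunction N l βs
        (μ + 1 / 4 * Real.log 2 - 3 / 4 * Real.log (Real.sinh (2 * β))) =
      ENNReal.ofReal ((2 * Real.sinh (2 * β)) ^ (-(l : ℝ) / 4)) * partitionFunction N l β μ := by
  rw [dualPartitionFunction, partitionFunction, ← ENNReal.tsum_mul_left]
  exact tsum_congr fun T => T.isCausal.dualWeight_dual hβ h μ

/-- The duality of the partition functions moves every threshold by the same amount. -/
theorem dualCriticalLine_dual {β βs : ℝ} (hβ : 0 < β) (h : Real.tanh βs = Real.exp (-2 * β)) :
    dualCriticalLine βs =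
      criticalLine β + 1 / 4 * Real.log 2 - 3 / 4 * Real.log (Real.sinh (2 * β)) := by
  have hs : 0 < Real.sinh (2 * β) := Real.sinh_pos_iff.2 (by linarith)
  have hβs : 0 ≤ βs := by
    by_contra! hlt
    have h1 := tanh_le_tanh hlt.le
    rw [h, Real.tanh_zero] at h1
    exact absurd (Real.exp_pos (-2 * β)) (not_lt.2 h1)
  set a : ℝ := 1 / 4 * Real.log 2 - 3 / 4 * Real.log (Real.sinh (2 * β)) with ha
  have hfin : ∀ N l μ,
      dualPartitionFunction N l βs (μ + a) < ∞ ↔ partitionFunction N l β μ < ∞ := by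
    intro N l μ
    have h1 : μ + a = μ + 1 / 4 * Real.log 2 - 3 / 4 * Real.log (Real.sinh (2 * β)) := by
      rw [ha]; ring
    rw [h1, dualPartitionFunction_dual N l hβ h]
    constructor
    · intro h2
      refine ENNReal.lt_top_of_mul_ne_top_right h2.ne ?_
      simpa using Real.rpow_pos_of_pos (by positivity) _
    · exact ENNReal.mul_lt_top ENNReal.ofReal_lt_top
  have h1 : (dualCriticalLine βs : EReal) ≤ (⨆ N, ⨆ l, criticalPoint N l β) + a := by
    rw [coe_dualCriticalLine hβs]
    refine iSup₂_le fun N l => (threshold_le_add fun μ => (hfin N l μ).2).trans ?_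
    exact add_le_add_left (le_iSup₂ (f := fun N l => criticalPoint N l β) N l) _
  have h2 : (⨆ N, ⨆ l, criticalPoint N l β) ≤ ((dualCriticalLine βs + -a : ℝ) : EReal) := by
    rw [EReal.coe_add, coe_dualCriticalLine hβs]
    refine iSup₂_le fun N l => (threshold_le_add (a := -a) fun μ hμ => ?_).trans
      (add_le_add_left (le_iSup₂ (f := fun N l => dualCriticalPoint N l βs) N l) _)
    rw [← hfin, neg_add_cancel_right]
    exact hμ
  have h3 : (⨆ N, ⨆ l, criticalPoint N l β) = (criticalLine β : EReal) := by
    refine (EReal.coe_toReal (ne_of_lt (h2.trans_lt (EReal.coe_lt_top _))) fun hbot => ?_).symm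
    rw [hbot, EReal.bot_add] at h1
    exact absurd (EReal.bot_lt_coe _) (not_lt.2 h1)
  rw [h3, ← EReal.coe_add, EReal.coe_le_coe_iff] at h1
  rw [h3, EReal.coe_le_coe_iff] at h2
  linarith

theorem log_cosh_le {β : ℝ} (hβ : 0 ≤ β) : Real.log (Real.cosh β) ≤ β := by
  rw [Real.log_le_iff_le_exp (Real.cosh_pos β), Real.cosh_eq]
  have := Real.exp_le_exp.2 (by linarith : -β ≤ β)
  linarith

theorem log_two_add_log_cosh_le (β : ℝ) :
    Real.log 2 + Real.log (Real.cosh β) - β ≤ Real.exp (-2 * β) := by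
  have h1 : Real.log 2 + Real.log (Real.cosh β) - β =
      Real.log (2 * Real.cosh β * Real.exp (-β)) := by
    have := Real.cosh_pos β
    rw [Real.log_mul (by positivity) (Real.exp_pos _).ne', Real.log_mul two_ne_zero this.ne',
      Real.log_exp]
    ring
  have h2 : 2 * Real.cosh β * Real.exp (-β) = Real.exp (-2 * β) + 1 := by
    rw [Real.cosh_eq, show -2 * β = -β + -β by ring, Real.exp_add]
    have : Real.exp β * Real.exp (-β) = 1 := by rw [← Real.exp_add]; simp
    linear_combination this
  rw [h1, h2]
  have := Real.log_le_sub_one_of_pos (by positivity : 0 < Real.exp (-2 * β) + 1)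
  linarith

theorem isBigO_dualCriticalLine_zero :
    (fun βs : ℝ => dualCriticalLine βs - 2 * Real.log 2) =O[𝓝[>] 0] fun βs : ℝ => βs := by
  refine IsBigO.of_bound (3 / 2) ?_
  filter_upwards [self_mem_nhdsWithin] with β (hβ : 0 < β)
  have h1 := le_dualCriticalLine_cosh hβ.le
  have h2 := dualCriticalLine_le hβ.le
  have h3 := log_cosh_le hβ.le
  have h4 := Real.log_nonneg (Real.one_le_cosh β)
  rw [Real.norm_eq_abs, Real.norm_eq_abs, abs_of_pos hβ, abs_of_nonneg (by linarith)]
  linarith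

theorem isBigO_dualCriticalLine_atTop :
    (fun βs : ℝ => dualCriticalLine βs - (Real.log 2 + 3 / 2 * βs)) =O[atTop]
      fun βs : ℝ => Real.exp (-2 * βs) := by
  refine IsBigO.of_bound 1 ?_
  filter_upwards [eventually_ge_atTop 0] with β hβ
  have h1 := le_dualCriticalLine_ground hβ
  have h2 := dualCriticalLine_le hβ
  have h3 := log_two_add_log_cosh_le β
  rw [Real.norm_eq_abs, Real.norm_eq_abs, abs_of_nonneg (Real.exp_pos _).le,
    abs_of_nonneg (by linarith)]
  linarith

end CDT

theorem mainTheorem3 :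
    (∀ β βs : ℝ, 0 < β → Real.tanh βs = Real.exp (-2 * β) →
      (∀ N l : ℕ, 1 ≤ N → 1 ≤ l → ∀ μ : ℝ,
        CDT.dualPartitionFunction N l βs
            (μ + 1 / 4 * Real.log 2 - 3 / 4 * Real.log (Real.sinh (2 * β))) =
          ENNReal.ofReal ((2 * Real.sinh (2 * β)) ^ (-(l : ℝ) / 4)) *
            CDT.partitionFunction N l β μ) ∧
      CDT.dualCriticalLine βs =
        CDT.criticalLine β + 1 / 4 * Real.log 2 - 3 / 4 * Real.log (Real.sinh (2 * β))) ∧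
    (∀ βs : ℝ, 0 ≤ βs → ∀ l : ℕ, 1 ≤ l →
      Tendsto (fun N : ℕ => CDT.dualCriticalPoint N l βs) atTop
        (𝓝 (CDT.dualCriticalLine βs : EReal))) ∧
    MonotoneOn CDT.dualCriticalLine (Set.Ici 0) ∧
    {βs : ℝ | 0 ≤ βs ∧
      ¬ ContinuousWithinAt CDT.dualCriticalLine (Set.Ici 0) βs}.Countable ∧
    (∀ βs : ℝ, 0 ≤ βs →
      max (2 * Real.log 2 + 3 / 2 * Real.log (Real.cosh βs)) (Real.log 2 + 3 / 2 * βs) ≤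
          CDT.dualCriticalLine βs ∧
        CDT.dualCriticalLine βs ≤
          2 * Real.log 2 + 1 / 2 * βs + Real.log (Real.cosh βs)) ∧
    (fun βs : ℝ => CDT.dualCriticalLine βs - 2 * Real.log 2)
      =O[𝓝[>] 0] (fun βs : ℝ => βs) ∧
    (fun βs : ℝ => CDT.dualCriticalLine βs - (Real.log 2 + 3 / 2 * βs))
      =O[atTop] (fun βs : ℝ => Real.exp (-2 * βs)) :=
  ⟨fun _ _ hβ h => ⟨fun N l _ _ μ => CDT.dualPartitionFunction_dual N l hβ h μ,
      CDT.dualCriticalLine_dual hβ h⟩,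
    fun _ hβs _ hl => CDT.tendsto_dualCriticalPoint hβs hl,
    CDT.monotoneOn_dualCriticalLine,
    CDT.monotoneOn_dualCriticalLine.countable_not_continuousWithinAt,
    fun _ hβs => ⟨max_le (CDT.le_dualCriticalLine_cosh hβs) (CDT.le_dualCriticalLine_ground hβs),
      CDT.dualCriticalLine_le hβs⟩,
    CDT.isBigO_dualCriticalLine_zero, CDT.isBigO_dualCriticalLine_atTop⟩
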